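/- Let $p,q\in\mathbb C$ with $0<|p|,|q|<1$, let $(a;q)_\infty=\prod_{n\ge 0}(1-aq^n)$ and let $$\Gamma(z)=\Gamma(z;p,q)=\prod_{j,k=0}^\infty\frac{1-z^{-1}p^{j+1}q^{k+1}}{1-zp^jq^k}$$ be the elliptic gamma function. Write $\Gamma(a_1,\dots,a_m)=\Gamma(a_1)\cdots\Gamma(a_m)$, $\Gamma(az^{\pm})=\Gamma(az)\Gamma(az^{-1})$, $\Gamma(z^{\pm2})=\Gamma(z^2)\Gamma(z^{-2})$, $\Gamma(aw^\pm z^\pm)=\Gamma(awz)\Gamma(awz^{-1})\Gamma(aw^{-1}z)\Gamma(aw^{-1}z^{-1})$, let $\kappa=\frac{(q;q)_\infty(p;p)_\infty}{4\pi i}$, and let $\mathbb T$ be the positively oriented unit circle. Two complex-valued functions $\alpha(z,t)$, $\beta(z,t)$ of $z\in\mathbb T$ form an *elliptic integral Bailey pair with respect to the parameter* $t$ if for every $w\in\mathbb T$ the following integral converges absolutely and $$\beta(w,t)=\kappa\int_{\mathbb T}\Gamma(tw^\pm z^\pm)\,\alpha(z,t)\,\frac{dz}{z}.$$ **Theorem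 (first integral Bailey lemma).** Let $s,t,u\in\mathbb C$ satisfy $|s|,|t|,|u|<1$ and $|pq|<|t^2s^2u|$, and let $\alpha(z,t)$, $\beta(z,t)$ be an elliptic integral Bailey pair with respect to $t$. Then the functions of $w\in\mathbb T$ $$\alpha'(w,st)=\frac{\Gamma(tuw^\pm)}{\Gamma(ts^2uw^\pm)}\,\alpha(w,t),$$ $$\beta'(w,st)=\kappa\,\frac{\Gamma(t^2s^2,\,t^2suw^\pm)}{\Gamma(s^2,\,t^2,\,suw^\pm)} \int_{\mathbb T}\frac{\Gamma(sw^\pm x^\pm,\,ux^\pm)}{\Gamma(x^{\pm2},\,t^2s^2ux^\pm)}\,\beta(x,t)\,\frac{dx}{x}$$ (where the last integral converges absolutely, and $1/\Gamma(x^{\pm2})$ is read as $0$ at $x=\pm1$) form an elliptic integral Bailey pair with respect to the parameter $st$. -/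

import Mathlib

noncomputable section

/-- The infinite `q`-Pochhammer symbol `(a; q)_∞ = ∏_{n ≥ 0} (1 - a qⁿ)`. -/
def qPochhammerInf (a q : ℂ) : ℂ := ∏' n : ℕ, (1 - a * q ^ n)

/-- The standard elliptic gamma function
`Γ(z; p, q) = ∏_{j, k ≥ 0} (1 - z⁻¹ p^(j+1) q^(k+1)) / (1 - z p^j q^k)`.
At its poles this expression takes the value `0` (division by zero), so that `1 / Γ` has its
true value `0` there. -/
def ellipticGamma (p q z : ℂ) : ℂ :=
  ∏' jk : ℕ × ℕ,
    (1 - z⁻¹ * p ^ (jk.1 + 1) * q ^ (jk.2 + 1)) / (1 - z * p ^ jk.1 * q ^ jk.2)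

/-- `Γ(a z^±) = Γ(a z) Γ(a z⁻¹)`. -/
def ellipticGammaPM (p q a z : ℂ) : ℂ :=
  ellipticGamma p q (a * z) * ellipticGamma p q (a * z⁻¹)

/-- `Γ(a w^± z^±)`, the product of `Γ(a w^ε z^δ)` over the four choices of signs `ε`, `δ`. -/
def ellipticGammaPMPM (p q a w z : ℂ) : ℂ :=
  ellipticGamma p q (a * w * z) * ellipticGamma p q (a * w * z⁻¹) *
    ellipticGamma p q (a * w⁻¹ * z) * ellipticGamma p q (a * w⁻¹ * z⁻¹)

/-- The constant `κ = (q; q)_∞ (p; p)_∞ / (4 π i)`. -/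
def baileyKappa (p q : ℂ) : ℂ :=
  qPochhammerInf q q * qPochhammerInf p p / (4 * (Real.pi : ℂ) * Complex.I)

/-- `α = α(·, t)` and `β = β(·, t)` form an elliptic integral Bailey pair with respect to `t`:
for every `w` on the unit circle `𝕋` the integral below converges and
`β(w, t) = κ ∫_𝕋 Γ(t w^± z^±) α(z, t) dz / z`.
Only the values of `α` and `β` on `𝕋` matter. -/
def IsEllipticBaileyPair (p q t : ℂ) (α β : ℂ → ℂ) : Prop :=
  ∀ w ∈ Metric.sphere (0 : ℂ) 1,
    CircleIntegrable (fun z => ellipticGammaPMPM p q t w z * α z / z) 0 1 ∧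
    β w = baileyKappa p q *
      ∮ z in C(0, 1), ellipticGammaPMPM p q t w z * α z / z

/-- `α'(w, st) = Γ(t u w^±) / Γ(t s² u w^±) · α(w, t)`. -/
def firstBaileyAlpha (p q s t u : ℂ) (α : ℂ → ℂ) (w : ℂ) : ℂ :=
  ellipticGammaPM p q (t * u) w / ellipticGammaPM p q (t * s ^ 2 * u) w * α w

/-- The integrand (with respect to `dx`) in the definition of `β'(w, st)`:
`Γ(s w^± x^±, u x^±) / Γ(x^{±2}, t² s² u x^±) · β(x, t) / x`. -/
def firstBaileyIntegrand (p q s t u : ℂ) (β : ℂ → ℂ) (w x : ℂ) : ℂ :=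
  ellipticGammaPMPM p q s w x * ellipticGammaPM p q u x /
    (ellipticGammaPM p q 1 (x ^ 2) * ellipticGammaPM p q (t ^ 2 * s ^ 2 * u) x) * β x / x

/-- `β'(w, st) = κ Γ(t² s², t² s u w^±) / Γ(s², t², s u w^±) ·
  ∫_𝕋 Γ(s w^± x^±, u x^±) / Γ(x^{±2}, t² s² u x^±) β(x, t) dx / x`. -/
def firstBaileyBeta (p q s t u : ℂ) (β : ℂ → ℂ) (w : ℂ) : ℂ :=
  baileyKappa p q *
    (ellipticGamma p q (t ^ 2 * s ^ 2) * ellipticGammaPM p q (t ^ 2 * s * u) w /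
      (ellipticGamma p q (s ^ 2) * ellipticGamma p q (t ^ 2) * ellipticGammaPM p q (s * u) w)) *
    ∮ x in C(0, 1), firstBaileyIntegrand p q s t u β w x

end

open Filter Topology

/-! Insert the integral for β into β′ and exchange the two integrations
(`circleIntegral_circleIntegral_swap`). For fixed w and z on the circle, the inner integral over x
is Spiridonov's elliptic beta integral with the five parameters sw, s/w, tz, t/z, u, whose product
t²s²u depends on neither w nor z. Its evaluation `baileyKappa_mul_betaIntegral` is a product of
gamma functions. Against the prefactor of β′ all of it cancels except Γ(st w^± z^±) Γ(tu z^±) /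
Γ(ts²u z^±) (`bailey_betaProduct`), which is the kernel for st times the multiplier in α′. Fubini
needs α itself to be integrable; this follows from the pair relation at w = 1, whose kernel Γ(t
z^±)² is continuous and has no zeros.

The bulk of the work is the beta integral, proved by showing that the quotient `betaRatio` of its
two sides is 1.

Invariance under a ↦ qa (`betaRatio_mul_left`): a theta function identity, deduced from the
three-term relation, writes a combination of the integrands at qa and a as a constant times K(z) +
K(1/z). Here K is holomorphic on 1 ≤ |z| ≤ 1/|q| and K(z/q) = -K(1/z), so Cauchy's theorem gives ∮ K
dz/z = 0. The three-term relation comes from the Jacobi triple product.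

Constancy (`betaRatio_eq_of_lt`): if all parameters are close to the unit circle, the admissible a
fill an annulus wider than a fundamental annulus for multiplication by q. An invariant holomorphic
function attains its maximum there and is constant; by symmetry the same holds in b.

The value (`betaRatio_eq_one_of_lt`): take a = ir, b = -ir and let r → 1. Poles pinch the contour at
±i, the integrand becomes a Poisson kernel times a continuous function, and the limit is read off at
±i.

Continuation (`betaRatio_eq_one`): along ζ ↦ (a^ζ, …, e^ζ) the admissible ζ form a convex open set,
containing 1 and all small positive numbers, where the parameters are close to the unit circle. -/

/-! ### Infinite products of linear factors -/

lemma multipliable_one_sub_mul {ι : Type*} {c : ι → ℂ} (hc : Summable fun i => ‖c i‖) (z : ℂ) :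
    Multipliable fun i => 1 - z * c i := by
  have h : Summable fun i => ‖-(z * c i)‖ := by
    simpa only [norm_neg, norm_mul] using hc.mul_left ‖z‖
  simpa only [sub_eq_add_neg] using multipliable_one_add_of_summable h

lemma tprod_one_sub_mul_ne_zero {ι : Type*} {c : ι → ℂ} (hc : Summable fun i => ‖c i‖) {z : ℂ}
    (hz : ∀ i, 1 - z * c i ≠ 0) : ∏' i, (1 - z * c i) ≠ 0 := by
  have h : Summable fun i => ‖-(z * c i)‖ := by
    simpa only [norm_neg, norm_mul] using hc.mul_left ‖z‖
  simp only [sub_eq_add_neg] at hz ⊢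
  exact tprod_one_add_ne_zero_of_summable hz h

lemma differentiable_tprod_one_sub_mul {ι : Type*} {c : ι → ℂ}
    (hc : Summable fun i => ‖c i‖) : Differentiable ℂ fun z => ∏' i, (1 - z * c i) := by
  intro z
  have hu : Summable fun i => (‖z‖ + 1) * ‖c i‖ := hc.mul_left _
  have h := Summable.hasProdLocallyUniformlyOn_one_add (f := fun i z => -(z * c i))
    (K := Metric.ball (0 : ℂ) (‖z‖ + 1)) Metric.isOpen_ball hu
    (Filter.Eventually.of_forall fun i x hx => by
      rw [norm_neg, norm_mul]
      gcongr
      simpa using (Metric.mem_ball.1 hx).le) (fun i => by fun_prop)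
  simp only [← sub_eq_add_neg] at h
  refine (h.differentiableOn (.of_forall fun s => ?_) Metric.isOpen_ball).differentiableAt
    (Metric.isOpen_ball.mem_nhds (by simp))
  simpa [Finset.prod_fn] using DifferentiableOn.finsetProd (fun _ _ ↦ by fun_prop)

lemma one_sub_mul_ne_zero_of_norm_lt_one {z c : ℂ} (hz : ‖z‖ < 1) (hc : ‖c‖ ≤ 1) :
    1 - z * c ≠ 0 := by
  intro h
  have h1 : ‖z * c‖ = 1 := by rw [← sub_eq_zero.1 h, norm_one]
  rw [norm_mul] at h1
  nlinarith [norm_nonneg z, norm_nonneg c]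

lemma summable_norm_pow {q : ℂ} (hq : ‖q‖ < 1) : Summable fun n : ℕ => ‖q ^ n‖ := by
  simpa only [norm_pow] using summable_geometric_of_lt_one (norm_nonneg q) hq

lemma summable_norm_pow_mul_pow {p q : ℂ} (hp : ‖p‖ < 1) (hq : ‖q‖ < 1) :
    Summable fun jk : ℕ × ℕ => ‖p ^ jk.1 * q ^ jk.2‖ := by
  simp only [norm_mul]
  exact (summable_norm_pow hp).mul_of_nonneg (summable_norm_pow hq)
    (fun _ => norm_nonneg _) (fun _ => norm_nonneg _)

/-! ### The `q`-Pochhammer symbol -/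

lemma differentiable_qPochhammerInf {q : ℂ} (hq : ‖q‖ < 1) :
    Differentiable ℂ fun z => qPochhammerInf z q :=
  differentiable_tprod_one_sub_mul (summable_norm_pow hq)

lemma qPochhammerInf_ne_zero {q : ℂ} (hq : ‖q‖ < 1) {z : ℂ} (hz : ‖z‖ < 1) :
    qPochhammerInf z q ≠ 0 :=
  tprod_one_sub_mul_ne_zero (summable_norm_pow hq) fun n =>
    one_sub_mul_ne_zero_of_norm_lt_one hz (by
      rw [norm_pow]; exact pow_le_one₀ (norm_nonneg _) hq.le)

lemma qPochhammerInf_eq_mul {q : ℂ} (hq : ‖q‖ < 1) (z : ℂ) :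
    qPochhammerInf z q = (1 - z) * qPochhammerInf (q * z) q := by
  have h := (multipliable_one_sub_mul (summable_norm_pow hq) (q * z)).hasProd
  have e : (fun n : ℕ => 1 - q * z * q ^ n) = fun n => 1 - z * q ^ (n + 1) := by
    funext n
    rw [pow_succ]
    ring
  have h' : HasProd (fun n : ℕ => 1 - z * q ^ (n + 1)) (qPochhammerInf (q * z) q) := by
    rw [← e]
    exact h
  have := tprod_eq_zero_mul' (f := fun n : ℕ => 1 - z * q ^ n) h'.multipliable
  rw [h'.tprod_eq, pow_zero, mul_one] at this
  exact this

/-! ### The double Pochhammer symbol -/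

/-- The double Pochhammer symbol `(z; p, q)_∞ = ∏_{j, k ≥ 0} (1 - z p^j q^k)`. -/
noncomputable def doublePochhammer (p q z : ℂ) : ℂ :=
  ∏' jk : ℕ × ℕ, (1 - z * (p ^ jk.1 * q ^ jk.2))

lemma differentiable_doublePochhammer {p q : ℂ} (hp : ‖p‖ < 1) (hq : ‖q‖ < 1) :
    Differentiable ℂ (doublePochhammer p q) :=
  differentiable_tprod_one_sub_mul (summable_norm_pow_mul_pow hp hq)

lemma doublePochhammer_ne_zero {p q : ℂ} (hp : ‖p‖ < 1) (hq : ‖q‖ < 1) {z : ℂ} (hz : ‖z‖ < 1) :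
    doublePochhammer p q z ≠ 0 :=
  tprod_one_sub_mul_ne_zero (summable_norm_pow_mul_pow hp hq) fun jk =>
    one_sub_mul_ne_zero_of_norm_lt_one hz (by
      rw [norm_mul, norm_pow, norm_pow]
      exact mul_le_one₀ (pow_le_one₀ (norm_nonneg _) hp.le) (by positivity)
        (pow_le_one₀ (norm_nonneg _) hq.le))

lemma doublePochhammer_comm (p q z : ℂ) : doublePochhammer p q z = doublePochhammer q p z := by
  rw [doublePochhammer, doublePochhammer, ← (Equiv.prodComm ℕ ℕ).tprod_eq]
  simp [mul_comm]

lemma hasProd_doublePochhammer {p q : ℂ} (hp : ‖p‖ < 1) (hq : ‖q‖ < 1) (z : ℂ) :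
    HasProd (fun j : ℕ => qPochhammerInf (z * p ^ j) q) (doublePochhammer p q z) := by
  refine (multipliable_one_sub_mul (summable_norm_pow_mul_pow hp hq) z).hasProd.prod_fiberwise
    fun j => ?_
  simp only [← mul_assoc]
  exact (multipliable_one_sub_mul (summable_norm_pow hq) (z * p ^ j)).hasProd

lemma doublePochhammer_eq_mul_left {p q : ℂ} (hp : ‖p‖ < 1) (hq : ‖q‖ < 1) (z : ℂ) :
    doublePochhammer p q z = qPochhammerInf z q * doublePochhammer p q (p * z) := by
  have e : (fun j : ℕ => qPochhammerInf (z * p ^ (j + 1)) q) =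
      fun j => qPochhammerInf (p * z * p ^ j) q := by
    funext n; congr 1; ring
  have h := hasProd_doublePochhammer hp hq (p * z)
  rw [← (hasProd_doublePochhammer hp hq z).tprod_eq, tprod_eq_zero_mul' (e ▸ h.multipliable), e,
    h.tprod_eq, pow_zero, mul_one]

lemma doublePochhammer_eq_mul_right {p q : ℂ} (hp : ‖p‖ < 1) (hq : ‖q‖ < 1) (z : ℂ) :
    doublePochhammer p q z = qPochhammerInf z p * doublePochhammer p q (q * z) := by
  rw [doublePochhammer_comm, doublePochhammer_eq_mul_left hq hp, doublePochhammer_comm p q]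

/-! ### The modified theta function -/

/-- The modified Jacobi theta function `θ(z; p) = (z; p)_∞ (p / z; p)_∞`. -/
noncomputable def modTheta (p z : ℂ) : ℂ := qPochhammerInf z p * qPochhammerInf (p / z) p

lemma modTheta_mul_left {p : ℂ} (hp : ‖p‖ < 1) (hp₀ : p ≠ 0) {z : ℂ} (hz : z ≠ 0) :
    modTheta p (p * z) = -z⁻¹ * modTheta p z := by
  rw [modTheta, modTheta, qPochhammerInf_eq_mul hp z, qPochhammerInf_eq_mul hp (p / (p * z))]
  have : p * (p / (p * z)) = p / z := by field_simp
  rw [this]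
  field_simp
  ring

lemma modTheta_inv {p : ℂ} (hp : ‖p‖ < 1) {z : ℂ} (hz : z ≠ 0) :
    modTheta p z⁻¹ = -z⁻¹ * modTheta p z := by
  rw [modTheta, modTheta, qPochhammerInf_eq_mul hp z, qPochhammerInf_eq_mul hp z⁻¹,
    div_inv_eq_mul, div_eq_mul_inv]
  field_simp
  ring

lemma modTheta_ne_zero {p : ℂ} (hp : ‖p‖ < 1) {z : ℂ} (hz : ‖p‖ < ‖z‖) (hz' : ‖z‖ < 1) :
    modTheta p z ≠ 0 := by
  refine mul_ne_zero (qPochhammerInf_ne_zero hp hz') (qPochhammerInf_ne_zero hp ?_)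
  rw [norm_div, div_lt_one ((norm_nonneg _).trans_lt hz)]
  exact hz

lemma differentiableAt_modTheta {p : ℂ} (hp : ‖p‖ < 1) {z : ℂ} (hz : z ≠ 0) :
    DifferentiableAt ℂ (modTheta p) z := by
  have h := differentiable_qPochhammerInf hp
  exact (h z).mul ((h (p / z)).comp z (by fun_prop (disch := exact hz)))

/-! ### The elliptic gamma function -/

/-- If a denominator factor vanishes, division by zero makes both sides 0, so no assumption on z is
needed. -/
lemma ellipticGamma_eq_div {p q : ℂ} (hp : ‖p‖ < 1) (hq : ‖q‖ < 1) (z : ℂ) :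
    ellipticGamma p q z = doublePochhammer p q (p * q / z) / doublePochhammer p q z := by
  have hs := summable_norm_pow_mul_pow hp hq
  have e : ellipticGamma p q z = ∏' jk : ℕ × ℕ,
      (1 - p * q / z * (p ^ jk.1 * q ^ jk.2)) / (1 - z * (p ^ jk.1 * q ^ jk.2)) := by
    rw [ellipticGamma]
    congr 1
    funext jk
    congr 1 <;> ring
  by_cases h : ∀ jk : ℕ × ℕ, 1 - z * (p ^ jk.1 * q ^ jk.2) ≠ 0
  · rw [e]
    exact (multipliable_one_sub_mul hs _).tprod_div₀ (multipliable_one_sub_mul hs _)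
      (tprod_one_sub_mul_ne_zero hs h)
  · push Not at h
    obtain ⟨jk, h⟩ := h
    have h0 : doublePochhammer p q z = 0 := tprod_of_exists_eq_zero ⟨jk, h⟩
    rw [e, tprod_of_exists_eq_zero ⟨jk, by rw [h, div_zero]⟩, h0, div_zero]

lemma norm_mul_div_lt_one {a z : ℂ} (hz : ‖a‖ < ‖z‖) : ‖a / z‖ < 1 := by
  rwa [norm_div, div_lt_one ((norm_nonneg _).trans_lt hz)]

lemma ellipticGamma_ne_zero {p q : ℂ} (hp : ‖p‖ < 1) (hq : ‖q‖ < 1) {z : ℂ}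
    (hz : ‖p * q‖ < ‖z‖) (hz' : ‖z‖ < 1) : ellipticGamma p q z ≠ 0 := by
  rw [ellipticGamma_eq_div hp hq]
  exact div_ne_zero (doublePochhammer_ne_zero hp hq (norm_mul_div_lt_one hz))
    (doublePochhammer_ne_zero hp hq hz')

lemma differentiableAt_ellipticGamma {p q : ℂ} (hp : ‖p‖ < 1) (hq : ‖q‖ < 1) {z : ℂ}
    (hz : z ≠ 0) (hz' : ‖z‖ < 1) : DifferentiableAt ℂ (ellipticGamma p q) z := by
  rw [funext (ellipticGamma_eq_div hp hq)]
  have h := differentiable_doublePochhammer hp hq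
  exact ((h (p * q / z)).comp z (by fun_prop (disch := exact hz))).div (h z)
    (doublePochhammer_ne_zero hp hq hz')

/-- In the inverted quotient the denominator (pq/z; p, q)_∞ has no zeros for |z| > |pq|. The poles
of Γ are allowed: the value 0 assigned to Γ there makes its inverse 0, as it should be. This covers
1/Γ(z^{±2}) at z = ±1. -/
lemma differentiableAt_ellipticGamma_inv {p q : ℂ} (hp : ‖p‖ < 1) (hq : ‖q‖ < 1) {z : ℂ}
    (hz : ‖p * q‖ < ‖z‖) : DifferentiableAt ℂ (fun x => (ellipticGamma p q x)⁻¹) z := by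
  simp only [ellipticGamma_eq_div hp hq, inv_div]
  have h := differentiable_doublePochhammer hp hq
  have hz₀ : z ≠ 0 := norm_pos_iff.1 ((norm_nonneg _).trans_lt hz)
  exact (h z).div ((h (p * q / z)).comp z (by fun_prop (disch := exact hz₀)))
    (doublePochhammer_ne_zero hp hq (norm_mul_div_lt_one hz))

lemma ellipticGamma_mul_right {p q : ℂ} (hp : ‖p‖ < 1) (hq : ‖q‖ < 1) (hq₀ : q ≠ 0) {z : ℂ}
    (hz₀ : z ≠ 0) (hz : ‖z‖ < 1) :
    ellipticGamma p q (q * z) = modTheta p z * ellipticGamma p q z := by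
  have h1 := doublePochhammer_ne_zero hp hq hz
  rw [ellipticGamma_eq_div hp hq, ellipticGamma_eq_div hp hq, modTheta]
  have e : p * q / (q * z) = p / z := by field_simp
  have e' : q * (p / z) = p * q / z := by ring
  rw [doublePochhammer_eq_mul_right hp hq z] at h1 ⊢
  rw [e, doublePochhammer_eq_mul_right hp hq (p / z), e']
  have h2 := left_ne_zero_of_mul h1
  have h3 := right_ne_zero_of_mul h1
  field_simp

/-- Peeling one factor in each base off (z; p, q)_∞ and off (1/z; p, q)_∞ leaves (pqz; p, q)_∞ and
(pq/z; p, q)_∞, which are the numerators of the two gamma functions. The four peeled factors pair up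
into two theta functions. Applied to z², it turns the denominator Γ(z^{±2}) of the beta integrand
into theta functions. -/
lemma inv_ellipticGamma_mul_inv {p q : ℂ} (hp : ‖p‖ < 1) (hq : ‖q‖ < 1) (hp₀ : p ≠ 0)
    (hq₀ : q ≠ 0) {z : ℂ} (hz : ‖p * q‖ < ‖z‖) (hz' : ‖p * q‖ < ‖z⁻¹‖) :
    (ellipticGamma p q z * ellipticGamma p q z⁻¹)⁻¹ = modTheta p z * modTheta q z⁻¹ := by
  have hz₀ : z ≠ 0 := norm_pos_iff.1 ((norm_nonneg _).trans_lt hz)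
  have h1 := doublePochhammer_ne_zero hp hq (norm_mul_div_lt_one hz)
  have h2 := doublePochhammer_ne_zero hp hq (norm_mul_div_lt_one hz')
  rw [ellipticGamma_eq_div hp hq, ellipticGamma_eq_div hp hq, modTheta, modTheta]
  have e1 : p * (q * z) = p * q / z⁻¹ := by field_simp
  have e2 : q * (p * z⁻¹) = p * q / z := by field_simp
  rw [doublePochhammer_eq_mul_right hp hq z, doublePochhammer_eq_mul_left hp hq (q * z),
    doublePochhammer_eq_mul_left hp hq z⁻¹, doublePochhammer_eq_mul_right hp hq (p * z⁻¹), e1, e2,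
    div_inv_eq_mul q, div_eq_mul_inv p z]
  generalize doublePochhammer p q (p * q / z) = a at *
  generalize doublePochhammer p q (p * q / z⁻¹) = b at *
  rw [← mul_inv_cancel_right₀ h1 (qPochhammerInf (p * z⁻¹) p)]
  field_simp

/-! ### Gaussian bilateral series and the triple product -/

/-- The bilateral series `∑ₙ r^(n² - n) xⁿ`. -/
noncomputable def gaussSeries (r x : ℂ) : ℂ := ∑' n : ℤ, r ^ (n ^ 2 - n) * x ^ n

lemma summable_norm_gaussSeries {r x : ℂ} (hr₀ : r ≠ 0) (hr : ‖r‖ < 1) (hx : x ≠ 0) :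
    Summable fun n : ℤ => ‖r ^ (n ^ 2 - n) * x ^ n‖ := by
  refine Summable.norm ?_
  have hI : (Real.pi : ℂ) * Complex.I ≠ 0 := by simp [Real.pi_ne_zero]
  have h2 : (2 : ℂ) * Real.pi * Complex.I ≠ 0 := by simp [Real.pi_ne_zero]
  -- With r = exp(πiτ) and x/r = exp(2πiz) the terms are those of the Jacobi theta series, and |r| <
  -- 1 becomes Im τ > 0.
  set τ : ℂ := Complex.log r / (Real.pi * Complex.I) with hτ
  set z : ℂ := Complex.log (x / r) / (2 * Real.pi * Complex.I) with hz
  have him : 0 < τ.im := by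
    have : τ = -(Complex.log r * Complex.I) / (Real.pi : ℝ) := by
      rw [hτ, div_eq_div_iff hI (by simp [Real.pi_ne_zero])]
      linear_combination (Complex.log r * Real.pi) * Complex.I_sq
    rw [this, Complex.div_ofReal_im]
    simp only [Complex.neg_im, Complex.mul_im, Complex.I_im, Complex.I_re, mul_one, mul_zero,
      add_zero, Complex.log_re]
    exact div_pos (neg_pos.2 (Real.log_neg (norm_pos_iff.2 hr₀) hr)) Real.pi_pos
  refine ((summable_jacobiTheta₂_term_iff z τ).2 him).congr fun n => ?_
  have e1 : 2 * Real.pi * Complex.I * n * z = n * Complex.log (x / r) := by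
    rw [hz]; field_simp
  have e2 : Real.pi * Complex.I * n ^ 2 * τ = (n ^ 2 : ℤ) * Complex.log r := by
    rw [hτ]; push_cast; field_simp
  rw [jacobiTheta₂_term, e1, e2, Complex.exp_add, Complex.exp_int_mul, Complex.exp_int_mul,
    Complex.exp_log hr₀, Complex.exp_log (div_ne_zero hx hr₀), div_zpow, zpow_sub₀ hr₀]
  ring

/-- The coefficients `1 / ((1 - p) ⋯ (1 - p^m))`, extended by `0` to negative `m`. -/
noncomputable def invQFactorial (p : ℂ) (m : ℤ) : ℂ :=
  if m < 0 then 0 else (∏ k ∈ Finset.range m.toNat, (1 - p * p ^ k))⁻¹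

lemma invQFactorial_natCast (p : ℂ) (n : ℕ) :
    invQFactorial p n = (∏ k ∈ Finset.range n, (1 - p * p ^ k))⁻¹ := by
  simp [invQFactorial]

lemma one_sub_mul_pow_ne_zero {p : ℂ} (hp : ‖p‖ < 1) (k : ℕ) : 1 - p * p ^ k ≠ 0 :=
  one_sub_mul_ne_zero_of_norm_lt_one hp (by
    rw [norm_pow]; exact pow_le_one₀ (norm_nonneg _) hp.le)

/-- At m = 0 both sides vanish because 1 - p⁰ = 0, so the extension by zero keeps the recurrence
valid on all of ℤ and sums over j ∈ ℤ have no boundary terms. -/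
lemma invQFactorial_mul {p : ℂ} (hp : ‖p‖ < 1) (m : ℤ) :
    invQFactorial p m * (1 - p ^ m) = invQFactorial p (m - 1) := by
  rcases lt_trichotomy m 0 with h | rfl | h
  · simp [invQFactorial, h, show m - 1 < 0 by lia]
  · simp [invQFactorial]
  · obtain ⟨n, rfl⟩ : ∃ n : ℕ, m = n + 1 := ⟨(m - 1).toNat, by lia⟩
    have e : ((n : ℤ) + 1) = ((n + 1 : ℕ) : ℤ) := by push_cast; ring
    rw [add_sub_cancel_right, e, invQFactorial_natCast, invQFactorial_natCast,
      Finset.prod_range_succ, zpow_natCast, pow_succ']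
    have := one_sub_mul_pow_ne_zero hp n
    rw [mul_inv, mul_assoc, inv_mul_cancel₀ this, mul_one]

lemma tendsto_invQFactorial {p : ℂ} (hp : ‖p‖ < 1) :
    Tendsto (fun n : ℕ => invQFactorial p n) atTop (𝓝 (qPochhammerInf p p)⁻¹) := by
  simp only [invQFactorial_natCast]
  exact ((multipliable_one_sub_mul (summable_norm_pow hp) p).hasProd.tendsto_prod_nat).inv₀
    (qPochhammerInf_ne_zero hp hp)

lemma tendsto_invQFactorial_intCast_add {p : ℂ} (hp : ‖p‖ < 1) (j : ℤ) :
    Tendsto (fun n : ℕ => invQFactorial p (n + j)) atTop (𝓝 (qPochhammerInf p p)⁻¹) := by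
  have h : Tendsto (fun n : ℕ => ((n : ℤ) + j).toNat) atTop atTop := by
    refine tendsto_atTop.2 fun b => ?_
    filter_upwards [eventually_ge_atTop (b + j.natAbs)] with n hn
    lia
  refine ((tendsto_invQFactorial hp).comp h).congr' ?_
  filter_upwards [eventually_ge_atTop j.natAbs] with n hn
  simp only [Function.comp]
  congr 1
  lia

lemma exists_norm_invQFactorial_le {p : ℂ} (hp : ‖p‖ < 1) :
    ∃ M, ∀ m : ℤ, ‖invQFactorial p m‖ ≤ M := by
  obtain ⟨M, hM⟩ := (tendsto_invQFactorial hp).norm.bddAbove_range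
  refine ⟨M, fun m => ?_⟩
  have hM' : ∀ n : ℕ, ‖invQFactorial p n‖ ≤ M := fun n => hM ⟨n, rfl⟩
  by_cases h : m < 0
  · rw [invQFactorial, if_pos h, norm_zero]
    exact (norm_nonneg _).trans (hM' 0)
  · have := hM' m.toNat
    rwa [Int.toNat_of_nonneg (not_lt.1 h)] at this

/-- The terms of the finite form of the triple product. -/
noncomputable def tripleTerm (p r y : ℂ) (n : ℕ) (j : ℤ) : ℂ :=
  invQFactorial p (n + j) * invQFactorial p (n - j) * (r ^ (j ^ 2 - j) * y ^ j)

/-- The bound is uniform in n and supplies the dominating series for the limit n → ∞. -/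
lemma exists_norm_tripleTerm_le {p r y : ℂ} (hp : ‖p‖ < 1) :
    ∃ M, ∀ n j, ‖tripleTerm p r y n j‖ ≤ M * ‖r ^ (j ^ 2 - j) * y ^ j‖ := by
  obtain ⟨M, hM⟩ := exists_norm_invQFactorial_le hp
  refine ⟨M * M, fun n j => ?_⟩
  rw [tripleTerm, norm_mul, norm_mul]
  have := (norm_nonneg _).trans (hM 0)
  gcongr <;> apply hM

lemma summable_tripleTerm {p r y : ℂ} (hp : ‖p‖ < 1) (hr₀ : r ≠ 0) (hr : ‖r‖ < 1) (hy : y ≠ 0)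
    (n : ℕ) : Summable (tripleTerm p r y n) := by
  obtain ⟨M, hM⟩ := exists_norm_tripleTerm_le (r := r) (y := y) hp
  exact .of_norm_bounded ((summable_norm_gaussSeries hr₀ hr hy).mul_left M) (hM n)

/-- This compares coefficients after multiplication by (1 + y pⁿ)(1 + p^(n+1)/y), which shifts j by
at most one. All the terms are multiples of the inverse factorials at level n + 1, so what remains
is a rational identity in pⁿ, p^j and y. -/
lemma tripleTerm_succ {p r y : ℂ} (hp : ‖p‖ < 1) (hp₀ : p ≠ 0) (hr : r ^ 2 = p) (hy : y ≠ 0)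
    (n : ℕ) (j : ℤ) :
    (1 + p ^ (2 * n + 1)) * tripleTerm p r y n j + p ^ n * y * tripleTerm p r y n (j - 1) +
      p ^ (n + 1) / y * tripleTerm p r y n (j + 1) =
    (1 - p ^ (2 * n + 1)) * (1 - p ^ (2 * n + 2)) * tripleTerm p r y (n + 1) j := by
  have hr₀ : r ≠ 0 := by rintro rfl; exact hp₀ (by rw [← hr]; simp)
  have a1 : invQFactorial p (n + j) = invQFactorial p (n + 1 + j) * (1 - p ^ (n + 1 + j : ℤ)) := by
    rw [invQFactorial_mul hp]; congr 1; ring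
  have a2 : invQFactorial p (n + (j - 1)) = invQFactorial p (n + j) * (1 - p ^ (n + j : ℤ)) := by
    rw [invQFactorial_mul hp]; congr 1; ring
  have b1 : invQFactorial p (n - j) = invQFactorial p (n + 1 - j) * (1 - p ^ (n + 1 - j : ℤ)) := by
    rw [invQFactorial_mul hp]; congr 1; ring
  have b2 : invQFactorial p (n - (j + 1)) = invQFactorial p (n - j) * (1 - p ^ (n - j : ℤ)) := by
    rw [invQFactorial_mul hp]; congr 1; ring
  have a3 : invQFactorial p (n + (j + 1)) = invQFactorial p (n + 1 + j) := by congr 1; ring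
  have b3 : invQFactorial p (n - (j - 1)) = invQFactorial p (n + 1 - j) := by congr 1; ring
  have g1 : r ^ ((j - 1) ^ 2 - (j - 1)) * y ^ (j - 1) =
      r ^ (j ^ 2 - j) * y ^ j * (p / (p ^ j * y)) := by
    rw [show (j - 1) ^ 2 - (j - 1) = j ^ 2 - j + 2 - 2 * j by ring, zpow_sub₀ hr₀, zpow_add₀ hr₀,
      zpow_mul, zpow_sub_one₀ hy, zpow_ofNat, hr]
    field_simp
  have g2 : r ^ ((j + 1) ^ 2 - (j + 1)) * y ^ (j + 1) =
      r ^ (j ^ 2 - j) * y ^ j * (p ^ j * y) := by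
    rw [show (j + 1) ^ 2 - (j + 1) = j ^ 2 - j + 2 * j by ring, zpow_add₀ hr₀,
      zpow_mul, zpow_add_one₀ hy, zpow_ofNat, hr]
    ring
  simp only [tripleTerm, Nat.cast_add, Nat.cast_one]
  rw [g1, g2, a3, b3, a2, b2, a1, b1]
  generalize invQFactorial p (n + 1 + j) = B
  generalize invQFactorial p (n + 1 - j) = B'
  generalize r ^ (j ^ 2 - j) * y ^ j = G
  have hP : p ^ j ≠ 0 := zpow_ne_zero _ hp₀
  rw [zpow_add₀ hp₀, zpow_sub₀ hp₀, zpow_add₀ hp₀, zpow_sub₀ hp₀, zpow_add₀ hp₀, zpow_natCast,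
    zpow_one]
  generalize p ^ j = P at *
  rw [pow_succ p n, pow_succ p (2 * n), pow_succ p (2 * n + 1), pow_succ p (2 * n), mul_comm 2 n,
    pow_mul]
  generalize p ^ n = N
  field_simp
  ring

lemma tsum_tripleTerm_succ {p r x : ℂ} (hp : ‖p‖ < 1) (hp₀ : p ≠ 0) (hr : r ^ 2 = p)
    (hr1 : ‖r‖ < 1) (hx : x ≠ 0) (n : ℕ) :
    (1 - x * p ^ n) * (1 - p / x * p ^ n) * ∑' j, tripleTerm p r (-x) n j =
    (1 - p * p ^ (2 * n)) * (1 - p * p ^ (2 * n + 1)) * ∑' j, tripleTerm p r (-x) (n + 1) j := by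
  have hr₀ : r ≠ 0 := by rintro rfl; exact hp₀ (by rw [← hr]; simp)
  have h := (summable_tripleTerm hp hr₀ hr1 (neg_ne_zero.2 hx) n).hasSum
  have h1 := (Equiv.subRight (1 : ℤ)).hasSum_iff.2 h
  have h2 := (Equiv.addRight (1 : ℤ)).hasSum_iff.2 h
  have h3 := ((h.mul_left (1 + p ^ (2 * n + 1))).add (h1.mul_left (p ^ n * -x))).add
    (h2.mul_left (p ^ (n + 1) / -x))
  have h4 := (summable_tripleTerm hp hr₀ hr1 (neg_ne_zero.2 hx) (n + 1)).hasSum.mul_left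
    ((1 - p ^ (2 * n + 1)) * (1 - p ^ (2 * n + 2)))
  have h5 := h3.unique (h4.congr_fun fun j =>
    tripleTerm_succ hp hp₀ hr (neg_ne_zero.2 hx) n j)
  rw [show p * p ^ (2 * n) = p ^ (2 * n + 1) by ring,
    show p * p ^ (2 * n + 1) = p ^ (2 * n + 2) by ring, ← h5]
  field_simp
  ring

/-- A symmetric form of the p-binomial theorem, by induction on n; at n = 0 only j = 0 survives. -/
lemma prod_eq_tsum_tripleTerm {p r x : ℂ} (hp : ‖p‖ < 1) (hp₀ : p ≠ 0) (hr : r ^ 2 = p)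
    (hr1 : ‖r‖ < 1) (hx : x ≠ 0) (n : ℕ) :
    (∏ k ∈ Finset.range n, (1 - x * p ^ k)) * (∏ k ∈ Finset.range n, (1 - p / x * p ^ k)) =
    (∏ k ∈ Finset.range (2 * n), (1 - p * p ^ k)) * ∑' j, tripleTerm p r (-x) n j := by
  induction n with
  | zero =>
    rw [tsum_eq_single 0]
    · simp [tripleTerm, invQFactorial]
    · intro j hj
      rcases lt_or_gt_of_ne hj with h | h
      · simp [tripleTerm, invQFactorial, h]
      · simp [tripleTerm, invQFactorial, h]
  | succ n ih =>
    rw [Finset.prod_range_succ, Finset.prod_range_succ, show 2 * (n + 1) = 2 * n + 1 + 1 by ring,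
      Finset.prod_range_succ _ (2 * n + 1), Finset.prod_range_succ _ (2 * n)]
    have := tsum_tripleTerm_succ hp hp₀ hr hr1 hx n
    linear_combination ((1 - x * p ^ n) * (1 - p / x * p ^ n)) * ih +
      (∏ k ∈ Finset.range (2 * n), (1 - p * p ^ k)) * this

/-- The Jacobi triple product identity. -/
lemma modTheta_eq_gaussSeries {p r x : ℂ} (hp : ‖p‖ < 1) (hp₀ : p ≠ 0) (hr : r ^ 2 = p)
    (hx : x ≠ 0) :
    modTheta p x = (qPochhammerInf p p)⁻¹ * gaussSeries r (-x) := by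
  have hr₀ : r ≠ 0 := by rintro rfl; exact hp₀ (by rw [← hr]; simp)
  have hr1 : ‖r‖ < 1 := by
    rw [← hr, norm_pow] at hp
    exact (pow_lt_one_iff_of_nonneg (norm_nonneg _) two_ne_zero).1 hp
  have hc := qPochhammerInf_ne_zero hp hp
  have hm := fun z : ℂ =>
    (multipliable_one_sub_mul (summable_norm_pow hp) z).hasProd.tendsto_prod_nat
  have hL := (hm x).mul (hm (p / x))
  obtain ⟨M, hM⟩ := exists_norm_tripleTerm_le (r := r) (y := -x) hp
  -- For fixed j both inverse factorials tend to 1/(p; p)_∞. One of these two factors cancels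
  -- against the limit of the product over k < 2n.
  have hT := tendsto_tsum_of_dominated_convergence (𝓕 := atTop)
    ((summable_norm_gaussSeries hr₀ hr1 (neg_ne_zero.2 hx)).mul_left M)
    (fun j => ((tendsto_invQFactorial_intCast_add hp j).mul
      (tendsto_invQFactorial_intCast_add hp (-j))).mul_const (r ^ (j ^ 2 - j) * (-x) ^ j))
    (Eventually.of_forall fun n j => hM n j)
  have hR := ((hm p).comp (tendsto_id.const_mul_atTop' (show 0 < 2 by simp))).mul hT
  have := tendsto_nhds_unique hL
    (hR.congr fun n => (prod_eq_tsum_tripleTerm hp hp₀ hr hr1 hx n).symm)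
  rw [modTheta, qPochhammerInf, qPochhammerInf, this, tsum_mul_left, gaussSeries]
  change qPochhammerInf p p * _ = _
  field_simp

/-! ### The addition formula for theta functions -/

lemma gaussSeries_sq_mul {p x : ℂ} (hp₀ : p ≠ 0) (hx : x ≠ 0) :
    gaussSeries p (p ^ 2 * x) = x⁻¹ * gaussSeries p x := by
  rw [gaussSeries, gaussSeries, ← tsum_mul_left, ← (Equiv.subRight (1 : ℤ)).tsum_eq]
  congr 1
  funext n
  simp only [Equiv.subRight_apply]
  rw [mul_zpow, ← zpow_natCast p 2, ← zpow_mul, zpow_sub_one₀ hx, ← mul_assoc, ← zpow_add₀ hp₀,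
    show (n - 1) ^ 2 - (n - 1) + ((2 : ℕ) : ℤ) * (n - 1) = n ^ 2 - n by push_cast; ring]
  ring

lemma gaussSeries_term_mul {r x w : ℂ} (hr₀ : r ≠ 0) (hx : x ≠ 0) (hw : w ≠ 0) (m n : ℤ) :
    r ^ (m ^ 2 - m) * (-(x * w)) ^ m * (r ^ (n ^ 2 - n) * (-(x / w)) ^ n) =
      r ^ (m ^ 2 - m + (n ^ 2 - n)) * (-1) ^ (m + n) * x ^ (m + n) * w ^ (m - n) := by
  rw [zpow_add₀ hr₀, zpow_add₀ (by simp), zpow_add₀ hx, zpow_sub₀ hw,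
    neg_eq_neg_one_mul, mul_zpow, mul_zpow, neg_eq_neg_one_mul (x / w), mul_zpow, div_zpow]
  ring

/-- The substitution m = k + l, n = k - l diagonalises m² + n² and reaches the pairs with m + n
even; r² = p absorbs the doubled exponents. -/
lemma gaussSeries_term_mul_even {p r x w : ℂ} (hp₀ : p ≠ 0) (hr₀ : r ≠ 0) (hr : r ^ 2 = p)
    (hx : x ≠ 0) (hw : w ≠ 0) (k l : ℤ) :
    r ^ ((k + l) ^ 2 - (k + l)) * (-(x * w)) ^ (k + l) *
        (r ^ ((k - l) ^ 2 - (k - l)) * (-(x / w)) ^ (k - l)) =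
      p ^ (k ^ 2 - k) * (x ^ 2) ^ k * (p ^ (l ^ 2 - l) * (p * w ^ 2) ^ l) := by
  have hpow : ∀ n : ℤ, r ^ (2 * n) = p ^ n := fun n => by rw [zpow_mul, zpow_ofNat, hr]
  rw [gaussSeries_term_mul hr₀ hx hw, show k + l + (k - l) = 2 * k by ring,
    show k + l - (k - l) = 2 * l by ring,
    show (k + l) ^ 2 - (k + l) + ((k - l) ^ 2 - (k - l)) = 2 * (k ^ 2 - k + (l ^ 2 - l) + l) by
      ring, hpow, zpow_add₀ hp₀, zpow_add₀ hp₀, mul_zpow p, zpow_mul, zpow_mul x, zpow_mul w]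
  simp only [zpow_ofNat, neg_one_sq, one_zpow]
  ring

lemma gaussSeries_term_mul_odd {p r x w : ℂ} (hp₀ : p ≠ 0) (hr₀ : r ≠ 0) (hr : r ^ 2 = p)
    (hx : x ≠ 0) (hw : w ≠ 0) (k l : ℤ) :
    r ^ ((k + l + 1) ^ 2 - (k + l + 1)) * (-(x * w)) ^ (k + l + 1) *
        (r ^ ((k - l) ^ 2 - (k - l)) * (-(x / w)) ^ (k - l)) =
      -(x * w) * (p ^ (k ^ 2 - k) * (p * x ^ 2) ^ k * (p ^ (l ^ 2 - l) * (p ^ 2 * w ^ 2) ^ l)) := by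
  have hpow : ∀ n : ℤ, r ^ (2 * n) = p ^ n := fun n => by rw [zpow_mul, zpow_ofNat, hr]
  rw [gaussSeries_term_mul hr₀ hx hw, show k + l + 1 + (k - l) = 2 * k + 1 by ring,
    show k + l + 1 - (k - l) = 2 * l + 1 by ring,
    show (k + l + 1) ^ 2 - (k + l + 1) + ((k - l) ^ 2 - (k - l)) =
      2 * (k ^ 2 - k + (l ^ 2 - l) + k + 2 * l) by ring, hpow, zpow_add₀ hp₀, zpow_add₀ hp₀,
    zpow_add₀ hp₀, zpow_add_one₀ hx, zpow_add_one₀ hw, zpow_add_one₀ (by simp : (-1 : ℂ) ≠ 0),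
    mul_zpow p, mul_zpow (p ^ 2), zpow_mul (-1), zpow_mul x, zpow_mul w, zpow_mul p]
  simp only [zpow_ofNat, neg_one_sq, one_zpow]
  ring

lemma hasSum_int_prod_of_even_odd {f : ℤ × ℤ → ℂ} {a b : ℂ}
    (h0 : HasSum (fun k : ℤ × ℤ => f (k.1 + k.2, k.1 - k.2)) a)
    (h1 : HasSum (fun k : ℤ × ℤ => f (k.1 + k.2 + 1, k.1 - k.2)) b) : HasSum f (a + b) := by
  let e0 : ℤ × ℤ → ℤ × ℤ := fun k => (k.1 + k.2, k.1 - k.2)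
  let e1 : ℤ × ℤ → ℤ × ℤ := fun k => (k.1 + k.2 + 1, k.1 - k.2)
  have i0 : Function.Injective e0 := by
    rintro ⟨a, b⟩ ⟨c, d⟩ h
    simp only [e0, Prod.mk.injEq] at h ⊢
    lia
  have i1 : Function.Injective e1 := by
    rintro ⟨a, b⟩ ⟨c, d⟩ h
    simp only [e1, Prod.mk.injEq] at h ⊢
    lia
  refine HasSum.add_isCompl (s := Set.range e0) (t := Set.range e1)
    ⟨Set.disjoint_left.2 ?_, codisjoint_iff.2 (Set.eq_univ_of_forall fun ⟨m, n⟩ => ?_)⟩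
    (i0.hasSum_range_iff.2 h0) (i1.hasSum_range_iff.2 h1)
  · rintro _ ⟨⟨a, b⟩, rfl⟩ ⟨⟨c, d⟩, h⟩
    simp only [e0, e1, Prod.mk.injEq] at h
    lia
  · rcases Int.even_or_odd' (m + n) with ⟨k, hk | hk⟩
    · exact Or.inl ⟨(k, m - k), by simp only [e0, Prod.mk.injEq]; lia⟩
    · exact Or.inr ⟨(k, m - k - 1), by simp only [e1, Prod.mk.injEq]; lia⟩

lemma hasSum_mul_of_summable_norm {ι κ : Type*} {f : ι → ℂ} {g : κ → ℂ}
    (hf : Summable fun i => ‖f i‖) (hg : Summable fun i => ‖g i‖) :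
    HasSum (fun k : ι × κ => f k.1 * g k.2) ((∑' i, f i) * ∑' i, g i) :=
  hf.of_norm.hasSum.mul hg.of_norm.hasSum (summable_mul_of_summable_norm hf hg)

/-- The double series is split by the parity of m + n, and each half factors into two series with
base p. -/
lemma gaussSeries_mul_gaussSeries {p r x w : ℂ} (hp : ‖p‖ < 1) (hp₀ : p ≠ 0) (hr : r ^ 2 = p)
    (hx : x ≠ 0) (hw : w ≠ 0) :
    gaussSeries r (-(x * w)) * gaussSeries r (-(x / w)) =
      gaussSeries p (x ^ 2) * gaussSeries p (p * w ^ 2) -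
        x / w * (gaussSeries p (p * x ^ 2) * gaussSeries p (w ^ 2)) := by
  have hr₀ : r ≠ 0 := by rintro rfl; exact hp₀ (by rw [← hr]; simp)
  have hr1 : ‖r‖ < 1 := by
    rw [← hr, norm_pow] at hp
    exact (pow_lt_one_iff_of_nonneg (norm_nonneg _) two_ne_zero).1 hp
  have h0 := hasSum_mul_of_summable_norm
    (summable_norm_gaussSeries hr₀ hr1 (neg_ne_zero.2 (mul_ne_zero hx hw)))
    (summable_norm_gaussSeries hr₀ hr1 (neg_ne_zero.2 (div_ne_zero hx hw)))
  have h1 := hasSum_mul_of_summable_norm (summable_norm_gaussSeries hp₀ hp (pow_ne_zero 2 hx))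
    (summable_norm_gaussSeries hp₀ hp (mul_ne_zero hp₀ (pow_ne_zero 2 hw)))
  have h2 := hasSum_mul_of_summable_norm
    (summable_norm_gaussSeries hp₀ hp (mul_ne_zero hp₀ (pow_ne_zero 2 hx)))
    (summable_norm_gaussSeries hp₀ hp (mul_ne_zero (pow_ne_zero 2 hp₀) (pow_ne_zero 2 hw)))
  have h3 := hasSum_int_prod_of_even_odd
    (f := fun i : ℤ × ℤ => r ^ (i.1 ^ 2 - i.1) * (-(x * w)) ^ i.1 *
      (r ^ (i.2 ^ 2 - i.2) * (-(x / w)) ^ i.2))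
    (h1.congr_fun fun k => gaussSeries_term_mul_even hp₀ hr₀ hr hx hw k.1 k.2)
    ((h2.mul_left (-(x * w))).congr_fun fun k =>
      gaussSeries_term_mul_odd hp₀ hr₀ hr hx hw k.1 k.2)
  have h4 := h0.unique h3
  simp only [← gaussSeries.eq_1] at h4
  rw [h4, gaussSeries_sq_mul hp₀ (pow_ne_zero 2 hw)]
  field_simp
  ring

/-- The addition formula (three-term relation) for theta functions. -/
lemma modTheta_addition {p x y w v : ℂ} (hp : ‖p‖ < 1) (hp₀ : p ≠ 0)
    (hx : x ≠ 0) (hy : y ≠ 0) (hw : w ≠ 0) (hv : v ≠ 0) :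
    modTheta p (x * w) * modTheta p (x / w) * (modTheta p (y * v) * modTheta p (y / v)) -
      modTheta p (x * v) * modTheta p (x / v) * (modTheta p (y * w) * modTheta p (y / w)) =
    y / w * (modTheta p (x * y) * modTheta p (x / y)) *
      (modTheta p (w * v) * modTheta p (w / v)) := by
  obtain ⟨r, hr⟩ := IsAlgClosed.exists_pow_nat_eq p (show 0 < 2 by simp)
  -- Up to the factor a and a constant, the right side is the 2×2 determinant of the vectors
  -- (F(a²)/a, F(pa²)) and (F(b²)/b, F(pb²)) with F = `gaussSeries p`. The three-term relation is
  -- then the Plücker relation for four vectors in the plane.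
  have key : ∀ a b : ℂ, a ≠ 0 → b ≠ 0 → modTheta p (a * b) * modTheta p (a / b) =
      (qPochhammerInf p p)⁻¹ ^ 2 * (gaussSeries p (a ^ 2) * gaussSeries p (p * b ^ 2) -
        a / b * (gaussSeries p (p * a ^ 2) * gaussSeries p (b ^ 2))) := by
    intro a b ha hb
    rw [modTheta_eq_gaussSeries hp hp₀ hr (mul_ne_zero ha hb),
      modTheta_eq_gaussSeries hp hp₀ hr (div_ne_zero ha hb),
      ← gaussSeries_mul_gaussSeries hp hp₀ hr ha hb]
    ring
  simp only [key, hx, hy, hw, hv, ne_eq, not_false_eq_true]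
  field_simp
  ring

lemma modTheta_addition_four {p t a b B z : ℂ} (hp : ‖p‖ < 1) (hp₀ : p ≠ 0) (ht : t ≠ 0)
    (ha : a ≠ 0) (hb : b ≠ 0) (hB : B ≠ 0) (hz : z ≠ 0) :
    z * (modTheta p (t / z) * modTheta p (t * a * b * z) *
        (modTheta p (t * B * a) * modTheta p (t * B * b)) -
      modTheta p (t * B * a * b * z) * modTheta p (t * B / z) *
        (modTheta p (t * a) * modTheta p (t * b))) =
    -(t * modTheta p (t * (t * B * a * b)) * modTheta p B * modTheta p (a * z) *
      modTheta p (b * z)) := by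
  -- The square root d of ab makes the products and quotients of the four arguments td, tBd, a/d, zd
  -- equal to the required arguments, up to inversion of some of them.
  obtain ⟨d, hd⟩ := IsAlgClosed.exists_pow_nat_eq (a * b) (show 0 < 2 by simp)
  have hd₀ : d ≠ 0 := by
    rintro rfl
    exact mul_ne_zero ha hb (by rw [← hd]; simp)
  have hb' : b = d ^ 2 / a := by rw [hd]; field_simp
  have h := modTheta_addition (x := t * d) (w := a / d) (y := t * B * d) (v := z * d) hp hp₀
    (by positivity) (by positivity) (by positivity) (by positivity)
  have e1 : t * d * (a / d) = t * a := by field_simp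
  have e2 : t * d / (a / d) = t * b := by rw [hb']; field_simp
  have e3 : t * B * d * (z * d) = t * B * a * b * z := by rw [hb']; field_simp
  have e4 : t * B * d / (z * d) = t * B / z := by field_simp
  have e5 : t * d * (z * d) = t * a * b * z := by rw [hb']; field_simp
  have e6 : t * d / (z * d) = t / z := by field_simp
  have e7 : t * B * d * (a / d) = t * B * a := by field_simp
  have e8 : t * B * d / (a / d) = t * B * b := by rw [hb']; field_simp
  have e9 : t * d * (t * B * d) = t * (t * B * a * b) := by rw [hb']; field_simp
  have e10 : t * d / (t * B * d) = B⁻¹ := by field_simp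
  have e11 : a / d * (z * d) = a * z := by field_simp
  have e12 : a / d / (z * d) = (b * z)⁻¹ := by rw [hb']; field_simp
  rw [e1, e2, e3, e4, e5, e6, e7, e8, e9, e10, e11, e12, modTheta_inv hp hB,
    modTheta_inv hp (mul_ne_zero hb hz)] at h
  have h' := congrArg (fun x => -z * x) h
  calc _ = _ := by ring
    _ = _ := h'
    _ = _ := by field_simp

lemma modTheta_addition_sq {p c x y z : ℂ} (hp : ‖p‖ < 1) (hp₀ : p ≠ 0) (hc : c ≠ 0)
    (hx : x ≠ 0) (hy : y ≠ 0) (hz : z ≠ 0) :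
    modTheta p (c * x) * modTheta p (c * y) * (modTheta p (x * y) * modTheta p (z ^ 2)) =
      modTheta p (c * x * y / z) * modTheta p (c * z) * (modTheta p (x * z) * modTheta p (y * z)) -
      z ^ 2 * (modTheta p (c * x * y * z) * modTheta p (c / z)) *
        (modTheta p (x / z) * modTheta p (y / z)) := by
  -- The same device with d² = xy and the arguments cd, zd, x/d, d/z; here zd divided by d/z
  -- produces z².
  obtain ⟨d, hd⟩ := IsAlgClosed.exists_pow_nat_eq (x * y) (show 0 < 2 by simp)
  have hd₀ : d ≠ 0 := by
    rintro rfl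
    exact mul_ne_zero hx hy (by rw [← hd]; simp)
  have hy' : y = d ^ 2 / x := by rw [hd]; field_simp
  have h := modTheta_addition (x := c * d) (w := x / d) (y := z * d) (v := d / z) hp hp₀
    (by positivity) (by positivity) (by positivity) (by positivity)
  have e1 : c * d * (x / d) = c * x := by field_simp
  have e2 : c * d / (x / d) = c * y := by rw [hy']; field_simp
  have e3 : z * d * (d / z) = x * y := by rw [hy']; field_simp
  have e4 : z * d / (d / z) = z ^ 2 := by field_simp
  have e5 : c * d * (d / z) = c * x * y / z := by rw [hy']; field_simp
  have e6 : c * d / (d / z) = c * z := by field_simp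
  have e7 : z * d * (x / d) = x * z := by field_simp
  have e8 : z * d / (x / d) = y * z := by rw [hy']; field_simp
  have e9 : c * d * (z * d) = c * x * y * z := by rw [hy']; field_simp
  have e10 : c * d / (z * d) = c / z := by field_simp
  have e11 : x / d * (d / z) = x / z := by field_simp
  have e12 : x / d / (d / z) = (y / z)⁻¹ := by rw [hy']; field_simp
  rw [e1, e2, e3, e4, e5, e6, e7, e8, e9, e10, e11, e12,
    modTheta_inv hp (div_ne_zero hy hz)] at h
  have e13 : y * z * (y / z)⁻¹ = z ^ 2 := by field_simp
  linear_combination h - (modTheta p (c * x * y * z) * modTheta p (c / z)) *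
    (modTheta p (x / z) * modTheta p (y / z)) * e13

/-- The theta function identity underlying the difference equation for the integrand of the
elliptic beta integral. -/
lemma modTheta_beta_identity {p a b c d e z : ℂ} (hp : ‖p‖ < 1) (hp₀ : p ≠ 0) (ha : a ≠ 0)
    (hb : b ≠ 0) (hc : c ≠ 0) (hd : d ≠ 0) (he : e ≠ 0) (hz : z ≠ 0)
    (hbc : modTheta p (b * c) ≠ 0) :
    z * modTheta p (z ^ 2) *
      (modTheta p (a * z) * modTheta p (a / z) *
        (modTheta p (a * c * d * e) * modTheta p (a * b * d * e) * modTheta p (a * b * c * e) *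
          modTheta p (a * b * c * d)) -
        modTheta p (a * b * c * d * e * z) * modTheta p (a * b * c * d * e / z) *
          (modTheta p (a * b) * modTheta p (a * c) * modTheta p (a * d) * modTheta p (a * e))) =
    -(a * modTheta p (a * (a * b * c * d * e))) *
      (modTheta p (a * b * c * d * e / z) * (modTheta p (a * z) * modTheta p (b * z) *
          modTheta p (c * z) * modTheta p (d * z) * modTheta p (e * z)) -
        z ^ 4 * modTheta p (a * b * c * d * e * z) * (modTheta p (a / z) * modTheta p (b / z) *
          modTheta p (c / z) * modTheta p (d / z) * modTheta p (e / z))) := by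
  have hade : a * d * e ≠ 0 := by positivity
  have h1 := modTheta_addition_sq hp hp₀ hade hb hc hz
  have h2 := modTheta_addition_sq hp hp₀ ha hb hc hz
  have h3 := modTheta_addition_four hp hp₀ ha hd he (mul_ne_zero hb hc) hz
  have h4 := modTheta_addition_four hp hp₀ ha hd he (mul_ne_zero hb hc) (inv_ne_zero hz)
  simp only [div_inv_eq_mul, ← div_eq_mul_inv] at h4
  simp only [show a * d * e * b = a * b * d * e by ring, show a * d * e * c = a * c * d * e by ring,
    show a * b * d * e * c = a * b * c * d * e by ring] at h1
  have hzz : z * z⁻¹ = 1 := mul_inv_cancel₀ hz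
  have e1 : a * (b * c) * d = a * b * c * d := by ring
  have e2 : a * (b * c) * e = a * b * c * e := by ring
  have e4 : a * (b * c) * z = a * b * c * z := by ring
  have e5 : a * (b * c) = a * b * c := by ring
  rw [e1, e2, e5] at h3
  rw [e1, e2, e4] at h4
  -- After multiplication by θ(bc), each of the two terms on the left contains a product θ(bc) θ(z²)
  -- that `h1` or `h2` splits in two. The four resulting terms recombine in pairs by `h3` and by its
  -- version `h4` at 1/z.
  refine mul_left_cancel₀ hbc ?_
  linear_combination (z * modTheta p (a * z) * modTheta p (a / z) * modTheta p (a * b * c * e) *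
      modTheta p (a * b * c * d)) * h1 -
    (z * modTheta p (a * b * c * d * e * z) * modTheta p (a * b * c * d * e / z) *
      modTheta p (a * d) * modTheta p (a * e)) * h2 +
    (modTheta p (a * z) * modTheta p (a * b * c * d * e / z) * modTheta p (b * z) *
      modTheta p (c * z)) * h3 -
    (z ^ 4 * modTheta p (a / z) * modTheta p (a * b * c * d * e * z) * modTheta p (b / z) *
      modTheta p (c / z)) * h4 +
    (z ^ 3 * modTheta p (a / z) * modTheta p (a * b * c * d * e * z) * modTheta p (b / z) *
      modTheta p (c / z)) * (modTheta p (a * z) * modTheta p (a * d * e / z) *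
        (modTheta p (a * b * c * d) * modTheta p (a * b * c * e)) -
      modTheta p (a * b * c * d * e / z) * modTheta p (a * b * c * z) *
        (modTheta p (a * d) * modTheta p (a * e))) * hzz

/-! ### Circle integrals of `f(z) dz / z` -/

lemma circleIntegral_div_self (f : ℂ → ℂ) {R : ℝ} (hR : R ≠ 0) :
    (∮ z in C(0, R), f z / z) =
      Complex.I * ∫ θ in (0 : ℝ)..2 * Real.pi, f (circleMap 0 R θ) := by
  rw [circleIntegral, ← intervalIntegral.integral_const_mul]
  congr 1
  funext θ
  have : circleMap 0 R θ ≠ 0 := circleMap_ne_center hR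
  rw [deriv_circleMap, smul_eq_mul]
  field_simp

lemma intervalIntegral_circleMap_add (f : ℂ → ℂ) (R φ : ℝ) :
    ∫ θ in (0 : ℝ)..2 * Real.pi, f (circleMap 0 R (θ + φ)) =
      ∫ θ in (0 : ℝ)..2 * Real.pi, f (circleMap 0 R θ) := by
  have hp : Function.Periodic (fun θ => f (circleMap 0 R θ)) (2 * Real.pi) := fun θ => by
    simp only [periodic_circleMap 0 R θ]
  rw [intervalIntegral.integral_comp_add_right (fun θ => f (circleMap 0 R θ)), zero_add, add_comm,
    hp.intervalIntegral_add_eq φ 0, zero_add]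

/-- Multiplication by c is a dilation by |c| followed by a rotation, and dz/z is invariant under the
rotation. -/
lemma circleIntegral_comp_mul_div_self (f : ℂ → ℂ) {c : ℂ} (hc : c ≠ 0) :
    (∮ z in C(0, 1), f (c * z) / z) = ∮ z in C(0, ‖c‖), f z / z := by
  rw [circleIntegral_div_self (fun z => f (c * z)) one_ne_zero,
    circleIntegral_div_self f (norm_ne_zero_iff.2 hc), ← intervalIntegral_circleMap_add f _ c.arg]
  congr 2
  funext θ
  congr 1
  simp only [circleMap, zero_add, Complex.ofReal_add, add_mul, Complex.exp_add]
  conv_lhs => rw [← Complex.norm_mul_exp_arg_mul_I c]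
  push_cast
  ring

lemma circleIntegral_comp_inv_div_self (f : ℂ → ℂ) :
    (∮ z in C(0, 1), f z⁻¹ / z) = ∮ z in C(0, 1), f z / z := by
  rw [circleIntegral_div_self (fun z => f z⁻¹) one_ne_zero, circleIntegral_div_self f one_ne_zero]
  have hp : Function.Periodic (fun θ => f (circleMap 0 1 θ)) (2 * Real.pi) := fun θ => by
    simp only [periodic_circleMap 0 1 θ]
  have e : ∀ θ, f (circleMap 0 1 θ)⁻¹ = f (circleMap 0 1 (-θ)) := fun θ => by
    rw [circleMap_zero_inv, inv_one]
  simp only [e]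
  rw [intervalIntegral.integral_comp_neg (fun θ => f (circleMap 0 1 θ))]
  have := hp.intervalIntegral_add_eq (-(2 * Real.pi)) 0
  rw [neg_add_cancel, zero_add] at this
  rw [neg_zero, this]

/-! ### The elliptic beta integral -/

/-- The integrand of the elliptic beta integral, with respect to `dz / z`. -/
noncomputable def betaIntegrand (p q a b c d e z : ℂ) : ℂ :=
  ellipticGammaPM p q a z * ellipticGammaPM p q b z * ellipticGammaPM p q c z *
      ellipticGammaPM p q d z * ellipticGammaPM p q e z /
    (ellipticGammaPM p q 1 (z ^ 2) * ellipticGammaPM p q (a * b * c * d * e) z)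

/-- The elliptic beta integral without its normalizing constant. -/
noncomputable def betaIntegral (p q a b c d e : ℂ) : ℂ :=
  ∮ z in C(0, 1), betaIntegrand p q a b c d e z / z

/-- The product of elliptic gamma functions evaluating the elliptic beta integral. -/
noncomputable def betaProduct (p q a b c d e : ℂ) : ℂ :=
  ellipticGamma p q (a * b) * ellipticGamma p q (a * c) * ellipticGamma p q (a * d) *
      ellipticGamma p q (a * e) * ellipticGamma p q (b * c) * ellipticGamma p q (b * d) *
      ellipticGamma p q (b * e) * ellipticGamma p q (c * d) * ellipticGamma p q (c * e) *
      ellipticGamma p q (d * e) /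
    (ellipticGamma p q (b * c * d * e) * ellipticGamma p q (a * c * d * e) *
      ellipticGamma p q (a * b * d * e) * ellipticGamma p q (a * b * c * e) *
      ellipticGamma p q (a * b * c * d))

/-- The parameters for which the unit circle is an admissible contour. -/
structure BetaDomain (p q a b c d e : ℂ) : Prop where
  ha : ‖a‖ < 1
  hb : ‖b‖ < 1
  hc : ‖c‖ < 1
  hd : ‖d‖ < 1
  he : ‖e‖ < 1
  hA : ‖p * q‖ < ‖a * b * c * d * e‖

/-- The function whose `q`-difference is the defect of invariance of the integrand. -/
noncomputable def betaShiftKernel (p q a b c d e z : ℂ) : ℂ :=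
  ellipticGamma p q (q * a * z) * ellipticGamma p q (a * z⁻¹) *
    (ellipticGamma p q (q * b * z) * ellipticGamma p q (b * z⁻¹)) *
    (ellipticGamma p q (q * c * z) * ellipticGamma p q (c * z⁻¹)) *
    (ellipticGamma p q (q * d * z) * ellipticGamma p q (d * z⁻¹)) *
    (ellipticGamma p q (q * e * z) * ellipticGamma p q (e * z⁻¹)) *
    modTheta q (z ^ 2)⁻¹ * z⁻¹ *
    ((ellipticGamma p q (q * (a * b * c * d * e) * z))⁻¹ *
      (ellipticGamma p q (a * b * c * d * e * z⁻¹))⁻¹)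

/-- In each pair Γ(qxz) Γ(x/z), replacing z by z/q has the same effect as replacing z by 1/z. The
sign comes from the remaining factor θ(z⁻²; q)/z, whose theta function is shifted by two
quasi-periods. -/
lemma betaShiftKernel_inv_mul {p q a b c d e z : ℂ} (hq : ‖q‖ < 1) (hq₀ : q ≠ 0) (hz : z ≠ 0) :
    betaShiftKernel p q a b c d e (q⁻¹ * z) = -betaShiftKernel p q a b c d e z⁻¹ := by
  have e1 : ∀ x : ℂ, q * x * (q⁻¹ * z) = x * z⁻¹⁻¹ := fun x => by field_simp
  have e2 : ∀ x : ℂ, x * (q⁻¹ * z)⁻¹ = q * x * z⁻¹ := fun x => by field_simp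
  have e3 : ((q⁻¹ * z) ^ 2)⁻¹ = q * (q * (z ^ 2)⁻¹) := by field_simp
  have e4 : (z⁻¹ ^ 2)⁻¹ = z ^ 2 := by field_simp
  have hz2 : (z ^ 2)⁻¹ ≠ 0 := by positivity
  have e5 : modTheta q (z ^ 2) = -z ^ 2 * modTheta q (z ^ 2)⁻¹ := by
    have := modTheta_inv hq hz2
    rw [inv_inv] at this
    exact this
  simp only [betaShiftKernel, e1, e2, e3, e4]
  rw [modTheta_mul_left hq hq₀ (mul_ne_zero hq₀ hz2), modTheta_mul_left hq hq₀ hz2, e5]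
  have hs : q * (-(q * (z ^ 2)⁻¹)⁻¹ * -z ^ 2) * z⁻¹ = z ^ 3 := by field_simp
  simp only [inv_inv]
  linear_combination (ellipticGamma p q (a * z) * ellipticGamma p q (q * a * z⁻¹) *
    (ellipticGamma p q (b * z) * ellipticGamma p q (q * b * z⁻¹)) *
    (ellipticGamma p q (c * z) * ellipticGamma p q (q * c * z⁻¹)) *
    (ellipticGamma p q (d * z) * ellipticGamma p q (q * d * z⁻¹)) *
    (ellipticGamma p q (e * z) * ellipticGamma p q (q * e * z⁻¹)) * modTheta q (z ^ 2)⁻¹ *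
    ((ellipticGamma p q (a * b * c * d * e * z))⁻¹ *
      (ellipticGamma p q (q * (a * b * c * d * e) * z⁻¹))⁻¹)) * hs

lemma betaIntegrand_eq {p q a b c d e z : ℂ} (hp : ‖p‖ < 1) (hq : ‖q‖ < 1) (hp₀ : p ≠ 0)
    (hq₀ : q ≠ 0) (hz : ‖z‖ = 1) :
    betaIntegrand p q a b c d e z =
      ellipticGammaPM p q a z * ellipticGammaPM p q b z * ellipticGammaPM p q c z *
      ellipticGammaPM p q d z * ellipticGammaPM p q e z *
      (modTheta p (z ^ 2) * modTheta q (z ^ 2)⁻¹) *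
      ((ellipticGamma p q (a * b * c * d * e * z))⁻¹ *
        (ellipticGamma p q (a * b * c * d * e * z⁻¹))⁻¹) := by
  have hpq : ‖p * q‖ < 1 := by
    rw [norm_mul]
    exact mul_lt_one_of_nonneg_of_lt_one_left (norm_nonneg _) hp hq.le
  rw [betaIntegrand, div_eq_mul_inv, mul_inv, ← inv_ellipticGamma_mul_inv hp hq hp₀ hq₀
    (by simpa [hz] using hpq) (by simpa [hz] using hpq)]
  simp only [ellipticGammaPM, one_mul, mul_inv]
  ring

/-! ### The difference equation in the parameter a -/

section shift

variable {p q a b c d e : ℂ}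

lemma BetaDomain.ne_zero (h : BetaDomain p q a b c d e) :
    a ≠ 0 ∧ b ≠ 0 ∧ c ≠ 0 ∧ d ≠ 0 ∧ e ≠ 0 := by
  have := norm_pos_iff.1 ((norm_nonneg _).trans_lt h.hA)
  simpa [and_assoc] using this

lemma norm_mul_le_left {x y : ℂ} (hy : ‖y‖ ≤ 1) : ‖x * y‖ ≤ ‖x‖ := by
  rw [norm_mul]
  exact mul_le_of_le_one_right (norm_nonneg _) hy

lemma norm_mul_le_right {x y : ℂ} (hx : ‖x‖ ≤ 1) : ‖x * y‖ ≤ ‖y‖ := by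
  rw [norm_mul]
  exact mul_le_of_le_one_left (norm_nonneg _) hx

lemma ellipticGamma_ne_zero_of_mul_eq (hp : ‖p‖ < 1) (hq : ‖q‖ < 1) {x y A : ℂ}
    (hA : ‖p * q‖ < ‖A‖) (hx : ‖x‖ < 1) (hy : ‖y‖ ≤ 1) (h : x * y = A) :
    ellipticGamma p q x ≠ 0 :=
  ellipticGamma_ne_zero hp hq (hA.trans_le (h ▸ norm_mul_le_left hy)) hx


lemma BetaDomain.norm_le (h : BetaDomain p q a b c d e) : ‖a * b * c * d * e‖ < ‖a‖ := by
  have h₀ := h.ne_zero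
  rw [show a * b * c * d * e = a * (b * (c * (d * e))) by ring, norm_mul]
  refine mul_lt_of_lt_one_right (norm_pos_iff.2 h₀.1) ?_
  refine (norm_mul_le_left ?_).trans_lt h.hb
  refine (norm_mul_le_left ?_).trans h.hc.le
  exact (norm_mul_le_left h.he.le).trans h.hd.le

lemma ellipticGammaPM_mul_left (hp : ‖p‖ < 1) (hq : ‖q‖ < 1) (hq₀ : q ≠ 0) {x z : ℂ}
    (hx : x ≠ 0) (hx1 : ‖x‖ < 1) (hz : ‖z‖ = 1) :
    ellipticGammaPM p q (q * x) z =
      modTheta p (x * z) * modTheta p (x / z) * ellipticGammaPM p q x z := by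
  have hz₀ : z ≠ 0 := norm_pos_iff.1 (by rw [hz]; exact one_pos)
  rw [ellipticGammaPM, ellipticGammaPM, mul_assoc, mul_assoc, div_eq_mul_inv,
    ellipticGamma_mul_right hp hq hq₀ (mul_ne_zero hx hz₀) (by simpa [hz] using hx1),
    ellipticGamma_mul_right hp hq hq₀ (mul_ne_zero hx (inv_ne_zero hz₀))
      (by simpa [hz] using hx1)]
  ring

lemma betaShiftKernel_eq (hp : ‖p‖ < 1) (hq : ‖q‖ < 1) (hq₀ : q ≠ 0)
    (h : BetaDomain p q a b c d e) {z : ℂ} (hz : ‖z‖ = 1) :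
    betaShiftKernel p q a b c d e z =
      ellipticGammaPM p q a z * ellipticGammaPM p q b z * ellipticGammaPM p q c z *
      ellipticGammaPM p q d z * ellipticGammaPM p q e z * modTheta q (z ^ 2)⁻¹ * z⁻¹ *
      ((ellipticGamma p q (a * b * c * d * e * z))⁻¹ *
        (ellipticGamma p q (a * b * c * d * e * z⁻¹))⁻¹) *
      (modTheta p (a * z) * modTheta p (b * z) * modTheta p (c * z) * modTheta p (d * z) *
        modTheta p (e * z) * (modTheta p (a * b * c * d * e * z))⁻¹) := by
  have hz₀ : z ≠ 0 := norm_pos_iff.1 (by rw [hz]; exact one_pos)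
  obtain ⟨ha, hb, hc, hd, he⟩ := h.ne_zero
  have key : ∀ x : ℂ, x ≠ 0 → ‖x‖ < 1 →
      ellipticGamma p q (q * x * z) = modTheta p (x * z) * ellipticGamma p q (x * z) := by
    intro x hx hx1
    rw [mul_assoc,
      ellipticGamma_mul_right hp hq hq₀ (mul_ne_zero hx hz₀) (by simpa [hz] using hx1)]
  rw [betaShiftKernel, key a ha h.ha, key b hb h.hb, key c hc h.hc, key d hd h.hd, key e he h.he,
    key (a * b * c * d * e) (by positivity) (h.norm_le.trans h.ha)]
  simp only [ellipticGammaPM, mul_inv]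
  ring

lemma BetaDomain.modTheta_prod_ne_zero (hp : ‖p‖ < 1) (h : BetaDomain p q a b c d e)
    (hA : ‖p‖ < ‖a * b * c * d * e‖) {z : ℂ} (hz : ‖z‖ = 1) :
    modTheta p (a * b * c * d * e * z) ≠ 0 := by
  refine modTheta_ne_zero hp ?_ ?_ <;> rw [norm_mul, hz, mul_one]
  · exact hA
  · exact h.norm_le.trans h.ha

lemma betaIntegrand_shift_algebra {G T P Q TA TA' g g' S S' k M M' z : ℂ} (hz : z ≠ 0)
    (hTA : TA ≠ 0) (hTA' : TA' ≠ 0)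
    (key : z * P * (T * S - TA * TA' * S') = -k * (TA' * M - z ^ 4 * TA * M')) :
    T * G * (P * Q) * (TA * TA' * (g * g'))⁻¹ * S - G * (P * Q) * (g * g')⁻¹ * S' =
      -k * (G * Q / z * (g * g')⁻¹ * (M * TA⁻¹) +
        G * (-z ^ 2 * Q) * z * (g'⁻¹ * g⁻¹) * (M' * TA'⁻¹)) := by
  have key' : P * (T * TA⁻¹ * TA'⁻¹ * S - S') = -k * (M * TA⁻¹ * z⁻¹ - z ^ 3 * M' * TA'⁻¹) := by
    field_simp
    linear_combination key
  simp only [mul_inv, div_eq_mul_inv]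
  linear_combination (G * Q * g⁻¹ * g'⁻¹) * key'

/-- Once the common gamma factors are removed this is `modTheta_beta_identity`: its two fivefold
theta products belong to the kernel at z and at 1/z. The condition |p| < |abcde| keeps θ(abcde
z^{±1}; p) away from zero, so that it can be divided out. -/
lemma betaIntegrand_shift (hp : ‖p‖ < 1) (hq : ‖q‖ < 1) (hp₀ : p ≠ 0) (hq₀ : q ≠ 0)
    (h : BetaDomain p q a b c d e) (hA : ‖p‖ < ‖a * b * c * d * e‖) {z : ℂ} (hz : ‖z‖ = 1) :
    betaIntegrand p q (q * a) b c d e z *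
        (modTheta p (a * c * d * e) * modTheta p (a * b * d * e) * modTheta p (a * b * c * e) *
          modTheta p (a * b * c * d)) -
      betaIntegrand p q a b c d e z *
        (modTheta p (a * b) * modTheta p (a * c) * modTheta p (a * d) * modTheta p (a * e)) =
    -(a * modTheta p (a * (a * b * c * d * e))) *
      (betaShiftKernel p q a b c d e z + betaShiftKernel p q a b c d e z⁻¹) := by
  have hz₀ : z ≠ 0 := norm_pos_iff.1 (by rw [hz]; exact one_pos)
  have hz' : ‖z⁻¹‖ = 1 := by rw [norm_inv, hz, inv_one]
  obtain ⟨ha, hb, hc, hd, he⟩ := h.ne_zero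
  have hA₀ : a * b * c * d * e ≠ 0 := by positivity
  have hA1 := h.norm_le.trans h.ha
  have hT := h.modTheta_prod_ne_zero hp hA hz
  have hT' := h.modTheta_prod_ne_zero hp hA hz'
  have hbc : modTheta p (b * c) ≠ 0 := by
    refine modTheta_ne_zero hp (hA.trans_le ?_) ((norm_mul_le_left h.hc.le).trans_lt h.hb)
    rw [show a * b * c * d * e = b * c * (a * (d * e)) by ring]
    exact norm_mul_le_left ((norm_mul_le_left ((norm_mul_le_left h.he.le).trans h.hd.le)).trans
      h.ha.le)
  have key := modTheta_beta_identity hp hp₀ ha hb hc hd he hz₀ hbc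
  have e5 : modTheta q (z ^ 2) = -z ^ 2 * modTheta q (z ^ 2)⁻¹ := by
    have := modTheta_inv hq (inv_ne_zero (pow_ne_zero 2 hz₀))
    rwa [inv_inv] at this
  have e6 : q * a * b * c * d * e = q * (a * b * c * d * e) := by ring
  have e7 := ellipticGammaPM_mul_left hp hq hq₀ hA₀ hA1 hz
  rw [ellipticGammaPM, ellipticGammaPM] at e7
  have e8 : ∀ x, ellipticGammaPM p q x z⁻¹ = ellipticGammaPM p q x z := fun x => by
    rw [ellipticGammaPM, ellipticGammaPM, inv_inv, mul_comm]
  rw [betaIntegrand_eq hp hq hp₀ hq₀ hz, betaIntegrand_eq hp hq hp₀ hq₀ hz,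
    betaShiftKernel_eq hp hq hq₀ h hz, betaShiftKernel_eq hp hq hq₀ h hz', e6,
    ellipticGammaPM_mul_left hp hq hq₀ ha h.ha hz, ← mul_inv, e7]
  rw [← mul_inv]
  have e9 : (z⁻¹ ^ 2)⁻¹ = z ^ 2 := by simp
  simp only [e8, e9, e5, inv_inv, ← div_eq_mul_inv _ z] at hT' ⊢
  linear_combination betaIntegrand_shift_algebra (G := ellipticGammaPM p q a z *
      ellipticGammaPM p q b z * ellipticGammaPM p q c z * ellipticGammaPM p q d z *
      ellipticGammaPM p q e z) (Q := modTheta q (z ^ 2)⁻¹)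
    (g := ellipticGamma p q (a * b * c * d * e * z))
    (g' := ellipticGamma p q (a * b * c * d * e / z)) hz₀ hT hT' key

/-- On the annulus, |qxz| and |x/z| stay below 1 for every parameter x, while |p| < |abcde| keeps
both arguments of the reciprocal gamma functions above |pq| in modulus. -/
lemma differentiableAt_betaShiftKernel (hp : ‖p‖ < 1) (hq : ‖q‖ < 1) (hq₀ : q ≠ 0)
    (h : BetaDomain p q a b c d e) (hA : ‖p‖ < ‖a * b * c * d * e‖) {z : ℂ} (hz : 1 ≤ ‖z‖)
    (hz' : ‖z‖ ≤ ‖q‖⁻¹) : DifferentiableAt ℂ (betaShiftKernel p q a b c d e) z := by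
  have hz₀ : z ≠ 0 := norm_pos_iff.1 (one_pos.trans_le hz)
  obtain ⟨ha, hb, hc, hd, he⟩ := h.ne_zero
  have hA₀ : a * b * c * d * e ≠ 0 := by positivity
  have hqn : 0 < ‖q‖ := norm_pos_iff.2 hq₀
  have hqz : ‖q‖ * ‖z‖ ≤ 1 := by
    have := mul_le_mul_of_nonneg_left hz' hqn.le
    rwa [mul_inv_cancel₀ hqn.ne'] at this
  have hzi : ‖z‖⁻¹ ≤ 1 := inv_le_one_of_one_le₀ hz
  have key : ∀ x : ℂ, x ≠ 0 → ‖x‖ < 1 → DifferentiableAt ℂ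
      (fun z => ellipticGamma p q (q * x * z) * ellipticGamma p q (x * z⁻¹)) z := by
    intro x hx hx1
    refine DifferentiableAt.mul ?_ ?_
    · refine (differentiableAt_ellipticGamma hp hq (by positivity) ?_).comp z (by fun_prop)
      rw [norm_mul, norm_mul]
      nlinarith [norm_nonneg x]
    · refine (differentiableAt_ellipticGamma hp hq (by positivity) ?_).comp z
        (by fun_prop (disch := exact hz₀))
      rw [norm_mul, norm_inv]
      nlinarith [norm_nonneg x]
  have k1 : DifferentiableAt ℂ
      (fun z => (ellipticGamma p q (q * (a * b * c * d * e) * z))⁻¹) z := by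
    refine (differentiableAt_ellipticGamma_inv hp hq ?_).comp z (by fun_prop)
    rw [norm_mul, norm_mul, norm_mul, mul_comm ‖p‖]
    exact (mul_lt_mul_of_pos_left hA hqn).trans_le (le_mul_of_one_le_right (by positivity) hz)
  have k2 : DifferentiableAt ℂ
      (fun z => (ellipticGamma p q (a * b * c * d * e * z⁻¹))⁻¹) z := by
    refine (differentiableAt_ellipticGamma_inv hp hq ?_).comp z (by fun_prop (disch := exact hz₀))
    rw [norm_mul, norm_mul, norm_inv]
    have hqi : ‖q‖ ≤ ‖z‖⁻¹ := by
      rw [le_inv_comm₀ hqn (norm_pos_iff.2 hz₀)]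
      exact hz'
    calc ‖p‖ * ‖q‖ < ‖a * b * c * d * e‖ * ‖q‖ := by gcongr
      _ ≤ _ := by gcongr
  have k3 : DifferentiableAt ℂ (fun z => modTheta q (z ^ 2)⁻¹) z :=
    (differentiableAt_modTheta hq (by positivity)).comp z
      (by fun_prop (disch := exact pow_ne_zero 2 hz₀))
  have k4 : DifferentiableAt ℂ (fun z : ℂ => z⁻¹) z := by fun_prop (disch := exact hz₀)
  exact (((((((key a ha h.ha).mul (key b hb h.hb)).mul (key c hc h.hc)).mul
    (key d hd h.hd)).mul (key e he h.he)).mul k3).mul k4).mul (k1.mul k2)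

/-- The integral over |z| = 1/|q| equals the one over the unit circle by Cauchy's theorem, and
equals its negative by `betaShiftKernel_inv_mul` together with z ↦ 1/z. -/
lemma circleIntegral_betaShiftKernel (hp : ‖p‖ < 1) (hq : ‖q‖ < 1) (hq₀ : q ≠ 0)
    (h : BetaDomain p q a b c d e) (hA : ‖p‖ < ‖a * b * c * d * e‖) :
    ∮ z in C(0, 1), betaShiftKernel p q a b c d e z / z = 0 := by
  have hqn : 0 < ‖q‖ := norm_pos_iff.2 hq₀
  have h1 : (∮ z in C(0, 1), betaShiftKernel p q a b c d e (q⁻¹ * z) / z) =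
      -∮ z in C(0, 1), betaShiftKernel p q a b c d e z / z := by
    rw [← circleIntegral_comp_inv_div_self (betaShiftKernel p q a b c d e), neg_eq_neg_one_mul,
      ← circleIntegral.integral_const_mul]
    refine circleIntegral.integral_congr zero_le_one fun z hz => ?_
    have hz₀ : z ≠ 0 := ne_zero_of_mem_unit_sphere ⟨z, hz⟩
    simp only [betaShiftKernel_inv_mul hq hq₀ hz₀]
    ring
  have hd : ∀ z ∈ Metric.closedBall (0 : ℂ) ‖q‖⁻¹ \ Metric.ball 0 1,
      DifferentiableAt ℂ (betaShiftKernel p q a b c d e) z := fun z hz =>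
    differentiableAt_betaShiftKernel hp hq hq₀ h hA (by simpa using hz.2) (by simpa using hz.1)
  have h2 := Complex.circleIntegral_sub_center_inv_smul_eq_of_differentiable_on_annulus_off_countable
    (c := 0) (f := betaShiftKernel p q a b c d e) one_pos ((one_le_inv₀ hqn).2 hq.le)
    Set.countable_empty (fun z hz => (hd z hz).continuousAt.continuousWithinAt)
    (fun z hz => hd z ⟨Metric.ball_subset_closedBall hz.1.1,
      fun hz' => hz.1.2 (Metric.ball_subset_closedBall hz')⟩)
  rw [circleIntegral_comp_mul_div_self _ (inv_ne_zero hq₀), norm_inv] at h1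
  simp only [sub_zero, smul_eq_mul, inv_mul_eq_div] at h2
  rw [h2] at h1
  exact self_eq_neg.1 h1

end shift

/-! ### Holomorphic dependence on the parameters, and invariance of the ratio under a ↦ qa -/

/-- Differentiation under the integral sign; Cauchy's estimate turns a bound for the integrand on a
compact set into one for its parameter derivative. -/
lemma differentiableOn_circleIntegral {U : Set ℂ} (hU : IsOpen U) {F : ℂ → ℂ → ℂ}
    (hF : ∀ ζ ∈ U, ∀ z ∈ Metric.sphere (0 : ℂ) 1,
      DifferentiableAt ℂ (fun x : ℂ × ℂ => F x.1 x.2) (ζ, z)) :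
    DifferentiableOn ℂ (fun ζ => ∮ z in C(0, 1), F ζ z) U := by
  intro ζ₀ h₀
  refine DifferentiableAt.differentiableWithinAt ?_
  obtain ⟨ε, hε, hεU⟩ := Metric.nhds_basis_closedBall.mem_iff.1 (hU.mem_nhds h₀)
  have hmem : ∀ θ, circleMap 0 1 θ ∈ Metric.sphere (0 : ℂ) 1 := fun θ =>
    circleMap_mem_sphere 0 zero_le_one θ
  have hcont : ContinuousOn (fun x : ℂ × ℂ => F x.1 x.2)
      (Metric.closedBall ζ₀ ε ×ˢ Metric.sphere 0 1) := fun x hx =>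
    (hF x.1 (hεU hx.1) x.2 hx.2).continuousAt.continuousWithinAt
  obtain ⟨M, hM⟩ := ((isCompact_closedBall ζ₀ ε).prod
    (isCompact_sphere (0 : ℂ) 1)).exists_bound_of_continuousOn hcont
  set f : ℂ → ℝ → ℂ := fun ζ θ => deriv (circleMap 0 1) θ • F ζ (circleMap 0 1 θ) with hf
  have hfc : ∀ ζ ∈ U, Continuous (f ζ) := by
    intro ζ hζ
    simp only [hf, deriv_circleMap, smul_eq_mul]
    have h1 : Continuous fun θ => circleMap 0 1 θ * Complex.I :=
      (continuous_circleMap 0 1).mul continuous_const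
    refine h1.mul (continuous_iff_continuousAt.2 fun θ => ?_)
    exact ContinuousAt.comp (f := fun θ => (ζ, circleMap 0 1 θ)) (hF ζ hζ _ (hmem θ)).continuousAt
      (by fun_prop)
  have hfd : ∀ ζ ∈ U, ∀ θ, DifferentiableAt ℂ (fun ζ => f ζ θ) ζ := by
    intro ζ hζ θ
    have h1 : DifferentiableAt ℂ (fun ζ => F ζ (circleMap 0 1 θ)) ζ :=
      DifferentiableAt.comp (f := fun ζ => (ζ, circleMap 0 1 θ)) ζ (hF ζ hζ _ (hmem θ))
        (by fun_prop)
    exact h1.const_mul _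
  have hfM : ∀ ζ ∈ Metric.closedBall ζ₀ ε, ∀ θ, ‖f ζ θ‖ ≤ M := by
    intro ζ hζ θ
    simpa [hf, deriv_circleMap] using hM (ζ, circleMap 0 1 θ) ⟨hζ, hmem θ⟩
  have hball : ∀ ζ ∈ Metric.ball ζ₀ (ε / 2), Metric.closedBall ζ (ε / 2) ⊆
      Metric.closedBall ζ₀ ε := fun ζ hζ =>
    Metric.closedBall_subset_closedBall' (by linarith [Metric.mem_ball.1 hζ])
  have hseq : Tendsto (fun n : ℕ => ζ₀ + ((ε / (n + 1) : ℝ) : ℂ)) atTop (𝓝[≠] ζ₀) := by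
    refine tendsto_nhdsWithin_iff.2 ⟨?_, Eventually.of_forall fun n => ?_⟩
    · have h1 : Tendsto (fun n : ℕ => ε / ((n : ℝ) + 1)) atTop (𝓝 0) := by
        simpa [div_eq_mul_inv] using (tendsto_one_div_add_atTop_nhds_zero_nat (𝕜 := ℝ)).const_mul ε
      have h2 := ((Complex.continuous_ofReal.tendsto 0).comp h1).const_add ζ₀
      simpa using h2
    · have : ε / ((n : ℝ) + 1) ≠ 0 := by positivity
      simp only [Set.mem_compl_iff, Set.mem_singleton_iff, add_eq_left, Complex.ofReal_eq_zero]
      exact this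
  have hsub : ∀ n : ℕ, ζ₀ + ((ε / (n + 1) : ℝ) : ℂ) ∈ U := fun n => hεU (by
    rw [Metric.mem_closedBall, dist_eq_norm, add_sub_cancel_left, Complex.norm_real,
      Real.norm_of_nonneg (by positivity)]
    exact div_le_self hε.le (by linarith [n.cast_nonneg (α := ℝ)]))
  refine (intervalIntegral.hasDerivAt_integral_of_dominated_loc_of_deriv_le (F := f)
    (F' := fun ζ θ => deriv (fun ζ => f ζ θ) ζ) (bound := fun _ => M / (ε / 2))
    (μ := MeasureTheory.volume) (Metric.ball_mem_nhds ζ₀ (half_pos hε))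
    ?_ ((hfc ζ₀ h₀).intervalIntegrable _ _) ?_ ?_ intervalIntegrable_const ?_).2.differentiableAt
  · filter_upwards [hU.mem_nhds h₀] with ζ hζ using (hfc ζ hζ).aestronglyMeasurable
  -- The derivative at ζ₀ is measurable in θ as a pointwise limit of continuous difference quotients
  -- along ζ₀ + ε/(n + 1).
  · refine aestronglyMeasurable_of_tendsto_ae atTop
      (f := fun (n : ℕ) θ => slope (fun ζ => f ζ θ) ζ₀ (ζ₀ + ((ε / (n + 1) : ℝ) : ℂ)))
      (fun n => ?_) (Eventually.of_forall fun θ => ?_)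
    · simp only [slope_def_module]
      exact (((hfc _ (hsub n)).sub (hfc ζ₀ h₀)).const_smul
        (ζ₀ + ((ε / (n + 1) : ℝ) : ℂ) - ζ₀)⁻¹).aestronglyMeasurable
    · exact (hfd ζ₀ h₀ θ).hasDerivAt.tendsto_slope.comp hseq
  · refine Eventually.of_forall fun θ _ ζ hζ => ?_
    refine Complex.norm_deriv_le_of_forall_mem_sphere_norm_le (half_pos hε) ?_ fun w hw =>
      hfM w (hball ζ hζ (Metric.sphere_subset_closedBall hw)) θ
    refine DifferentiableOn.diffContOnCl fun w hw => ?_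
    rw [closure_ball _ (half_pos hε).ne'] at hw
    exact (hfd w (hεU (hball ζ hζ hw)) θ).differentiableWithinAt
  · exact Eventually.of_forall fun θ _ ζ hζ => (hfd ζ (hεU (hball ζ hζ
      (Metric.mem_closedBall_self (half_pos hε).le))) θ).hasDerivAt

section

variable {p q a b c d e : ℂ}

lemma differentiableAt_betaIntegrand (hp : ‖p‖ < 1) (hq : ‖q‖ < 1)
    {a b c d e : ℂ → ℂ} {ζ : ℂ} (h : BetaDomain p q (a ζ) (b ζ) (c ζ) (d ζ) (e ζ))
    (ha : DifferentiableAt ℂ a ζ) (hb : DifferentiableAt ℂ b ζ) (hc : DifferentiableAt ℂ c ζ)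
    (hd : DifferentiableAt ℂ d ζ) (he : DifferentiableAt ℂ e ζ) {z : ℂ}
    (hz : z ∈ Metric.sphere (0 : ℂ) 1) :
    DifferentiableAt ℂ (fun x : ℂ × ℂ => betaIntegrand p q (a x.1) (b x.1) (c x.1) (d x.1) (e x.1)
      x.2 / x.2) (ζ, z) := by
  have hz1 : ‖z‖ = 1 := by simpa using hz
  have hz₀ : z ≠ 0 := norm_pos_iff.1 (by rw [hz1]; exact one_pos)
  have hpq : ‖p * q‖ < 1 := by
    rw [norm_mul]
    exact mul_lt_one_of_nonneg_of_lt_one_left (norm_nonneg _) hp hq.le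
  obtain ⟨ha₀, hb₀, hc₀, hd₀, he₀⟩ := h.ne_zero
  have key : ∀ f : ℂ → ℂ, DifferentiableAt ℂ f ζ → f ζ ≠ 0 → ‖f ζ‖ < 1 →
      DifferentiableAt ℂ (fun x : ℂ × ℂ => ellipticGammaPM p q (f x.1) x.2) (ζ, z) := by
    intro f hf hf0 hf1
    have hf' : DifferentiableAt ℂ (fun x : ℂ × ℂ => f x.1) (ζ, z) :=
      DifferentiableAt.comp (g := f) (f := Prod.fst) (ζ, z) hf differentiableAt_fst
    refine DifferentiableAt.mul ?_ ?_
    · exact DifferentiableAt.comp (f := fun x : ℂ × ℂ => f x.1 * x.2) (ζ, z)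
        (differentiableAt_ellipticGamma hp hq (mul_ne_zero hf0 hz₀) (by simpa [hz1] using hf1))
        (by fun_prop)
    · exact DifferentiableAt.comp (f := fun x : ℂ × ℂ => f x.1 * x.2⁻¹) (ζ, z)
        (differentiableAt_ellipticGamma hp hq (mul_ne_zero hf0 (inv_ne_zero hz₀))
          (by simpa [hz1] using hf1)) (by fun_prop (disch := exact hz₀))
  have key2 : ∀ f : ℂ × ℂ → ℂ, DifferentiableAt ℂ f (ζ, z) → ‖p * q‖ < ‖f (ζ, z)‖ →
      DifferentiableAt ℂ (fun x : ℂ × ℂ => (ellipticGamma p q (f x))⁻¹) (ζ, z) := by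
    intro f hf hf1
    exact DifferentiableAt.comp (g := fun x => (ellipticGamma p q x)⁻¹) (f := f) (ζ, z)
      (differentiableAt_ellipticGamma_inv hp hq hf1) hf
  have hA : DifferentiableAt ℂ (fun x : ℂ × ℂ => a x.1 * b x.1 * c x.1 * d x.1 * e x.1) (ζ, z) :=
    DifferentiableAt.comp (g := fun ζ => a ζ * b ζ * c ζ * d ζ * e ζ) (f := Prod.fst) (ζ, z)
      (by fun_prop) differentiableAt_fst
  simp only [betaIntegrand, div_eq_mul_inv, mul_inv]
  refine (((((((key a ha ha₀ h.ha).mul (key b hb hb₀ h.hb)).mul (key c hc hc₀ h.hc)).mul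
    (key d hd hd₀ h.hd)).mul (key e he he₀ h.he))).mul (DifferentiableAt.mul ?_ ?_)).mul ?_
  · simp only [ellipticGammaPM, mul_inv]
    refine (key2 _ (by fun_prop) (by simpa [hz1] using hpq)).mul
      (key2 _ (by fun_prop (disch := exact pow_ne_zero 2 hz₀)) (by simpa [hz1] using hpq))
  · simp only [ellipticGammaPM, mul_inv]
    refine (key2 _ (by fun_prop) (by simpa [hz1] using h.hA)).mul
      (key2 _ (by fun_prop (disch := exact hz₀)) (by simpa [hz1] using h.hA))
  · fun_prop (disch := exact hz₀)

lemma continuousOn_betaIntegrand (hp : ‖p‖ < 1) (hq : ‖q‖ < 1) (h : BetaDomain p q a b c d e) :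
    ContinuousOn (fun z => betaIntegrand p q a b c d e z / z) (Metric.sphere 0 1) := fun z hz =>
  (ContinuousAt.comp (f := fun z : ℂ => ((0 : ℂ), z)) (differentiableAt_betaIntegrand hp hq
    (a := fun _ => a) (b := fun _ => b) (c := fun _ => c) (d := fun _ => d) (e := fun _ => e)
    (ζ := 0) h (by fun_prop) (by fun_prop) (by fun_prop) (by fun_prop) (by fun_prop)
      hz).continuousAt (by fun_prop)).continuousWithinAt

lemma norm_mul_lt_one {x y : ℂ} (hx : ‖x‖ < 1) (hy : ‖y‖ < 1) : ‖x * y‖ < 1 :=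
  (norm_mul_le_left hy.le).trans_lt hx

lemma betaProduct_ne_zero (hp : ‖p‖ < 1) (hq : ‖q‖ < 1) (h : BetaDomain p q a b c d e) :
    betaProduct p q a b c d e ≠ 0 := by
  have key : ∀ x y, ‖x‖ < 1 → ‖y‖ < 1 → x * y = a * b * c * d * e → ellipticGamma p q x ≠ 0 :=
    fun x y hx hy hxy => ellipticGamma_ne_zero_of_mul_eq hp hq h.hA hx hy.le hxy
  have m := @norm_mul_lt_one
  obtain ⟨ha, hb, hc, hd, he, -⟩ := h
  refine div_ne_zero ?_ ?_
  · exact mul_ne_zero (mul_ne_zero (mul_ne_zero (mul_ne_zero (mul_ne_zero (mul_ne_zero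
      (mul_ne_zero (mul_ne_zero (mul_ne_zero
      (key _ (c * d * e) (m ha hb) (m (m hc hd) he) (by ring))
      (key _ (b * d * e) (m ha hc) (m (m hb hd) he) (by ring)))
      (key _ (b * c * e) (m ha hd) (m (m hb hc) he) (by ring)))
      (key _ (b * c * d) (m ha he) (m (m hb hc) hd) (by ring)))
      (key _ (a * d * e) (m hb hc) (m (m ha hd) he) (by ring)))
      (key _ (a * c * e) (m hb hd) (m (m ha hc) he) (by ring)))
      (key _ (a * c * d) (m hb he) (m (m ha hc) hd) (by ring)))
      (key _ (a * b * e) (m hc hd) (m (m ha hb) he) (by ring)))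
      (key _ (a * b * d) (m hc he) (m (m ha hb) hd) (by ring)))
      (key _ (a * b * c) (m hd he) (m (m ha hb) hc) (by ring))
  · exact mul_ne_zero (mul_ne_zero (mul_ne_zero (mul_ne_zero
      (key _ a (m (m (m hb hc) hd) he) ha (by ring))
      (key _ b (m (m (m ha hc) hd) he) hb (by ring)))
      (key _ c (m (m (m ha hb) hd) he) hc (by ring)))
      (key _ d (m (m (m ha hb) hc) he) hd (by ring)))
      (key _ e (m (m (m ha hb) hc) hd) he (by ring))

lemma differentiableAt_betaProduct (hp : ‖p‖ < 1) (hq : ‖q‖ < 1)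
    {a b c d e : ℂ → ℂ} {ζ : ℂ} (h : BetaDomain p q (a ζ) (b ζ) (c ζ) (d ζ) (e ζ))
    (hda : DifferentiableAt ℂ a ζ) (hdb : DifferentiableAt ℂ b ζ) (hdc : DifferentiableAt ℂ c ζ)
    (hdd : DifferentiableAt ℂ d ζ) (hde : DifferentiableAt ℂ e ζ) :
    DifferentiableAt ℂ (fun ζ => betaProduct p q (a ζ) (b ζ) (c ζ) (d ζ) (e ζ)) ζ := by
  let G : (ℂ → ℂ) → Prop := fun f => DifferentiableAt ℂ f ζ ∧ f ζ ≠ 0 ∧ ‖f ζ‖ < 1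
  have m : ∀ {f g}, G f → G g → G fun ζ => f ζ * g ζ := fun hf hg =>
    ⟨hf.1.mul hg.1, mul_ne_zero hf.2.1 hg.2.1, norm_mul_lt_one hf.2.2 hg.2.2⟩
  have key : ∀ {f : ℂ → ℂ}, G f → DifferentiableAt ℂ (fun ζ => ellipticGamma p q (f ζ)) ζ :=
    fun {f} hf => DifferentiableAt.comp (f := f) ζ
      (differentiableAt_ellipticGamma hp hq hf.2.1 hf.2.2) hf.1
  have h₀ := betaProduct_ne_zero hp hq h
  obtain ⟨a0, b0, c0, d0, e0⟩ := h.ne_zero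
  have ha : G a := ⟨hda, a0, h.ha⟩
  have hb : G b := ⟨hdb, b0, h.hb⟩
  have hc : G c := ⟨hdc, c0, h.hc⟩
  have hd : G d := ⟨hdd, d0, h.hd⟩
  have he : G e := ⟨hde, e0, h.he⟩
  refine DifferentiableAt.div ?_ ?_ fun h0 => h₀ (by rw [betaProduct, h0, div_zero])
  · exact (((((((((key (m ha hb)).mul (key (m ha hc))).mul (key (m ha hd))).mul
      (key (m ha he))).mul (key (m hb hc))).mul (key (m hb hd))).mul (key (m hb he))).mul
      (key (m hc hd))).mul (key (m hc he))).mul (key (m hd he))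
  · exact ((((key (m (m (m hb hc) hd) he)).mul (key (m (m (m ha hc) hd) he))).mul
      (key (m (m (m ha hb) hd) he))).mul (key (m (m (m ha hb) hc) he))).mul
      (key (m (m (m ha hb) hc) hd))

/-- The ratio of the two sides of the elliptic beta integral evaluation. -/
noncomputable def betaRatio (p q a b c d e : ℂ) : ℂ :=
  baileyKappa p q * betaIntegral p q a b c d e / betaProduct p q a b c d e

lemma differentiableOn_betaRatio (hp : ‖p‖ < 1) (hq : ‖q‖ < 1) {U : Set ℂ} (hU : IsOpen U)
    {a b c d e : ℂ → ℂ} (h : ∀ ζ ∈ U, BetaDomain p q (a ζ) (b ζ) (c ζ) (d ζ) (e ζ))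
    (ha : Differentiable ℂ a) (hb : Differentiable ℂ b) (hc : Differentiable ℂ c)
    (hd : Differentiable ℂ d) (he : Differentiable ℂ e) :
    DifferentiableOn ℂ (fun ζ => betaRatio p q (a ζ) (b ζ) (c ζ) (d ζ) (e ζ)) U := by
  have h1 := differentiableOn_circleIntegral hU
    (F := fun ζ z => betaIntegrand p q (a ζ) (b ζ) (c ζ) (d ζ) (e ζ) z / z) fun ζ hζ z hz =>
    differentiableAt_betaIntegrand hp hq (h ζ hζ) (ha ζ) (hb ζ) (hc ζ) (hd ζ) (he ζ) hz
  exact (h1.const_mul _).div (fun ζ hζ => (differentiableAt_betaProduct hp hq (h ζ hζ) (ha ζ)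
    (hb ζ) (hc ζ) (hd ζ) (he ζ)).differentiableWithinAt) fun ζ hζ =>
    betaProduct_ne_zero hp hq (h ζ hζ)

/-- Admissibility of qa is exactly what strengthens |pq| < |abcde| to the bound that the shift
kernel needs. -/
lemma BetaDomain.norm_lt_of_mul_left (h : BetaDomain p q (q * a) b c d e) :
    ‖p‖ < ‖a * b * c * d * e‖ := by
  have := h.hA
  rw [show q * a * b * c * d * e = q * (a * b * c * d * e) by ring, norm_mul, norm_mul,
    mul_comm ‖p‖] at this
  exact lt_of_mul_lt_mul_left this (norm_nonneg _)

lemma betaIntegral_mul_left (hp : ‖p‖ < 1) (hq : ‖q‖ < 1) (hp₀ : p ≠ 0) (hq₀ : q ≠ 0)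
    (h : BetaDomain p q a b c d e) (h' : BetaDomain p q (q * a) b c d e) :
    betaIntegral p q (q * a) b c d e *
        (modTheta p (a * c * d * e) * modTheta p (a * b * d * e) * modTheta p (a * b * c * e) *
          modTheta p (a * b * c * d)) =
      betaIntegral p q a b c d e *
        (modTheta p (a * b) * modTheta p (a * c) * modTheta p (a * d) * modTheta p (a * e)) := by
  have hA := h'.norm_lt_of_mul_left
  have i1 := (continuousOn_betaIntegrand hp hq h').circleIntegrable zero_le_one
  have i2 := (continuousOn_betaIntegrand hp hq h).circleIntegrable zero_le_one
  have hg : ContinuousOn (betaShiftKernel p q a b c d e) (Metric.sphere 0 1) := fun z hz =>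
    (differentiableAt_betaShiftKernel hp hq hq₀ h hA (by simpa using (mem_sphere_zero_iff_norm.1
      hz).ge) (by rw [mem_sphere_zero_iff_norm.1 hz]; exact (one_le_inv₀
        (norm_pos_iff.2 hq₀)).2 hq.le)).continuousAt.continuousWithinAt
  have hz₀ : ∀ z ∈ Metric.sphere (0 : ℂ) 1, z ≠ 0 := fun z hz => ne_zero_of_mem_unit_sphere ⟨z, hz⟩
  have hinv : ContinuousOn (fun z : ℂ => z⁻¹) (Metric.sphere 0 1) :=
    continuousOn_inv₀.mono hz₀
  have i3 : CircleIntegrable (fun z => betaShiftKernel p q a b c d e z / z) 0 1 :=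
    (hg.div continuousOn_id hz₀).circleIntegrable zero_le_one
  have i4 : CircleIntegrable (fun z => betaShiftKernel p q a b c d e z⁻¹ / z) 0 1 :=
    ((hg.comp hinv fun z hz => by simpa using hz).div continuousOn_id hz₀).circleIntegrable
      zero_le_one
  have h0 := circleIntegral_betaShiftKernel hp hq hq₀ h hA
  have h0' := circleIntegral_comp_inv_div_self (betaShiftKernel p q a b c d e)
  rw [h0] at h0'
  set S := modTheta p (a * c * d * e) * modTheta p (a * b * d * e) * modTheta p (a * b * c * e) *
    modTheta p (a * b * c * d)
  set S' := modTheta p (a * b) * modTheta p (a * c) * modTheta p (a * d) * modTheta p (a * e)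
  set k := -(a * modTheta p (a * (a * b * c * d * e)))
  have e1 : (∮ z in C(0, 1), (S * (betaIntegrand p q (q * a) b c d e z / z) -
      S' * (betaIntegrand p q a b c d e z / z))) =
      ∮ z in C(0, 1), (k * (betaShiftKernel p q a b c d e z / z) +
        k * (betaShiftKernel p q a b c d e z⁻¹ / z)) := by
    refine circleIntegral.integral_congr zero_le_one fun z hz => ?_
    have := betaIntegrand_shift hp hq hp₀ hq₀ h hA (mem_sphere_zero_iff_norm.1 hz)
    linear_combination this / z
  have j1 : CircleIntegrable (fun z => S * (betaIntegrand p q (q * a) b c d e z / z)) 0 1 :=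
    i1.const_smul
  have j2 : CircleIntegrable (fun z => S' * (betaIntegrand p q a b c d e z / z)) 0 1 :=
    i2.const_smul
  have j3 : CircleIntegrable (fun z => k * (betaShiftKernel p q a b c d e z / z)) 0 1 :=
    i3.const_smul
  have j4 : CircleIntegrable (fun z => k * (betaShiftKernel p q a b c d e z⁻¹ / z)) 0 1 :=
    i4.const_smul
  rw [circleIntegral.integral_sub j1 j2, circleIntegral.integral_add j3 j4,
    circleIntegral.integral_const_mul, circleIntegral.integral_const_mul,
    circleIntegral.integral_const_mul, circleIntegral.integral_const_mul, h0, h0'] at e1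
  rw [betaIntegral, betaIntegral]
  linear_combination e1

lemma betaProduct_mul_left_algebra {T₁ T₂ T₃ T₄ S₁ S₂ S₃ S₄ g₁ g₂ g₃ g₄ R G₀ G₁ G₂ G₃ G₄ : ℂ}
    (h₁ : S₁ ≠ 0) (h₂ : S₂ ≠ 0) (h₃ : S₃ ≠ 0) (h₄ : S₄ ≠ 0) :
    T₁ * g₁ * (T₂ * g₂) * (T₃ * g₃) * (T₄ * g₄) * R /
        (G₀ * (S₁ * G₁) * (S₂ * G₂) * (S₃ * G₃) * (S₄ * G₄)) * (S₁ * S₂ * S₃ * S₄) =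
      g₁ * g₂ * g₃ * g₄ * R / (G₀ * G₁ * G₂ * G₃ * G₄) * (T₁ * T₂ * T₃ * T₄) := by
  have hS : S₁ * S₂ * S₃ * S₄ ≠ 0 := mul_ne_zero (mul_ne_zero (mul_ne_zero h₁ h₂) h₃) h₄
  rw [show G₀ * (S₁ * G₁) * (S₂ * G₂) * (S₃ * G₃) * (S₄ * G₄) =
    G₀ * G₁ * G₂ * G₃ * G₄ * (S₁ * S₂ * S₃ * S₄) by ring, div_mul_eq_mul_div,
    mul_div_mul_right _ _ hS]
  ring

lemma betaProduct_mul_left (hp : ‖p‖ < 1) (hq : ‖q‖ < 1) (hq₀ : q ≠ 0)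
    (h : BetaDomain p q a b c d e) (hA : ‖p‖ < ‖a * b * c * d * e‖) :
    betaProduct p q (q * a) b c d e *
        (modTheta p (a * c * d * e) * modTheta p (a * b * d * e) * modTheta p (a * b * c * e) *
          modTheta p (a * b * c * d)) =
      betaProduct p q a b c d e *
        (modTheta p (a * b) * modTheta p (a * c) * modTheta p (a * d) * modTheta p (a * e)) := by
  have m := @norm_mul_lt_one
  have z := @mul_ne_zero ℂ _ _ _
  have key : ∀ x : ℂ, x ≠ 0 → ‖x‖ < 1 →
      ellipticGamma p q (q * x) = modTheta p x * ellipticGamma p q x :=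
    fun x hx hx1 => ellipticGamma_mul_right hp hq hq₀ hx hx1
  obtain ⟨a0, b0, c0, d0, e0⟩ := h.ne_zero
  obtain ⟨ha, hb, hc, hd, he, -⟩ := h
  have hS : ∀ x y : ℂ, ‖x‖ < 1 → ‖y‖ < 1 → x * y = a * b * c * d * e → modTheta p x ≠ 0 :=
    fun x y hx hy hxy => modTheta_ne_zero hp (hA.trans_le (hxy ▸ norm_mul_le_left hy.le)) hx
  have i1 : ‖a * c * d * e‖ < 1 := m (m (m ha hc) hd) he
  have i2 : ‖a * b * d * e‖ < 1 := m (m (m ha hb) hd) he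
  have i3 : ‖a * b * c * e‖ < 1 := m (m (m ha hb) hc) he
  have i4 : ‖a * b * c * d‖ < 1 := m (m (m ha hb) hc) hd
  have := betaProduct_mul_left_algebra
    (T₁ := modTheta p (a * b)) (T₂ := modTheta p (a * c)) (T₃ := modTheta p (a * d))
    (T₄ := modTheta p (a * e)) (g₁ := ellipticGamma p q (a * b)) (g₂ := ellipticGamma p q (a * c))
    (g₃ := ellipticGamma p q (a * d)) (g₄ := ellipticGamma p q (a * e))
    (R := ellipticGamma p q (b * c) * ellipticGamma p q (b * d) *
      ellipticGamma p q (b * e) * ellipticGamma p q (c * d) * ellipticGamma p q (c * e) *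
      ellipticGamma p q (d * e)) (G₀ := ellipticGamma p q (b * c * d * e))
    (G₁ := ellipticGamma p q (a * c * d * e)) (G₂ := ellipticGamma p q (a * b * d * e))
    (G₃ := ellipticGamma p q (a * b * c * e)) (G₄ := ellipticGamma p q (a * b * c * d))
    (hS _ b i1 hb (by ring)) (hS _ c i2 hc (by ring)) (hS _ d i3 hd (by ring))
    (hS _ e i4 he (by ring))
  rw [← key _ (z a0 b0) (m ha hb), ← key _ (z a0 c0) (m ha hc), ← key _ (z a0 d0) (m ha hd),
    ← key _ (z a0 e0) (m ha he), ← key _ (z (z (z a0 c0) d0) e0) i1,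
    ← key _ (z (z (z a0 b0) d0) e0) i2, ← key _ (z (z (z a0 b0) c0) e0) i3,
    ← key _ (z (z (z a0 b0) c0) d0) i4] at this
  have e1 : ∀ x, q * a * x = q * (a * x) := fun x => mul_assoc q a x
  have e2 : ∀ x y w, q * a * x * y * w = q * (a * x * y * w) := fun x y w => by ring
  rw [betaProduct, betaProduct, e2, e2, e2, e2, e1, e1, e1, e1]
  linear_combination this

lemma betaRatio_mul_left (hp : ‖p‖ < 1) (hq : ‖q‖ < 1) (hp₀ : p ≠ 0) (hq₀ : q ≠ 0)
    (h : BetaDomain p q a b c d e) (h' : BetaDomain p q (q * a) b c d e) :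
    betaRatio p q (q * a) b c d e = betaRatio p q a b c d e := by
  have hA := h'.norm_lt_of_mul_left
  have hJ := betaIntegral_mul_left hp hq hp₀ hq₀ h h'
  have hN := betaProduct_mul_left hp hq hq₀ h hA
  have hN0 := betaProduct_ne_zero hp hq h
  have hN0' := betaProduct_ne_zero hp hq h'
  have m := @norm_mul_lt_one
  obtain ⟨ha, hb, hc, hd, he, -⟩ := h
  have hS : ∀ x y : ℂ, ‖x‖ < 1 → ‖y‖ < 1 → x * y = a * b * c * d * e → modTheta p x ≠ 0 :=
    fun x y hx hy hxy => modTheta_ne_zero hp (hA.trans_le (hxy ▸ norm_mul_le_left hy.le)) hx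
  rw [betaRatio, betaRatio, div_eq_div_iff hN0' hN0]
  refine mul_right_cancel₀ (mul_ne_zero (mul_ne_zero (mul_ne_zero
    (hS _ b (m (m (m ha hc) hd) he) hb (by ring)) (hS _ c (m (m (m ha hb) hd) he) hc (by ring)))
    (hS _ d (m (m (m ha hb) hc) he) hd (by ring))) (hS _ e (m (m (m ha hb) hc) hd) he (by ring))) ?_
  linear_combination (baileyKappa p q * betaProduct p q a b c d e) * hJ -
    (baileyKappa p q * betaIntegral p q a b c d e) * hN

end

/-! ### Constancy near the unit circle -/

/-- A holomorphic function on an annulus that is invariant under multiplication by `q`, where the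
annulus is wider than a fundamental annulus, is constant. -/
lemma eq_of_annulus_of_mul_invariant {σ : ℝ} {q : ℂ} {h : ℂ → ℂ} (hσ₀ : 0 < σ) (hσ : σ < ‖q‖)
    (hσ' : ‖q‖ ^ 2 ≤ σ) (hq : ‖q‖ < 1) (hd : DifferentiableOn ℂ h {a | σ < ‖a‖ ∧ ‖a‖ < 1})
    (hinv : ∀ a, σ < ‖q * a‖ → ‖a‖ < 1 → h (q * a) = h a) {a a' : ℂ}
    (ha : σ < ‖a‖ ∧ ‖a‖ < 1) (ha' : σ < ‖a'‖ ∧ ‖a'‖ < 1) : h a = h a' := by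
  have hq₀ : 0 < ‖q‖ := hσ₀.trans hσ
  -- β > σ/|q| puts the closed fundamental annulus |q|β ≤ |x| ≤ β inside the domain. With β > |q|
  -- and σ ≥ |q|², a single multiplication or division by q moves any point of the domain into it,
  -- so the maximum over it is global.
  obtain ⟨β, hβ, hβ1⟩ := exists_between (max_lt hq ((div_lt_one hq₀).2 hσ))
  obtain ⟨hβq, hβσ⟩ := max_lt_iff.1 hβ
  rw [div_lt_iff₀ hq₀] at hβσ
  have hβ₀ : 0 < β := hq₀.trans hβq
  set K : Set ℂ := Metric.closedBall 0 β \ Metric.ball 0 (‖q‖ * β) with hK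
  have hKmem : ∀ x, x ∈ K ↔ ‖q‖ * β ≤ ‖x‖ ∧ ‖x‖ ≤ β := fun x => by
    simp [hK, and_comm]
  have hKU : K ⊆ {a | σ < ‖a‖ ∧ ‖a‖ < 1} := fun x hx => by
    rw [hKmem] at hx
    exact ⟨lt_of_lt_of_le (by linarith) hx.1, hx.2.trans_lt hβ1⟩
  have hKc : IsCompact K := (isCompact_closedBall 0 β).diff Metric.isOpen_ball
  have hKne : K.Nonempty := ⟨(β : ℂ), by
    rw [hKmem, Complex.norm_real, Real.norm_of_nonneg hβ₀.le]
    exact ⟨mul_le_of_le_one_left hβ₀.le hq.le, le_rfl⟩⟩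
  obtain ⟨a₀, ha₀, hmax⟩ := hKc.exists_isMaxOn hKne ((hd.continuousOn.mono hKU).norm)
  have hbound : ∀ x, σ < ‖x‖ → ‖x‖ < 1 → ‖h x‖ ≤ ‖h a₀‖ := by
    intro x hx hx1
    by_cases h1 : β < ‖x‖
    · have h2 : ‖q‖ * β < ‖q * x‖ := by rw [norm_mul]; gcongr
      rw [← hinv x (by linarith) hx1]
      refine hmax ((hKmem _).2 ⟨h2.le, ?_⟩)
      rw [norm_mul]
      nlinarith
    · by_cases h2 : ‖x‖ < ‖q‖ * β
      · have hqx : q * (x / q) = x := mul_div_cancel₀ x (norm_pos_iff.1 hq₀)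
        have h3 : ‖x / q‖ < β := by
          rw [norm_div, div_lt_iff₀ hq₀]
          linarith
        have h4 : ‖q‖ ≤ ‖x / q‖ := by
          rw [norm_div, le_div_iff₀ hq₀]
          nlinarith
        rw [← hqx, hinv (x / q) (by rwa [hqx]) (h3.trans hβ1)]
        refine hmax ((hKmem _).2 ⟨?_, h3.le⟩)
        nlinarith
      · exact hmax ((hKmem _).2 ⟨not_lt.1 h2, not_lt.1 h1⟩)
  -- The exponential map covers the annulus by a convex strip, which gives the connectedness needed
  -- for the maximum principle.
  set S : Set ℂ := {w | Real.log σ < w.re ∧ w.re < 0} with hS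
  have hSo : IsOpen S := (isOpen_lt continuous_const Complex.continuous_re).inter
    (isOpen_lt Complex.continuous_re continuous_const)
  have hSc : IsPreconnected S := ((convex_halfSpace_re_gt _).inter
    (convex_halfSpace_re_lt _)).isPreconnected
  have hSU : ∀ w ∈ S, σ < ‖Complex.exp w‖ ∧ ‖Complex.exp w‖ < 1 := fun w hw => by
    rw [Complex.norm_exp]
    exact ⟨(Real.log_lt_iff_lt_exp hσ₀).1 hw.1, Real.exp_lt_one_iff.2 hw.2⟩
  have hlog : ∀ x, σ < ‖x‖ ∧ ‖x‖ < 1 → Complex.log x ∈ S ∧ Complex.exp (Complex.log x) = x :=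
    fun x hx => by
      have hx₀ : x ≠ 0 := norm_pos_iff.1 (hσ₀.trans hx.1)
      refine ⟨?_, Complex.exp_log hx₀⟩
      rw [hS, Set.mem_ofPred_eq, Complex.log_re]
      exact ⟨Real.log_lt_log hσ₀ hx.1, Real.log_neg (norm_pos_iff.2 hx₀) hx.2⟩
  have hfd : DifferentiableOn ℂ (fun w => h (Complex.exp w)) S :=
    hd.comp Complex.differentiable_exp.differentiableOn hSU
  obtain ⟨hw₀, hw₀'⟩ := hlog a₀ (hKU ha₀)
  have hconst := Complex.eqOn_of_isPreconnected_of_isMaxOn_norm hSc hSo hfd hw₀ (fun w hw => by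
    simp only [Function.comp, Set.mem_ofPred_eq, hw₀']
    exact hbound _ (hSU w hw).1 (hSU w hw).2)
  have key : ∀ x, σ < ‖x‖ ∧ ‖x‖ < 1 → h x = h a₀ := fun x hx => by
    have := hconst (hlog x hx).1
    simpa only [(hlog x hx).2, Function.const_apply, hw₀'] using this
  rw [key a ha, key a' ha']

section

variable {p q a b c d e : ℂ}

lemma betaRatio_swap : betaRatio p q a b c d e = betaRatio p q b a c d e := by
  have h1 : betaIntegral p q a b c d e = betaIntegral p q b a c d e := by
    rw [betaIntegral, betaIntegral]
    congr 1
    funext z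
    rw [betaIntegrand, betaIntegrand, mul_comm a b, mul_comm (ellipticGammaPM p q a z)]
  have h2 : betaProduct p q a b c d e = betaProduct p q b a c d e := by
    rw [betaProduct, betaProduct, mul_comm b a]
    congr 1 <;> ring
  rw [betaRatio, betaRatio, h1, h2]

lemma pow_four_lt_norm {ρ : ℝ} (hρ : 0 < ρ) (hb : ρ < ‖b‖) (hc : ρ < ‖c‖) (hd : ρ < ‖d‖)
    (he : ρ < ‖e‖) : ρ ^ 4 < ‖b * c * d * e‖ := by
  rw [norm_mul, norm_mul, norm_mul, show ρ ^ 4 = ρ * ρ * ρ * ρ by ring]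
  gcongr

lemma betaDomain_of_lt {ρ : ℝ} (hρ : 0 < ρ) (hpρ : ‖p‖ ≤ ρ ^ 4) (hqρ : ‖q‖ ≤ ρ)
    (ha : ρ < ‖a‖ ∧ ‖a‖ < 1) (hb : ρ < ‖b‖ ∧ ‖b‖ < 1) (hc : ρ < ‖c‖ ∧ ‖c‖ < 1)
    (hd : ρ < ‖d‖ ∧ ‖d‖ < 1) (he : ρ < ‖e‖ ∧ ‖e‖ < 1) : BetaDomain p q a b c d e := by
  refine ⟨ha.2, hb.2, hc.2, hd.2, he.2, ?_⟩
  have := pow_four_lt_norm hρ hb.1 hc.1 hd.1 he.1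
  rw [show a * b * c * d * e = b * c * d * e * a by ring, norm_mul, norm_mul _ a]
  calc ‖p‖ * ‖q‖ ≤ ρ ^ 4 * ρ := by gcongr
    _ < _ := by gcongr; exact ha.1

/-- Because |bcde| > ρ⁴ ≥ |p|, the inner radius of the admissible annulus in a lies below |q|, so
`eq_of_annulus_of_mul_invariant` applies. -/
lemma betaRatio_eq_of_lt_left {ρ : ℝ} (hp : ‖p‖ < 1) (hq : ‖q‖ < 1) (hp₀ : p ≠ 0) (hq₀ : q ≠ 0)
    (hρ : 0 < ρ) (hpρ : ‖p‖ ≤ ρ ^ 4) (hqρ : ‖q‖ ≤ ρ) {a' : ℂ}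
    (ha : ρ < ‖a‖ ∧ ‖a‖ < 1) (ha' : ρ < ‖a'‖ ∧ ‖a'‖ < 1) (hb : ρ < ‖b‖ ∧ ‖b‖ < 1)
    (hc : ρ < ‖c‖ ∧ ‖c‖ < 1) (hd : ρ < ‖d‖ ∧ ‖d‖ < 1) (he : ρ < ‖e‖ ∧ ‖e‖ < 1) :
    betaRatio p q a b c d e = betaRatio p q a' b c d e := by
  have hq0 : 0 < ‖q‖ := norm_pos_iff.2 hq₀
  have hB : ‖p‖ < ‖b * c * d * e‖ := hpρ.trans_lt (pow_four_lt_norm hρ hb.1 hc.1 hd.1 he.1)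
  have hB0 : 0 < ‖b * c * d * e‖ := (norm_nonneg _).trans_lt hB
  -- The second entry is the admissibility bound for a; the first supplies the lower bound |q|² ≤ σ
  -- required by the constancy lemma.
  set σ := max (‖q‖ ^ 2) (‖p * q‖ / ‖b * c * d * e‖) with hσ
  have hσq : σ < ‖q‖ := by
    refine max_lt ?_ ?_
    · nlinarith
    · rw [div_lt_iff₀ hB0, norm_mul, mul_comm]
      gcongr
  have hdom : ∀ x : ℂ, σ < ‖x‖ → ‖x‖ < 1 → BetaDomain p q x b c d e := by
    intro x hx hx1
    refine ⟨hx1, hb.2, hc.2, hd.2, he.2, ?_⟩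
    have := (le_max_right _ _).trans_lt hx
    rw [div_lt_iff₀ hB0, ← norm_mul] at this
    rwa [show x * b * c * d * e = x * (b * c * d * e) by ring]
  have hopen : IsOpen {x : ℂ | σ < ‖x‖ ∧ ‖x‖ < 1} :=
    (isOpen_lt continuous_const continuous_norm).inter (isOpen_lt continuous_norm continuous_const)
  refine eq_of_annulus_of_mul_invariant (σ := σ) (q := q) (h := fun x => betaRatio p q x b c d e)
    ((pow_pos hq0 2).trans_le (le_max_left _ _)) hσq (le_max_left _ _) hq ?_ ?_
    ⟨(hσq.trans_le hqρ).trans ha.1, ha.2⟩ ⟨(hσq.trans_le hqρ).trans ha'.1, ha'.2⟩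
  · exact differentiableOn_betaRatio hp hq hopen (a := fun x => x) (b := fun _ => b)
      (c := fun _ => c) (d := fun _ => d) (e := fun _ => e) (fun x hx => hdom x hx.1 hx.2)
      (by fun_prop) (by fun_prop) (by fun_prop) (by fun_prop) (by fun_prop)
  · intro x hx hx1
    have hqx : ‖q * x‖ ≤ ‖x‖ := norm_mul_le_right hq.le
    exact betaRatio_mul_left hp hq hp₀ hq₀ (hdom x (hx.trans_le hqx) hx1)
      (hdom _ hx (hqx.trans_lt hx1))

lemma betaRatio_eq_of_lt {ρ : ℝ} (hp : ‖p‖ < 1) (hq : ‖q‖ < 1) (hp₀ : p ≠ 0) (hq₀ : q ≠ 0)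
    (hρ : 0 < ρ) (hpρ : ‖p‖ ≤ ρ ^ 4) (hqρ : ‖q‖ ≤ ρ) {a' b' : ℂ}
    (ha : ρ < ‖a‖ ∧ ‖a‖ < 1) (ha' : ρ < ‖a'‖ ∧ ‖a'‖ < 1) (hb : ρ < ‖b‖ ∧ ‖b‖ < 1)
    (hb' : ρ < ‖b'‖ ∧ ‖b'‖ < 1)
    (hc : ρ < ‖c‖ ∧ ‖c‖ < 1) (hd : ρ < ‖d‖ ∧ ‖d‖ < 1) (he : ρ < ‖e‖ ∧ ‖e‖ < 1) :
    betaRatio p q a b c d e = betaRatio p q a' b' c d e := by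
  rw [betaRatio_eq_of_lt_left hp hq hp₀ hq₀ hρ hpρ hqρ ha ha' hb hc hd he, betaRatio_swap,
    betaRatio_eq_of_lt_left hp hq hp₀ hq₀ hρ hpρ hqρ hb hb' ha' hc hd he, betaRatio_swap]

end

/-! ### The Poisson kernel -/

lemma norm_one_add_mul_inv_sq {r : ℝ} {z : ℂ} (hz : ‖z‖ = 1) :
    ‖1 + r ^ 2 * (z ^ 2)⁻¹‖ = ‖1 + (r : ℂ) ^ 2 * z ^ 2‖ := by
  have hz₀ : z ≠ 0 := norm_pos_iff.1 (by rw [hz]; exact one_pos)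
  have h : 1 + (r : ℂ) ^ 2 * (z ^ 2)⁻¹ = (starRingEnd ℂ) (1 + (r : ℂ) ^ 2 * z ^ 2) := by
    have : (starRingEnd ℂ) z = z⁻¹ := (Complex.inv_eq_conj hz).symm
    simp [this]
  rw [h, Complex.norm_conj]

/-- The Poisson kernel with peaks at `± i`. -/
noncomputable def poissonI (r : ℝ) (z : ℂ) : ℂ :=
  (1 - r ^ 4) / ((1 + r ^ 2 * z ^ 2) * (1 + r ^ 2 * (z ^ 2)⁻¹))

lemma one_sub_sq_le_norm {r : ℝ} (hr₀ : 0 ≤ r) {z : ℂ} (hz : ‖z‖ = 1) :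
    1 - r ^ 2 ≤ ‖1 + (r : ℂ) ^ 2 * z ^ 2‖ := by
  have := norm_sub_norm_le (1 : ℂ) (-((r : ℂ) ^ 2 * z ^ 2))
  simpa [hz, abs_of_nonneg hr₀] using this

lemma one_add_ne_zero_of_lt {r : ℝ} (hr₀ : 0 ≤ r) (hr : r < 1) {z : ℂ} (hz : ‖z‖ = 1) :
    1 + (r : ℂ) ^ 2 * z ^ 2 ≠ 0 := by
  refine norm_pos_iff.1 (lt_of_lt_of_le ?_ (one_sub_sq_le_norm hr₀ hz))
  nlinarith

lemma norm_poissonI {r : ℝ} (hr₀ : 0 ≤ r) (hr : r < 1) {z : ℂ} (hz : ‖z‖ = 1) :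
    ‖poissonI r z‖ = (1 - r ^ 4) / ‖1 + (r : ℂ) ^ 2 * z ^ 2‖ ^ 2 := by
  have h : (0 : ℝ) ≤ 1 - r ^ 4 := sub_nonneg.2 (pow_le_one₀ hr₀ hr.le)
  rw [poissonI, norm_div, norm_mul, norm_one_add_mul_inv_sq hz, ← pow_two]
  congr 1
  rw [show (1 : ℂ) - (r : ℂ) ^ 4 = ((1 - r ^ 4 : ℝ) : ℂ) by push_cast; ring, Complex.norm_real,
    Real.norm_of_nonneg h]

lemma poissonI_eq_norm {r : ℝ} (hr₀ : 0 ≤ r) (hr : r < 1) {z : ℂ} (hz : ‖z‖ = 1) :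
    poissonI r z = (‖poissonI r z‖ : ℂ) := by
  rw [norm_poissonI hr₀ hr hz, poissonI]
  have h : 1 + (r : ℂ) ^ 2 * (z ^ 2)⁻¹ = (starRingEnd ℂ) (1 + (r : ℂ) ^ 2 * z ^ 2) := by
    have : (starRingEnd ℂ) z = z⁻¹ := (Complex.inv_eq_conj hz).symm
    simp [this]
  rw [h, Complex.mul_conj, Complex.normSq_eq_norm_sq]
  push_cast
  rfl

/-- Since |1 + z²| ≤ |1 + r²z²| + (1 - r²) ≤ 2|1 + r²z²|, the denominator is controlled by |1 +
z²|². As r → 1 the kernel therefore concentrates where z² = -1. -/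
lemma norm_poissonI_mul_le {r : ℝ} (hr₀ : 0 ≤ r) (hr : r < 1) {z : ℂ} (hz : ‖z‖ = 1) :
    ‖poissonI r z‖ * ‖1 + z ^ 2‖ ^ 2 ≤ 4 * (1 - r ^ 4) := by
  have h1 := one_sub_sq_le_norm hr₀ hz
  have h2 : 0 < ‖1 + (r : ℂ) ^ 2 * z ^ 2‖ := norm_pos_iff.2 (one_add_ne_zero_of_lt hr₀ hr hz)
  have h3 : ‖1 + z ^ 2‖ ≤ 2 * ‖1 + (r : ℂ) ^ 2 * z ^ 2‖ := by
    have e : 1 + z ^ 2 = (1 + (r : ℂ) ^ 2 * z ^ 2) + ((1 - r ^ 2 : ℝ) : ℂ) * z ^ 2 := by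
      push_cast; ring
    have h4 : ‖((1 - r ^ 2 : ℝ) : ℂ) * z ^ 2‖ = 1 - r ^ 2 := by
      rw [norm_mul, norm_pow, hz, one_pow, mul_one, Complex.norm_real,
        Real.norm_of_nonneg (sub_nonneg.2 (pow_le_one₀ hr₀ hr.le))]
    rw [e]
    linarith [norm_add_le (1 + (r : ℂ) ^ 2 * z ^ 2) (((1 - r ^ 2 : ℝ) : ℂ) * z ^ 2)]
  have h5 : (0 : ℝ) ≤ 1 - r ^ 4 := sub_nonneg.2 (pow_le_one₀ hr₀ hr.le)
  rw [norm_poissonI hr₀ hr hz, div_mul_eq_mul_div, div_le_iff₀ (by positivity)]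
  have h6 : ‖1 + z ^ 2‖ ^ 2 ≤ (2 * ‖1 + (r : ℂ) ^ 2 * z ^ 2‖) ^ 2 := by gcongr
  nlinarith

lemma continuousOn_poissonI {r : ℝ} (hr₀ : 0 ≤ r) (hr : r < 1) :
    ContinuousOn (poissonI r) (Metric.sphere 0 1) := by
  intro z hz
  have hz1 : ‖z‖ = 1 := mem_sphere_zero_iff_norm.1 hz
  have hz₀ : z ≠ 0 := norm_pos_iff.1 (by rw [hz1]; exact one_pos)
  have h1 := one_add_ne_zero_of_lt hr₀ hr hz1
  have h2 : 1 + (r : ℂ) ^ 2 * (z ^ 2)⁻¹ ≠ 0 := by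
    rw [← norm_pos_iff, norm_one_add_mul_inv_sq hz1]
    exact norm_pos_iff.2 h1
  refine ContinuousAt.continuousWithinAt ?_
  unfold poissonI
  refine ContinuousAt.div (by fun_prop) ?_ (mul_ne_zero h1 h2)
  have : ContinuousAt (fun z : ℂ => (z ^ 2)⁻¹) z :=
    ContinuousAt.inv₀ (by fun_prop) (pow_ne_zero 2 hz₀)
  fun_prop

/-- On the circle the kernel is f(z) + f(1/z) - 1 with f(z) = 1/(1 + r²z²) holomorphic on the closed
disc, and f(0) = 1. -/
lemma circleIntegral_poissonI {r : ℝ} (hr₀ : 0 ≤ r) (hr : r < 1) :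
    (∮ z in C(0, 1), poissonI r z / z) = 2 * Real.pi * Complex.I := by
  have hz₀ : ∀ z ∈ Metric.sphere (0 : ℂ) 1, z ≠ 0 := fun z hz => ne_zero_of_mem_unit_sphere ⟨z, hz⟩
  set f : ℂ → ℂ := fun z => (1 + (r : ℂ) ^ 2 * z ^ 2)⁻¹ with hf
  have hne : ∀ z ∈ Metric.closedBall (0 : ℂ) 1, 1 + (r : ℂ) ^ 2 * z ^ 2 ≠ 0 := by
    intro z hz h
    have hz1 : ‖z‖ ≤ 1 := by simpa using hz
    have := congrArg norm (eq_neg_of_add_eq_zero_right h)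
    simp only [norm_mul, norm_pow, Complex.norm_real, norm_neg, norm_one,
      Real.norm_of_nonneg hr₀] at this
    have h1 : r * ‖z‖ < 1 := by nlinarith [norm_nonneg z]
    have h2 : 0 ≤ r * ‖z‖ := by positivity
    nlinarith
  have hfd : ∀ z ∈ Metric.closedBall (0 : ℂ) 1, DifferentiableAt ℂ f z := fun z hz =>
    DifferentiableAt.inv (by fun_prop) (hne z hz)
  have h1 : (∮ z in C(0, 1), f z / z) = 2 * Real.pi * Complex.I := by
    have := DifferentiableOn.circleIntegral_sub_inv_smul (f := f)
      (fun z hz => (hfd z hz).differentiableWithinAt) (Metric.mem_ball_self (x := (0 : ℂ)) one_pos)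
    simpa [hf, inv_mul_eq_div] using this
  have h2 := circleIntegral_comp_inv_div_self f
  have h3 : (∮ z in C(0, 1), (1 : ℂ) / z) = 2 * Real.pi * Complex.I := by
    simpa [one_div] using circleIntegral.integral_sub_center_inv (0 : ℂ) one_ne_zero
  have hfc : ContinuousOn f (Metric.sphere 0 1) := fun z hz =>
    (hfd z (Metric.sphere_subset_closedBall hz)).continuousAt.continuousWithinAt
  have hinv : ContinuousOn (fun z : ℂ => z⁻¹) (Metric.sphere 0 1) := continuousOn_inv₀.mono hz₀
  have i1 : CircleIntegrable (fun z => f z / z) 0 1 :=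
    (hfc.div continuousOn_id hz₀).circleIntegrable zero_le_one
  have i2 : CircleIntegrable (fun z => f z⁻¹ / z) 0 1 :=
    ((hfc.comp hinv fun z hz => by simpa using hz).div continuousOn_id hz₀).circleIntegrable
      zero_le_one
  have i3 : CircleIntegrable (fun z : ℂ => 1 / z) 0 1 :=
    (continuousOn_const.div continuousOn_id hz₀).circleIntegrable zero_le_one
  have i12 : CircleIntegrable (fun z => f z / z + f z⁻¹ / z) 0 1 := i1.add i2
  have e : (∮ z in C(0, 1), poissonI r z / z) =
      ∮ z in C(0, 1), (f z / z + f z⁻¹ / z - 1 / z) := by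
    refine circleIntegral.integral_congr zero_le_one fun z hz => ?_
    have hz1 : ‖z‖ = 1 := mem_sphere_zero_iff_norm.1 hz
    have g1 := one_add_ne_zero_of_lt hr₀ hr hz1
    have g2 : 1 + (r : ℂ) ^ 2 * (z ^ 2)⁻¹ ≠ 0 := by
      rw [← norm_pos_iff, norm_one_add_mul_inv_sq hz1]
      exact norm_pos_iff.2 g1
    have g3 : z ^ 2 * (z ^ 2)⁻¹ = 1 := mul_inv_cancel₀ (pow_ne_zero 2 (hz₀ z hz))
    simp only [poissonI, hf, inv_pow, ← add_div, ← sub_div]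
    congr 1
    generalize (z ^ 2)⁻¹ = y at *
    field_simp
    linear_combination (r : ℂ) ^ 4 * g3
  rw [e, circleIntegral.integral_sub i12 i3, circleIntegral.integral_add i1 i2, h2, h1, h3]
  ring

/-- The function |1 + z²|² + (1 - r) vanishes only at (1, ±i), where H = h. On the compact set where
|H - h| ≥ ε it is bounded below by some δ > 0, and C is a bound for |H - h| divided by δ. -/
lemma exists_norm_sub_le_of_continuousOn {H : ℝ → ℂ → ℂ} {r₁ : ℝ} {h : ℂ}
    (hH : ContinuousOn (fun x : ℝ × ℂ => H x.1 x.2) (Set.Icc r₁ 1 ×ˢ Metric.sphere 0 1))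
    (h1 : H 1 Complex.I = h) (h2 : H 1 (-Complex.I) = h) {ε : ℝ} (hε : 0 < ε) :
    ∃ C, 0 ≤ C ∧ ∀ r ∈ Set.Icc r₁ 1, ∀ z ∈ Metric.sphere (0 : ℂ) 1,
      ‖H r z - h‖ ≤ ε + C * (‖1 + z ^ 2‖ ^ 2 + (1 - r)) := by
  set T : Set (ℝ × ℂ) := Set.Icc r₁ 1 ×ˢ Metric.sphere 0 1 with hT
  have hTc : IsCompact T := isCompact_Icc.prod (isCompact_sphere _ _)
  have hm : ContinuousOn (fun x : ℝ × ℂ => ‖H x.1 x.2 - h‖) T := (hH.sub continuousOn_const).norm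
  obtain ⟨M, hM⟩ := hTc.bddAbove_image hm
  have hM' : ∀ x ∈ T, ‖H x.1 x.2 - h‖ ≤ M := fun x hx => hM ⟨x, hx, rfl⟩
  set S : Set (ℝ × ℂ) := T ∩ (fun x : ℝ × ℂ => ‖H x.1 x.2 - h‖) ⁻¹' Set.Ici ε with hS
  have hSc : IsCompact S :=
    hTc.of_isClosed_subset (hm.preimage_isClosed_of_isClosed hTc.isClosed isClosed_Ici)
      Set.inter_subset_left
  rcases S.eq_empty_or_nonempty with hne | hne
  · refine ⟨0, le_rfl, fun r hr z hz => ?_⟩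
    by_contra hcon
    have : (r, z) ∈ S := ⟨⟨hr, hz⟩, by
      simp only [Set.mem_preimage, Set.mem_Ici]
      linarith⟩
    rw [hne] at this
    exact this
  · obtain ⟨x₀, hx₀, hmin⟩ := hSc.exists_isMinOn hne
      (f := fun x : ℝ × ℂ => ‖1 + x.2 ^ 2‖ ^ 2 + (1 - x.1)) (by fun_prop)
    have hmin' : ∀ x ∈ S, ‖1 + x₀.2 ^ 2‖ ^ 2 + (1 - x₀.1) ≤ ‖1 + x.2 ^ 2‖ ^ 2 + (1 - x.1) :=
      isMinOn_iff.1 hmin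
    clear hmin
    obtain ⟨δ, hδ⟩ : ∃ δ, δ = ‖1 + x₀.2 ^ 2‖ ^ 2 + (1 - x₀.1) := ⟨_, rfl⟩
    rw [← hδ] at hmin'
    have hr0 : x₀.1 ≤ 1 := hx₀.1.1.2
    have hδ0 : 0 < δ := by
      by_contra hcon
      have e0 := sq_nonneg ‖1 + x₀.2 ^ 2‖
      have e1 : x₀.1 = 1 := by linarith
      have e2 : 1 + x₀.2 ^ 2 = 0 := by
        rw [← norm_eq_zero, ← sq_eq_zero_iff]
        linarith
      have e3 : (x₀.2 - Complex.I) * (x₀.2 + Complex.I) = 0 := by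
        linear_combination e2 - Complex.I_sq
      have e4 : ε ≤ ‖H x₀.1 x₀.2 - h‖ := hx₀.2
      rcases mul_eq_zero.1 e3 with h3 | h3
      · rw [e1, sub_eq_zero.1 h3, h1, sub_self, norm_zero] at e4
        linarith
      · rw [e1, eq_neg_of_add_eq_zero_left h3, h2, sub_self, norm_zero] at e4
        linarith
    have hM0 : 0 ≤ M := (norm_nonneg _).trans (hM' x₀ hx₀.1)
    refine ⟨M / δ, by positivity, fun r hr z hz => ?_⟩
    have hd : 0 ≤ ‖1 + z ^ 2‖ ^ 2 + (1 - r) := add_nonneg (by positivity) (sub_nonneg.2 hr.2)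
    by_cases hcon : ε ≤ ‖H r z - h‖
    · have h3 : δ ≤ ‖1 + z ^ 2‖ ^ 2 + (1 - r) := hmin' (r, z) ⟨⟨hr, hz⟩, hcon⟩
      have h4 := hM' (r, z) ⟨hr, hz⟩
      have h5 : M ≤ M / δ * (‖1 + z ^ 2‖ ^ 2 + (1 - r)) := by
        rw [div_mul_eq_mul_div, le_div_iff₀ hδ0]
        gcongr
      simp only at h4
      linarith
    · have : 0 ≤ M / δ * (‖1 + z ^ 2‖ ^ 2 + (1 - r)) := by positivity
      linarith

/-- The kernel is nonnegative with total mass 2π, so the part of the bound constant in z is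
integrated exactly, while the part with |1 + z²|² is handled by `norm_poissonI_mul_le`. -/
lemma norm_circleIntegral_poissonI_sub_le {r : ℝ} (hr₀ : 0 ≤ r) (hr : r < 1) {f : ℂ → ℂ}
    (hf : ContinuousOn f (Metric.sphere 0 1)) {h : ℂ} {ε C : ℝ} (hC : 0 ≤ C)
    (hb : ∀ z ∈ Metric.sphere (0 : ℂ) 1, ‖f z - h‖ ≤ ε + C * (‖1 + z ^ 2‖ ^ 2 + (1 - r))) :
    ‖(∮ z in C(0, 1), poissonI r z * f z / z) - 2 * Real.pi * Complex.I * h‖ ≤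
      2 * Real.pi * (ε + C * (1 - r) + 4 * C * (1 - r ^ 4)) := by
  have hz₀ : ∀ z ∈ Metric.sphere (0 : ℂ) 1, z ≠ 0 := fun z hz => ne_zero_of_mem_unit_sphere ⟨z, hz⟩
  have hK := continuousOn_poissonI hr₀ hr
  have i1 : CircleIntegrable (fun z => poissonI r z * f z / z) 0 1 :=
    ((hK.mul hf).div continuousOn_id hz₀).circleIntegrable zero_le_one
  have i2 : CircleIntegrable (fun z => poissonI r z / z * h) 0 1 :=
    ((hK.div continuousOn_id hz₀).mul continuousOn_const).circleIntegrable zero_le_one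
  have hmem : ∀ θ, circleMap 0 1 θ ∈ Metric.sphere (0 : ℂ) 1 := fun θ =>
    circleMap_mem_sphere 0 zero_le_one θ
  have hcm : ∀ {g : ℂ → ℂ}, ContinuousOn g (Metric.sphere 0 1) →
      Continuous fun θ => g (circleMap 0 1 θ) := fun hg =>
    hg.comp_continuous (continuous_circleMap 0 1) hmem
  have hint : ∫ θ in (0 : ℝ)..2 * Real.pi, ‖poissonI r (circleMap 0 1 θ)‖ = 2 * Real.pi := by
    have h1 := circleIntegral_poissonI hr₀ hr
    rw [circleIntegral_div_self _ one_ne_zero, mul_comm _ Complex.I] at h1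
    have h2 := mul_left_cancel₀ Complex.I_ne_zero h1
    have h3 : ∀ θ, poissonI r (circleMap 0 1 θ) = (‖poissonI r (circleMap 0 1 θ)‖ : ℂ) := fun θ =>
      poissonI_eq_norm hr₀ hr (mem_sphere_zero_iff_norm.1 (hmem θ))
    rw [intervalIntegral.integral_congr (fun θ _ => h3 θ), intervalIntegral.integral_ofReal] at h2
    exact_mod_cast h2
  have e : (∮ z in C(0, 1), poissonI r z * f z / z) - 2 * Real.pi * Complex.I * h =
      ∮ z in C(0, 1), poissonI r z * (f z - h) / z := by
    rw [← circleIntegral_poissonI hr₀ hr, mul_comm _ h, ← circleIntegral.integral_const_mul,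
      ← circleIntegral.integral_sub i1 (by simpa only [mul_comm _ h] using i2)]
    congr 1
    funext z
    ring
  rw [e, circleIntegral_div_self _ one_ne_zero, norm_mul, Complex.norm_I, one_mul]
  have hpt : ∀ θ, ‖poissonI r (circleMap 0 1 θ) * (f (circleMap 0 1 θ) - h)‖ ≤
      ‖poissonI r (circleMap 0 1 θ)‖ * (ε + C * (1 - r)) + 4 * C * (1 - r ^ 4) := fun θ => by
    have h1 := hb _ (hmem θ)
    have h2 := norm_poissonI_mul_le hr₀ hr (mem_sphere_zero_iff_norm.1 (hmem θ))
    rw [norm_mul]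
    nlinarith [mul_le_mul_of_nonneg_left h1 (norm_nonneg (poissonI r (circleMap 0 1 θ))),
      mul_le_mul_of_nonneg_left h2 hC]
  have c1 : Continuous fun θ => ‖poissonI r (circleMap 0 1 θ)‖ := (hcm hK).norm
  have c2 : Continuous fun θ => ‖poissonI r (circleMap 0 1 θ) * (f (circleMap 0 1 θ) - h)‖ :=
    ((hcm hK).mul ((hcm hf).sub continuous_const)).norm
  refine (intervalIntegral.norm_integral_le_integral_norm Real.two_pi_pos.le).trans ?_
  have c3 : Continuous fun θ => ‖poissonI r (circleMap 0 1 θ)‖ * (ε + C * (1 - r)) :=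
    c1.mul continuous_const
  have c4 : Continuous fun θ => ‖poissonI r (circleMap 0 1 θ)‖ * (ε + C * (1 - r)) +
      4 * C * (1 - r ^ 4) := c3.add continuous_const
  refine (intervalIntegral.integral_mono Real.two_pi_pos.le (c2.intervalIntegrable _ _)
    (c4.intervalIntegrable _ _) hpt).trans_eq ?_
  rw [intervalIntegral.integral_add (c3.intervalIntegrable _ _) intervalIntegrable_const,
    intervalIntegral.integral_mul_const, hint,
    intervalIntegral.integral_const, smul_eq_mul]
  ring

/-- As r → 1 the integrals tend to 2πi h and the right side to 2c. The factor 1 + r² is what remains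
of 1 - r⁴ after the pole 1/(1 - r²) of Γ(ab) has been divided out. -/
lemma eq_of_circleIntegral_poissonI_eq {H : ℝ → ℂ → ℂ} {r₁ : ℝ} {h c : ℂ} (hr₁ : 0 ≤ r₁)
    (hr₁' : r₁ < 1)
    (hH : ContinuousOn (fun x : ℝ × ℂ => H x.1 x.2) (Set.Icc r₁ 1 ×ˢ Metric.sphere 0 1))
    (h1 : H 1 Complex.I = h) (h2 : H 1 (-Complex.I) = h)
    (hc : ∀ r ∈ Set.Ico r₁ 1, (∮ z in C(0, 1), poissonI r z * H r z / z) = (1 + (r : ℂ) ^ 2) * c) :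
    c = Real.pi * Complex.I * h := by
  have key : ∀ ε > 0, ‖2 * c - 2 * Real.pi * Complex.I * h‖ ≤ 2 * Real.pi * ε := by
    intro ε hε
    obtain ⟨C, hC, hb⟩ := exists_norm_sub_le_of_continuousOn hH h1 h2 hε
    have hL : Tendsto (fun r : ℝ => ‖(1 + (r : ℂ) ^ 2) * c - 2 * Real.pi * Complex.I * h‖) (𝓝[<] 1)
        (𝓝 ‖(1 + ((1 : ℝ) : ℂ) ^ 2) * c - 2 * Real.pi * Complex.I * h‖) :=
      (Continuous.tendsto (by fun_prop) 1).mono_left nhdsWithin_le_nhds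
    have hR : Tendsto (fun r : ℝ => 2 * Real.pi * (ε + C * (1 - r) + 4 * C * (1 - r ^ 4))) (𝓝[<] 1)
        (𝓝 (2 * Real.pi * (ε + C * (1 - 1) + 4 * C * (1 - 1 ^ 4)))) :=
      (Continuous.tendsto (by fun_prop) 1).mono_left nhdsWithin_le_nhds
    have := le_of_tendsto_of_tendsto hL hR (by
      filter_upwards [Ico_mem_nhdsLT hr₁'] with r hr
      rw [← hc r hr]
      exact norm_circleIntegral_poissonI_sub_le (hr₁.trans hr.1) hr.2
        (hH.comp (f := fun z => (r, z)) (by fun_prop) fun z hz => ⟨⟨hr.1, hr.2.le⟩, hz⟩) hC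
        (hb r ⟨hr.1, hr.2.le⟩))
    norm_num at this ⊢
    exact this
  have h0 : ‖2 * c - 2 * Real.pi * Complex.I * h‖ ≤ 0 := by
    refine le_of_forall_pos_le_add fun δ hδ => ?_
    have := key (δ / (2 * Real.pi)) (by positivity)
    rwa [mul_div_cancel₀ _ Real.two_pi_pos.ne', ← zero_add δ] at this
  have := norm_le_zero_iff.1 h0
  linear_combination this / 2

/-! ### The elliptic beta integral near the unit circle -/

/-- The function `(1 - z) Γ(z)`, with its removable singularity at `z = 1` removed. -/
noncomputable def ellipticGammaReg (p q z : ℂ) : ℂ :=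
  doublePochhammer p q (p * q / z) / (qPochhammerInf (p * z) p * doublePochhammer p q (q * z))

section

variable {p q a b c d e : ℂ}

lemma ellipticGamma_eq_reg_div (hp : ‖p‖ < 1) (hq : ‖q‖ < 1) (z : ℂ) :
    ellipticGamma p q z = ellipticGammaReg p q z / (1 - z) := by
  rw [ellipticGamma_eq_div hp hq, ellipticGammaReg, div_div, doublePochhammer_eq_mul_right hp hq z,
    qPochhammerInf_eq_mul hp z]
  congr 1
  ring

lemma ellipticGammaReg_denom_ne_zero (hp : ‖p‖ < 1) (hq : ‖q‖ < 1) {z : ℂ} (hz : ‖z‖ ≤ 1) :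
    qPochhammerInf (p * z) p * doublePochhammer p q (q * z) ≠ 0 := by
  refine mul_ne_zero (qPochhammerInf_ne_zero hp ?_) (doublePochhammer_ne_zero hp hq ?_)
  · exact (norm_mul_le_left hz).trans_lt hp
  · exact (norm_mul_le_left hz).trans_lt hq

lemma ellipticGammaReg_ne_zero (hp : ‖p‖ < 1) (hq : ‖q‖ < 1) {z : ℂ} (hz : ‖p * q‖ < ‖z‖)
    (hz' : ‖z‖ ≤ 1) : ellipticGammaReg p q z ≠ 0 :=
  div_ne_zero (doublePochhammer_ne_zero hp hq (norm_mul_div_lt_one hz))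
    (ellipticGammaReg_denom_ne_zero hp hq hz')

lemma continuousAt_ellipticGammaReg (hp : ‖p‖ < 1) (hq : ‖q‖ < 1) {z : ℂ} (hz : z ≠ 0)
    (hz' : ‖z‖ ≤ 1) : ContinuousAt (ellipticGammaReg p q) z := by
  have h1 := (differentiable_doublePochhammer hp hq).continuous
  have h2 := (differentiable_qPochhammerInf hp).continuous
  refine ContinuousAt.div ?_ ?_ (ellipticGammaReg_denom_ne_zero hp hq hz')
  · exact h1.continuousAt.comp (f := fun z => p * q / z) (by fun_prop (disch := exact hz))
  · exact Continuous.continuousAt (by fun_prop)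

/-- This is the residue constant that cancels the numerator of κ in the limit. -/
lemma ellipticGammaReg_one (hp : ‖p‖ < 1) (hq : ‖q‖ < 1) :
    ellipticGammaReg p q 1 = (qPochhammerInf q q * qPochhammerInf p p)⁻¹ := by
  have h := doublePochhammer_eq_mul_left hp hq q
  have h0 : doublePochhammer p q (p * q) ≠ 0 := doublePochhammer_ne_zero hp hq (by
    rw [norm_mul]
    exact mul_lt_one_of_nonneg_of_lt_one_left (norm_nonneg _) hp hq.le)
  rw [ellipticGammaReg, div_one, mul_one, mul_one, h, mul_comm (qPochhammerInf p p), mul_assoc,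
    mul_comm (doublePochhammer p q (p * q)), ← mul_assoc, div_mul_cancel_right₀ h0]

/-- The integrand of the elliptic beta integral with the poles in the parameters `a`, `b` near the
unit circle removed. -/
noncomputable def betaIntegrandReg (p q a b c d e z : ℂ) : ℂ :=
  ellipticGammaReg p q (a * z) * ellipticGammaReg p q (a * z⁻¹) *
    (ellipticGammaReg p q (b * z) * ellipticGammaReg p q (b * z⁻¹)) *
    ellipticGammaPM p q c z * ellipticGammaPM p q d z * ellipticGammaPM p q e z *
    ((ellipticGammaPM p q 1 (z ^ 2))⁻¹ * (ellipticGammaPM p q (a * b * c * d * e) z)⁻¹)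

/-- The factors of the evaluation of the elliptic beta integral other than `Γ(ab)`. -/
noncomputable def betaProductReg (p q a b c d e : ℂ) : ℂ :=
  ellipticGamma p q (a * c) * ellipticGamma p q (a * d) *
      ellipticGamma p q (a * e) * ellipticGamma p q (b * c) * ellipticGamma p q (b * d) *
      ellipticGamma p q (b * e) * ellipticGamma p q (c * d) * ellipticGamma p q (c * e) *
      ellipticGamma p q (d * e) /
    (ellipticGamma p q (b * c * d * e) * ellipticGamma p q (a * c * d * e) *
      ellipticGamma p q (a * b * d * e) * ellipticGamma p q (a * b * c * e) *
      ellipticGamma p q (a * b * c * d))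

lemma betaProduct_eq_mul_reg :
    betaProduct p q a b c d e = ellipticGamma p q (a * b) * betaProductReg p q a b c d e := by
  rw [betaProduct, betaProductReg, mul_div_assoc']
  congr 1
  ring

lemma betaIntegrand_eq_reg (hp : ‖p‖ < 1) (hq : ‖q‖ < 1) (z : ℂ) :
    betaIntegrand p q a b c d e z = betaIntegrandReg p q a b c d e z /
      ((1 - a * z) * (1 - a * z⁻¹) * ((1 - b * z) * (1 - b * z⁻¹))) := by
  have h : ∀ x, ellipticGammaPM p q x z = ellipticGammaReg p q (x * z) *
      ellipticGammaReg p q (x * z⁻¹) * ((1 - x * z) * (1 - x * z⁻¹))⁻¹ := fun x => by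
    rw [ellipticGammaPM, ellipticGamma_eq_reg_div hp hq, ellipticGamma_eq_reg_div hp hq (x * z⁻¹),
      div_mul_div_comm, div_eq_mul_inv]
  rw [betaIntegrand, betaIntegrandReg, h a, h b, div_eq_mul_inv, div_eq_mul_inv,
    mul_inv (ellipticGammaPM p q 1 (z ^ 2)), mul_inv ((1 - a * z) * (1 - a * z⁻¹))]
  generalize ((1 - a * z) * (1 - a * z⁻¹))⁻¹ = A
  generalize ((1 - b * z) * (1 - b * z⁻¹))⁻¹ = B
  ring

/-- Parameters that are close to the unit circle, two of them possibly on it. -/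
structure NearCircle (p q a b c d e : ℂ) (ρ : ℝ) : Prop where
  hρ : 0 < ρ
  hp : ‖p‖ ≤ ρ ^ 4
  hq : ‖q‖ ≤ ρ
  ha : ρ < ‖a‖ ∧ ‖a‖ ≤ 1
  hb : ρ < ‖b‖ ∧ ‖b‖ ≤ 1
  hc : ρ < ‖c‖ ∧ ‖c‖ < 1
  hd : ρ < ‖d‖ ∧ ‖d‖ < 1
  he : ρ < ‖e‖ ∧ ‖e‖ < 1

lemma NearCircle.norm_mul_lt {ρ : ℝ} (h : NearCircle p q a b c d e ρ) {x y : ℂ} (hx : ρ < ‖x‖)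
    (hy : ρ < ‖y‖) : ‖p * q‖ < ‖x * y‖ := by
  have h1 : ρ ≤ 1 := (h.ha.1.trans_le h.ha.2).le
  have h2 : ρ ^ 4 < ‖x * y‖ := by
    have : ρ ^ 4 ≤ ρ ^ 2 := pow_le_pow_of_le_one h.hρ.le h1 (by norm_num)
    rw [norm_mul]
    have h0 := h.hρ
    nlinarith
  exact (norm_mul_le_left (h.hq.trans h1)).trans_lt (h.hp.trans_lt h2)

lemma NearCircle.norm_mul_lt_three {ρ : ℝ} (h : NearCircle p q a b c d e ρ) {x y z w : ℂ}
    (hx : ρ < ‖x‖) (hy : ρ < ‖y‖) (hz : ρ < ‖z‖) (hw : ρ < ‖w‖) :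
    ‖p * q‖ < ‖x * y * z * w‖ := by
  have h1 : ρ ≤ 1 := (h.ha.1.trans_le h.ha.2).le
  exact (norm_mul_le_left (h.hq.trans h1)).trans_lt
    (h.hp.trans_lt (pow_four_lt_norm h.hρ hx hy hz hw))

lemma NearCircle.norm_lt {ρ : ℝ} (h : NearCircle p q a b c d e ρ) :
    ‖p * q‖ < ‖a * b * c * d * e‖ := by
  have h1 := pow_four_lt_norm h.hρ h.hb.1 h.hc.1 h.hd.1 h.he.1
  have h0 := h.hρ
  rw [show a * b * c * d * e = a * (b * c * d * e) by ring, norm_mul, norm_mul _ (b * c * d * e)]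
  calc ‖p‖ * ‖q‖ ≤ ρ ^ 4 * ρ := mul_le_mul h.hp h.hq (norm_nonneg _) (by positivity)
    _ = ρ * ρ ^ 4 := mul_comm _ _
    _ < _ := by gcongr; exact h.ha.1

lemma NearCircle.ne_zero {ρ : ℝ} (h : NearCircle p q a b c d e ρ) {x : ℂ} (hx : ρ < ‖x‖) :
    x ≠ 0 := norm_pos_iff.1 (h.hρ.trans hx)

/-- The fifteen arguments of elliptic gamma functions other than `ab` lie in the annulus where the
elliptic gamma function is holomorphic and does not vanish. -/
lemma NearCircle.annulus {ρ : ℝ} (h : NearCircle p q a b c d e ρ) :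
    ((‖p * q‖ < ‖a * c‖ ∧ ‖a * c‖ < 1) ∧ (‖p * q‖ < ‖a * d‖ ∧ ‖a * d‖ < 1) ∧
      (‖p * q‖ < ‖a * e‖ ∧ ‖a * e‖ < 1) ∧ (‖p * q‖ < ‖b * c‖ ∧ ‖b * c‖ < 1) ∧
      (‖p * q‖ < ‖b * d‖ ∧ ‖b * d‖ < 1) ∧ (‖p * q‖ < ‖b * e‖ ∧ ‖b * e‖ < 1) ∧
      (‖p * q‖ < ‖c * d‖ ∧ ‖c * d‖ < 1) ∧ (‖p * q‖ < ‖c * e‖ ∧ ‖c * e‖ < 1) ∧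
      (‖p * q‖ < ‖d * e‖ ∧ ‖d * e‖ < 1)) ∧
    ((‖p * q‖ < ‖b * c * d * e‖ ∧ ‖b * c * d * e‖ < 1) ∧
      (‖p * q‖ < ‖a * c * d * e‖ ∧ ‖a * c * d * e‖ < 1) ∧
      (‖p * q‖ < ‖a * b * d * e‖ ∧ ‖a * b * d * e‖ < 1) ∧
      (‖p * q‖ < ‖a * b * c * e‖ ∧ ‖a * b * c * e‖ < 1) ∧
      (‖p * q‖ < ‖a * b * c * d‖ ∧ ‖a * b * c * d‖ < 1)) := by
  have l : ∀ {x y : ℂ}, ‖x‖ ≤ 1 → ‖y‖ < 1 → ‖x * y‖ < 1 := fun hx hy =>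
    (norm_mul_le_right hx).trans_lt hy
  have l' : ∀ {x y : ℂ}, ‖x‖ ≤ 1 → ‖y‖ ≤ 1 → ‖x * y‖ ≤ 1 := fun hx hy =>
    (norm_mul_le_right hx).trans hy
  obtain ⟨-, -, -, ha, hb, hc, hd, he⟩ := id h
  exact ⟨⟨⟨h.norm_mul_lt ha.1 hc.1, l ha.2 hc.2⟩, ⟨h.norm_mul_lt ha.1 hd.1, l ha.2 hd.2⟩,
    ⟨h.norm_mul_lt ha.1 he.1, l ha.2 he.2⟩, ⟨h.norm_mul_lt hb.1 hc.1, l hb.2 hc.2⟩,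
    ⟨h.norm_mul_lt hb.1 hd.1, l hb.2 hd.2⟩, ⟨h.norm_mul_lt hb.1 he.1, l hb.2 he.2⟩,
    ⟨h.norm_mul_lt hc.1 hd.1, l hc.2.le hd.2⟩, ⟨h.norm_mul_lt hc.1 he.1, l hc.2.le he.2⟩,
    ⟨h.norm_mul_lt hd.1 he.1, l hd.2.le he.2⟩⟩,
    ⟨h.norm_mul_lt_three hb.1 hc.1 hd.1 he.1, l (l' (l' hb.2 hc.2.le) hd.2.le) he.2⟩,
    ⟨h.norm_mul_lt_three ha.1 hc.1 hd.1 he.1, l (l' (l' ha.2 hc.2.le) hd.2.le) he.2⟩,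
    ⟨h.norm_mul_lt_three ha.1 hb.1 hd.1 he.1, l (l' (l' ha.2 hb.2) hd.2.le) he.2⟩,
    ⟨h.norm_mul_lt_three ha.1 hb.1 hc.1 he.1, l (l' (l' ha.2 hb.2) hc.2.le) he.2⟩,
    ⟨h.norm_mul_lt_three ha.1 hb.1 hc.1 hd.1, l (l' (l' ha.2 hb.2) hc.2.le) hd.2⟩⟩

lemma betaProductReg_ne_zero (hp : ‖p‖ < 1) (hq : ‖q‖ < 1) {ρ : ℝ}
    (h : NearCircle p q a b c d e ρ) : betaProductReg p q a b c d e ≠ 0 := by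
  have g : ∀ {x : ℂ}, (‖p * q‖ < ‖x‖ ∧ ‖x‖ < 1) → ellipticGamma p q x ≠ 0 := fun hx =>
    ellipticGamma_ne_zero hp hq hx.1 hx.2
  obtain ⟨⟨h1, h2, h3, h4, h5, h6, h7, h8, h9⟩, k1, k2, k3, k4, k5⟩ := h.annulus
  unfold betaProductReg
  exact div_ne_zero (mul_ne_zero (mul_ne_zero (mul_ne_zero (mul_ne_zero (mul_ne_zero (mul_ne_zero
    (mul_ne_zero (mul_ne_zero (g h1) (g h2)) (g h3)) (g h4)) (g h5)) (g h6)) (g h7)) (g h8)) (g h9))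
    (mul_ne_zero (mul_ne_zero (mul_ne_zero (mul_ne_zero (g k1) (g k2)) (g k3)) (g k4)) (g k5))

lemma continuousAt_ellipticGamma_comp {X : Type*} [TopologicalSpace X] (hp : ‖p‖ < 1)
    (hq : ‖q‖ < 1) {f : X → ℂ} {x : X} (hf : ContinuousAt f x) (h₀ : f x ≠ 0) (h1 : ‖f x‖ < 1) :
    ContinuousAt (fun x => ellipticGamma p q (f x)) x :=
  ContinuousAt.comp (g := ellipticGamma p q)
    (differentiableAt_ellipticGamma hp hq h₀ h1).continuousAt hf

lemma continuousAt_ellipticGamma_inv_comp {X : Type*} [TopologicalSpace X] (hp : ‖p‖ < 1)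
    (hq : ‖q‖ < 1) {f : X → ℂ} {x : X} (hf : ContinuousAt f x) (h1 : ‖p * q‖ < ‖f x‖) :
    ContinuousAt (fun x => (ellipticGamma p q (f x))⁻¹) x :=
  ContinuousAt.comp (g := fun z => (ellipticGamma p q z)⁻¹)
    (differentiableAt_ellipticGamma_inv hp hq h1).continuousAt hf

lemma continuousAt_ellipticGammaReg_comp {X : Type*} [TopologicalSpace X] (hp : ‖p‖ < 1)
    (hq : ‖q‖ < 1) {f : X → ℂ} {x : X} (hf : ContinuousAt f x) (h₀ : f x ≠ 0) (h1 : ‖f x‖ ≤ 1) :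
    ContinuousAt (fun x => ellipticGammaReg p q (f x)) x :=
  ContinuousAt.comp (g := ellipticGammaReg p q) (continuousAt_ellipticGammaReg hp hq h₀ h1) hf

lemma continuousAt_ellipticGammaPM_comp {X : Type*} [TopologicalSpace X] (hp : ‖p‖ < 1)
    (hq : ‖q‖ < 1) {f g : X → ℂ} {x : X} (hf : ContinuousAt f x) (hg : ContinuousAt g x)
    (h₀ : f x ≠ 0) (h1 : ‖f x‖ < 1) (hg1 : ‖g x‖ = 1) :
    ContinuousAt (fun x => ellipticGammaPM p q (f x) (g x)) x := by
  have hg₀ : g x ≠ 0 := norm_pos_iff.1 (by rw [hg1]; exact one_pos)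
  exact (continuousAt_ellipticGamma_comp hp hq (hf.mul hg) (mul_ne_zero h₀ hg₀)
    (by simpa [hg1] using h1)).mul (continuousAt_ellipticGamma_comp hp hq (hf.mul (hg.inv₀ hg₀))
    (mul_ne_zero h₀ (inv_ne_zero hg₀)) (by simpa [hg1] using h1))

lemma continuousAt_ellipticGammaPM_inv_comp {X : Type*} [TopologicalSpace X] (hp : ‖p‖ < 1)
    (hq : ‖q‖ < 1) {f g : X → ℂ} {x : X} (hf : ContinuousAt f x) (hg : ContinuousAt g x)
    (h1 : ‖p * q‖ < ‖f x‖) (hg1 : ‖g x‖ = 1) :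
    ContinuousAt (fun x => (ellipticGammaPM p q (f x) (g x))⁻¹) x := by
  have hg₀ : g x ≠ 0 := norm_pos_iff.1 (by rw [hg1]; exact one_pos)
  simp only [ellipticGammaPM, mul_inv]
  exact (continuousAt_ellipticGamma_inv_comp hp hq (hf.mul hg) (by simpa [hg1] using h1)).mul
    (continuousAt_ellipticGamma_inv_comp hp hq (hf.mul (hg.inv₀ hg₀)) (by simpa [hg1] using h1))

lemma continuousAt_betaProductReg {X : Type*} [TopologicalSpace X] (hp : ‖p‖ < 1) (hq : ‖q‖ < 1)
    {ρ : ℝ} {a b : X → ℂ} {x : X} (h : NearCircle p q (a x) (b x) c d e ρ)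
    (ha : ContinuousAt a x) (hb : ContinuousAt b x) :
    ContinuousAt (fun x => betaProductReg p q (a x) (b x) c d e) x := by
  have g : ∀ {f : X → ℂ}, (‖p * q‖ < ‖f x‖ ∧ ‖f x‖ < 1) → ContinuousAt f x →
      ContinuousAt (fun x => ellipticGamma p q (f x)) x := fun hx hf =>
    continuousAt_ellipticGamma_comp hp hq hf (norm_pos_iff.1 ((norm_nonneg _).trans_lt hx.1)) hx.2
  have g' : ∀ {f : X → ℂ}, (‖p * q‖ < ‖f x‖ ∧ ‖f x‖ < 1) → ContinuousAt f x →
      ContinuousAt (fun x => (ellipticGamma p q (f x))⁻¹) x := fun hx hf =>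
    continuousAt_ellipticGamma_inv_comp hp hq hf hx.1
  obtain ⟨⟨h1, h2, h3, h4, h5, h6, h7, h8, h9⟩, k1, k2, k3, k4, k5⟩ := h.annulus
  simp only [betaProductReg, div_eq_mul_inv, mul_inv]
  exact (((((((((g h1 (by fun_prop)).mul (g h2 (by fun_prop))).mul (g h3 (by fun_prop))).mul
    (g h4 (by fun_prop))).mul (g h5 (by fun_prop))).mul (g h6 (by fun_prop))).mul
    (g h7 (by fun_prop))).mul (g h8 (by fun_prop))).mul (g h9 (by fun_prop))).mul
    (((((g' k1 (by fun_prop)).mul (g' k2 (by fun_prop))).mul (g' k3 (by fun_prop))).mul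
    (g' k4 (by fun_prop))).mul (g' k5 (by fun_prop)))

lemma continuousAt_betaIntegrandReg {X : Type*} [TopologicalSpace X] (hp : ‖p‖ < 1) (hq : ‖q‖ < 1)
    {ρ : ℝ} {a b z : X → ℂ} {x : X} (h : NearCircle p q (a x) (b x) c d e ρ)
    (ha : ContinuousAt a x) (hb : ContinuousAt b x) (hz : ContinuousAt z x) (hz1 : ‖z x‖ = 1) :
    ContinuousAt (fun x => betaIntegrandReg p q (a x) (b x) c d e (z x)) x := by
  have hz₀ : z x ≠ 0 := norm_pos_iff.1 (by rw [hz1]; exact one_pos)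
  have r1 : ∀ {f : X → ℂ}, ContinuousAt f x → ρ < ‖f x‖ → ‖f x‖ ≤ 1 →
      ContinuousAt (fun x => ellipticGammaReg p q (f x * z x) *
        ellipticGammaReg p q (f x * (z x)⁻¹)) x := by
    intro f hf hf0 hf1
    have hf0 := h.ne_zero hf0
    exact (continuousAt_ellipticGammaReg_comp hp hq (hf.mul hz) (mul_ne_zero hf0 hz₀)
      (by simpa [hz1] using hf1)).mul (continuousAt_ellipticGammaReg_comp hp hq
      (hf.mul (hz.inv₀ hz₀)) (mul_ne_zero hf0 (inv_ne_zero hz₀)) (by simpa [hz1] using hf1))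
  have r2 : ∀ {y : ℂ}, ρ < ‖y‖ ∧ ‖y‖ < 1 →
      ContinuousAt (fun x => ellipticGammaPM p q y (z x)) x := fun hy =>
    continuousAt_ellipticGammaPM_comp hp hq continuousAt_const hz (h.ne_zero hy.1) hy.2 hz1
  unfold betaIntegrandReg
  exact (((((r1 ha h.ha.1 h.ha.2).mul (r1 hb h.hb.1 h.hb.2)).mul (r2 h.hc)).mul (r2 h.hd)).mul
    (r2 h.he)).mul ((continuousAt_ellipticGammaPM_inv_comp hp hq continuousAt_const (hz.pow 2)
      (by simpa using norm_mul_lt_one hp hq) (by simp [hz1])).mul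
    (continuousAt_ellipticGammaPM_inv_comp hp hq (by fun_prop) hz h.norm_lt hz1))

lemma betaIntegrandReg_inv (z : ℂ) :
    betaIntegrandReg p q a b c d e z⁻¹ = betaIntegrandReg p q a b c d e z := by
  have h : ∀ x z, ellipticGammaPM p q x z⁻¹ = ellipticGammaPM p q x z := fun x z => by
    rw [ellipticGammaPM, ellipticGammaPM, inv_inv, mul_comm]
  simp only [betaIntegrandReg, inv_pow, h, inv_inv]
  ring

/-- Here ab = 1, and the products of a, b with z^{±1} are 1 and -1, each twice. The value Γ(-1) is
half the regularised value at -1, so 1/Γ(z^{±2}) contributes the factor 4; the other gamma factors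
match those of the product after cancellation. -/
lemma betaIntegrandReg_I (hp : ‖p‖ < 1) (hq : ‖q‖ < 1) {ρ : ℝ}
    (h : NearCircle p q Complex.I (-Complex.I) c d e ρ) :
    betaIntegrandReg p q Complex.I (-Complex.I) c d e Complex.I =
      4 * ellipticGammaReg p q 1 ^ 2 * betaProductReg p q Complex.I (-Complex.I) c d e := by
  have g : ∀ {x : ℂ}, (‖p * q‖ < ‖x‖ ∧ ‖x‖ < 1) → ellipticGamma p q x ≠ 0 := fun hx =>
    ellipticGamma_ne_zero hp hq hx.1 hx.2
  obtain ⟨⟨h1, h2, h3, h4, h5, h6, h7, h8, h9⟩, k1, k2, k3, k4, k5⟩ := h.annulus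
  have i1 : Complex.I * -Complex.I = 1 := by simp
  have hR : ellipticGammaReg p q (-1) ≠ 0 := ellipticGammaReg_ne_zero hp hq
    (by simpa using norm_mul_lt_one hp hq) (by simp)
  have e1 : ellipticGamma p q (-1) = ellipticGammaReg p q (-1) / 2 := by
    rw [ellipticGamma_eq_reg_div hp hq]
    norm_num
  have hPM : ∀ x, ellipticGammaPM p q x Complex.I =
      ellipticGamma p q (Complex.I * x) * ellipticGamma p q (-Complex.I * x) := fun x => by
    rw [ellipticGammaPM, Complex.inv_I, mul_comm x, mul_comm x]
  have hPM1 : ellipticGammaPM p q 1 (Complex.I ^ 2) = (ellipticGammaReg p q (-1) / 2) ^ 2 := by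
    rw [ellipticGammaPM, Complex.I_sq, inv_neg, inv_one, one_mul, e1, pow_two]
  have m1 : -Complex.I * c * d * e = -Complex.I * (c * d * e) := by ring
  have m2 : Complex.I * c * d * e = Complex.I * (c * d * e) := by ring
  rw [m1] at k1
  rw [m2] at k2
  rw [i1, one_mul] at k3 k4 k5
  rw [betaIntegrandReg, betaProductReg, hPM1, hPM, hPM, hPM, hPM, i1, m1, m2, Complex.inv_I,
    Complex.I_mul_I, i1, one_mul c, one_mul d,
    show -Complex.I * Complex.I = 1 by simp, show -Complex.I * -Complex.I = -1 by simp]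
  have n1 := g k1
  have n2 := g k2
  have n3 := g k3
  have n4 := g k4
  have n5 := g k5
  generalize ellipticGammaReg p q (-1) = R at hR ⊢
  generalize ellipticGamma p q (c * d) = x1 at n5 ⊢
  generalize ellipticGamma p q (c * e) = x2 at n4 ⊢
  generalize ellipticGamma p q (d * e) = x3 at n3 ⊢
  generalize ellipticGamma p q (Complex.I * (c * d * e)) = x4 at n2 ⊢
  generalize ellipticGamma p q (-Complex.I * (c * d * e)) = x5 at n1 ⊢
  generalize ellipticGamma p q (Complex.I * c) = y1
  generalize ellipticGamma p q (Complex.I * d) = y2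
  generalize ellipticGamma p q (Complex.I * e) = y3
  generalize ellipticGamma p q (-Complex.I * c) = y4
  generalize ellipticGamma p q (-Complex.I * d) = y5
  generalize ellipticGamma p q (-Complex.I * e) = y6
  generalize ellipticGammaReg p q 1 = R1
  field_simp
  ring

/-- The ratio does not depend on a and b, so they may be moved to ir and -ir. Letting r → 1 gives
ratio/κ = 4πi/((q; q)_∞ (p; p)_∞), which is 1/κ. -/
lemma betaRatio_eq_one_of_lt {ρ : ℝ} (hp : ‖p‖ < 1) (hq : ‖q‖ < 1) (hp₀ : p ≠ 0) (hq₀ : q ≠ 0)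
    (hρ : 0 < ρ) (hpρ : ‖p‖ ≤ ρ ^ 4) (hqρ : ‖q‖ ≤ ρ)
    (ha : ρ < ‖a‖ ∧ ‖a‖ < 1) (hb : ρ < ‖b‖ ∧ ‖b‖ < 1) (hc : ρ < ‖c‖ ∧ ‖c‖ < 1)
    (hd : ρ < ‖d‖ ∧ ‖d‖ < 1) (he : ρ < ‖e‖ ∧ ‖e‖ < 1) : betaRatio p q a b c d e = 1 := by
  obtain ⟨r₁, hr₁, hr₁'⟩ := exists_between (ha.1.trans ha.2)
  have hr0 : ∀ r ∈ Set.Icc r₁ 1, 0 ≤ r := fun r hr => (hρ.trans (hr₁.trans_le hr.1)).le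
  have hnI : ∀ r ∈ Set.Icc r₁ 1, ‖Complex.I * (r : ℂ)‖ = r := fun r hr => by
    simp [abs_of_nonneg (hr0 r hr)]
  have hnI' : ∀ r ∈ Set.Icc r₁ 1, ‖-Complex.I * (r : ℂ)‖ = r := fun r hr => by
    simp [abs_of_nonneg (hr0 r hr)]
  have near : ∀ r ∈ Set.Icc r₁ 1,
      NearCircle p q (Complex.I * (r : ℂ)) (-Complex.I * (r : ℂ)) c d e ρ := fun r hr =>
    ⟨hρ, hpρ, hqρ, by rw [hnI r hr]; exact ⟨hr₁.trans_le hr.1, hr.2⟩,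
      by rw [hnI' r hr]; exact ⟨hr₁.trans_le hr.1, hr.2⟩, hc, hd, he⟩
  have hsq : ∀ r : ℝ, Complex.I * (r : ℂ) * (-Complex.I * (r : ℂ)) = (r : ℂ) ^ 2 := fun r => by
    linear_combination -(r : ℂ) ^ 2 * Complex.I_sq
  have hR : ∀ r ∈ Set.Icc r₁ 1, ellipticGammaReg p q ((r : ℂ) ^ 2) ≠ 0 := fun r hr => by
    have h1 := near r hr
    rw [← hsq r]
    exact ellipticGammaReg_ne_zero hp hq (h1.norm_mul_lt h1.ha.1 h1.hb.1)
      ((norm_mul_le_left h1.hb.2).trans h1.ha.2)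
  -- The denominators of the integrand and the pole of Γ(ab) = Γ(r²) are removed, so H remains
  -- continuous up to and including r = 1.
  set H : ℝ → ℂ → ℂ := fun r z =>
    betaIntegrandReg p q (Complex.I * (r : ℂ)) (-Complex.I * (r : ℂ)) c d e z *
      (ellipticGammaReg p q ((r : ℂ) ^ 2) *
        betaProductReg p q (Complex.I * (r : ℂ)) (-Complex.I * (r : ℂ)) c d e)⁻¹ with hH
  have hHc : ContinuousOn (fun x : ℝ × ℂ => H x.1 x.2) (Set.Icc r₁ 1 ×ˢ Metric.sphere 0 1) := by
    rintro ⟨r, z⟩ ⟨hr, hz⟩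
    have c1 : Continuous fun x : ℝ × ℂ => Complex.I * (x.1 : ℂ) := by fun_prop
    have c2 : Continuous fun x : ℝ × ℂ => -Complex.I * (x.1 : ℂ) := by fun_prop
    have c3 : Continuous fun x : ℝ × ℂ => (x.1 : ℂ) ^ 2 := by fun_prop
    refine ContinuousAt.continuousWithinAt (ContinuousAt.mul ?_ (ContinuousAt.inv₀ ?_ ?_))
    · exact continuousAt_betaIntegrandReg hp hq (near r hr) c1.continuousAt c2.continuousAt
        continuousAt_snd (mem_sphere_zero_iff_norm.1 hz)
    · refine ContinuousAt.mul (continuousAt_ellipticGammaReg_comp hp hq c3.continuousAt ?_ ?_)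
        (continuousAt_betaProductReg hp hq (near r hr) c1.continuousAt c2.continuousAt)
      · exact pow_ne_zero 2 (Complex.ofReal_ne_zero.2 (hρ.trans (hr₁.trans_le hr.1)).ne')
      · simpa [abs_of_nonneg (hr0 r hr)] using hr.2
    · exact mul_ne_zero (hR r hr) (betaProductReg_ne_zero hp hq (near r hr))
  have hone : (1 : ℝ) ∈ Set.Icc r₁ 1 := ⟨hr₁'.le, le_rfl⟩
  have near1 := near 1 hone
  have hR1 := hR 1 hone
  simp only [Complex.ofReal_one, mul_one, one_pow] at near1 hR1
  have h1 : H 1 Complex.I = 4 * ellipticGammaReg p q 1 := by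
    have hB := betaProductReg_ne_zero hp hq near1
    simp only [hH, Complex.ofReal_one, mul_one, one_pow]
    rw [betaIntegrandReg_I hp hq near1]
    generalize betaProductReg p q Complex.I (-Complex.I) c d e = B at hB ⊢
    generalize ellipticGammaReg p q 1 = R1 at hR1 ⊢
    field_simp
  have h2 : H 1 (-Complex.I) = 4 * ellipticGammaReg p q 1 := by
    rw [← h1]
    simp only [hH]
    rw [← Complex.inv_I, betaIntegrandReg_inv]
  have hX : qPochhammerInf q q * qPochhammerInf p p ≠ 0 :=
    mul_ne_zero (qPochhammerInf_ne_zero hq hq) (qPochhammerInf_ne_zero hp hp)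
  have hπ : (Real.pi : ℂ) ≠ 0 := Complex.ofReal_ne_zero.2 Real.pi_ne_zero
  have hκ : baileyKappa p q ≠ 0 := div_ne_zero hX
    (mul_ne_zero (mul_ne_zero (by norm_num) hπ) Complex.I_ne_zero)
  have key := eq_of_circleIntegral_poissonI_eq (c := betaRatio p q a b c d e / baileyKappa p q)
    (hρ.trans hr₁).le hr₁' hHc h1 h2 ?_
  · rw [ellipticGammaReg_one hp hq, div_eq_iff hκ, baileyKappa] at key
    rw [key]
    have := Complex.I_ne_zero
    generalize qPochhammerInf q q * qPochhammerInf p p = X at hX ⊢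
    field_simp
  · intro r hr
    have hr' : r ∈ Set.Icc r₁ 1 := ⟨hr.1, hr.2.le⟩
    have hlt : ρ < r := hr₁.trans_le hr.1
    rw [betaRatio_eq_of_lt hp hq hp₀ hq₀ hρ hpρ hqρ ha
      (a' := Complex.I * (r : ℂ)) (by rw [hnI r hr']; exact ⟨hlt, hr.2⟩) hb
      (b' := -Complex.I * (r : ℂ)) (by rw [hnI' r hr']; exact ⟨hlt, hr.2⟩) hc hd he]
    have hB := betaProductReg_ne_zero hp hq (near r hr')
    -- The four removed denominators multiply to (1 + r²z²)(1 + r²z⁻²), which is the denominator of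
    -- the Poisson kernel.
    have e1 : (∮ z in C(0, 1), poissonI r z * H r z / z) =
        (1 - (r : ℂ) ^ 4) * (ellipticGammaReg p q ((r : ℂ) ^ 2) *
          betaProductReg p q (Complex.I * (r : ℂ)) (-Complex.I * (r : ℂ)) c d e)⁻¹ *
          betaIntegral p q (Complex.I * (r : ℂ)) (-Complex.I * (r : ℂ)) c d e := by
      rw [betaIntegral, ← circleIntegral.integral_const_mul]
      refine circleIntegral.integral_congr zero_le_one fun z hz => ?_
      have hd : (1 - Complex.I * (r : ℂ) * z) * (1 - Complex.I * (r : ℂ) * z⁻¹) *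
          ((1 - -Complex.I * (r : ℂ) * z) * (1 - -Complex.I * (r : ℂ) * z⁻¹)) =
          (1 + (r : ℂ) ^ 2 * z ^ 2) * (1 + (r : ℂ) ^ 2 * (z ^ 2)⁻¹) := by
        rw [← inv_pow]
        generalize z⁻¹ = y
        have hI := Complex.I_sq
        linear_combination (-(r : ℂ) ^ 2 * (z ^ 2 + y ^ 2) +
          (r : ℂ) ^ 4 * z ^ 2 * y ^ 2 * (Complex.I ^ 2 - 1)) * hI
      simp only [hH]
      rw [betaIntegrand_eq_reg hp hq, hd, poissonI]
      ring
    have hr2 : (1 : ℂ) - (r : ℂ) ^ 2 ≠ 0 := by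
      have : r ^ 2 < 1 := pow_lt_one₀ (hr0 r hr') hr.2 two_ne_zero
      exact_mod_cast (sub_pos.2 this).ne'
    rw [e1, betaRatio, betaProduct_eq_mul_reg, hsq, ellipticGamma_eq_reg_div hp hq]
    have hR' := hR r hr'
    generalize betaProductReg p q (Complex.I * (r : ℂ)) (-Complex.I * (r : ℂ)) c d e = B at hB ⊢
    generalize betaIntegral p q (Complex.I * (r : ℂ)) (-Complex.I * (r : ℂ)) c d e = J
    generalize ellipticGammaReg p q ((r : ℂ) ^ 2) = R at hR' ⊢
    generalize baileyKappa p q = κ at hκ ⊢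
    field_simp
    ring

end

/-! ### Evaluation of the elliptic beta integral -/

section

variable {p q a b c d e : ℂ}

lemma isLinearMap_re_mul (L : ℂ) : IsLinearMap ℝ fun ζ : ℂ => (ζ * L).re :=
  ⟨fun x y => by rw [add_mul, Complex.add_re], fun r x => by simp [mul_assoc]⟩

/-- In logarithmic coordinates the conditions are real-linear inequalities in ζ, so the admissible
set is an intersection of half-planes. -/
lemma betaDomain_exp_iff (hpq : 0 < ‖p * q‖) (A B C D E ζ : ℂ) :
    BetaDomain p q (Complex.exp (ζ * A)) (Complex.exp (ζ * B)) (Complex.exp (ζ * C))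
      (Complex.exp (ζ * D)) (Complex.exp (ζ * E)) ↔
    ((ζ * A).re < 0 ∧ (ζ * B).re < 0 ∧ (ζ * C).re < 0 ∧ (ζ * D).re < 0 ∧ (ζ * E).re < 0 ∧
      Real.log ‖p * q‖ < (ζ * (A + B + C + D + E)).re) := by
  have h1 : ∀ x, ‖Complex.exp (ζ * x)‖ < 1 ↔ (ζ * x).re < 0 := fun x => by
    rw [Complex.norm_exp, Real.exp_lt_one_iff]
  have h2 : ‖p * q‖ < ‖Complex.exp (ζ * A) * Complex.exp (ζ * B) * Complex.exp (ζ * C) *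
      Complex.exp (ζ * D) * Complex.exp (ζ * E)‖ ↔
      Real.log ‖p * q‖ < (ζ * (A + B + C + D + E)).re := by
    rw [← Complex.exp_add, ← Complex.exp_add, ← Complex.exp_add, ← Complex.exp_add, ← mul_add,
      ← mul_add, ← mul_add, ← mul_add, Complex.norm_exp, Real.log_lt_iff_lt_exp hpq]
  rw [← h1, ← h1, ← h1, ← h1, ← h1, ← h2]
  exact ⟨fun h => ⟨h.ha, h.hb, h.hc, h.hd, h.he, h.hA⟩,
    fun ⟨ha, hb, hc, hd, he, hA⟩ => ⟨ha, hb, hc, hd, he, hA⟩⟩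

lemma betaRatio_eq_one (hp : ‖p‖ < 1) (hq : ‖q‖ < 1) (hp₀ : p ≠ 0) (hq₀ : q ≠ 0)
    (h : BetaDomain p q a b c d e) : betaRatio p q a b c d e = 1 := by
  have hpq : 0 < ‖p * q‖ := norm_pos_iff.2 (mul_ne_zero hp₀ hq₀)
  obtain ⟨ha₀, hb₀, hc₀, hd₀, he₀⟩ := h.ne_zero
  set x : ℂ → ℂ → ℂ := fun y ζ => Complex.exp (ζ * Complex.log y) with hx
  have hx1 : ∀ {y : ℂ}, y ≠ 0 → x y 1 = y := fun hy => by
    simp only [hx, one_mul, Complex.exp_log hy]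
  have hxd : ∀ y, Differentiable ℂ (x y) := fun y => by fun_prop
  set U : Set ℂ := {ζ | BetaDomain p q (x a ζ) (x b ζ) (x c ζ) (x d ζ) (x e ζ)} with hU
  have hUeq : U = {ζ | (ζ * Complex.log a).re < 0} ∩ ({ζ | (ζ * Complex.log b).re < 0} ∩
      ({ζ | (ζ * Complex.log c).re < 0} ∩ ({ζ | (ζ * Complex.log d).re < 0} ∩
      ({ζ | (ζ * Complex.log e).re < 0} ∩ {ζ | Real.log ‖p * q‖ < (ζ * (Complex.log a +
        Complex.log b + Complex.log c + Complex.log d + Complex.log e)).re})))) := by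
    ext ζ
    exact betaDomain_exp_iff hpq _ _ _ _ _ ζ
  have hopen : ∀ L : ℂ, IsOpen {ζ : ℂ | (ζ * L).re < 0} := fun L =>
    isOpen_lt (by fun_prop) continuous_const
  have hconv : ∀ L : ℂ, Convex ℝ {ζ : ℂ | (ζ * L).re < 0} := fun L =>
    convex_halfSpace_lt (isLinearMap_re_mul L) 0
  have hUo : IsOpen U := by
    rw [hUeq]
    exact (hopen _).inter ((hopen _).inter ((hopen _).inter ((hopen _).inter ((hopen _).inter
      (isOpen_lt continuous_const (by fun_prop))))))
  have hUc : IsPreconnected U := by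
    rw [hUeq]
    exact ((hconv _).inter ((hconv _).inter ((hconv _).inter ((hconv _).inter ((hconv _).inter
      (convex_halfSpace_gt (isLinearMap_re_mul _) _)))))).isPreconnected
  have h1U : (1 : ℂ) ∈ U := by
    rw [hU, Set.mem_ofPred_eq, hx1 ha₀, hx1 hb₀, hx1 hc₀, hx1 hd₀, hx1 he₀]
    exact h
  have hF : DifferentiableOn ℂ (fun ζ => betaRatio p q (x a ζ) (x b ζ) (x c ζ) (x d ζ) (x e ζ)) U :=
    differentiableOn_betaRatio hp hq hUo (fun ζ hζ => hζ) (hxd a) (hxd b) (hxd c) (hxd d) (hxd e)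
  -- Any ρ < 1 above both |p|^(1/4) and |q| satisfies the smallness conditions of
  -- `betaRatio_eq_one_of_lt`.
  obtain ⟨ρ, hρ, hρ1⟩ := exists_between (max_lt
    (Real.rpow_lt_one (norm_nonneg p) hp (by norm_num : (0 : ℝ) < 1 / 4)) hq)
  obtain ⟨hρp, hρq⟩ := max_lt_iff.1 hρ
  have hρ0 : 0 < ρ := (norm_nonneg q).trans_lt hρq
  have hρp' : ‖p‖ ≤ ρ ^ 4 := by
    have h1 : (‖p‖ ^ (1 / 4 : ℝ)) ^ 4 = ‖p‖ := by
      rw [← Real.rpow_natCast, ← Real.rpow_mul (norm_nonneg p)]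
      norm_num
    rw [← h1]
    exact pow_le_pow_left₀ (Real.rpow_nonneg (norm_nonneg p) _) hρp.le 4
  set V : ℂ → Set ℂ := fun y => {ζ | ρ < ‖x y ζ‖ ∧ ‖x y ζ‖ < 1} with hV
  have hVo : ∀ y, IsOpen (V y) := fun y =>
    (isOpen_lt continuous_const (hxd y).continuous.norm).inter
      (isOpen_lt (hxd y).continuous.norm continuous_const)
  -- As ε → 0⁺, |y^ε| = |y|^ε tends to 1 from below, hence eventually exceeds ρ.
  have hVε : ∀ {y : ℂ}, y ≠ 0 → ‖y‖ < 1 → ∀ᶠ ε : ℝ in 𝓝[>] 0, (ε : ℂ) ∈ V y := by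
    intro y hy hy1
    have hc : Continuous fun ε : ℝ => ‖x y (ε : ℂ)‖ :=
      ((hxd y).continuous.comp Complex.continuous_ofReal).norm
    have h0 : ρ < ‖x y ((0 : ℝ) : ℂ)‖ := by simpa [hx] using hρ1
    filter_upwards [nhdsWithin_le_nhds (hc.continuousAt.eventually (lt_mem_nhds h0)),
      self_mem_nhdsWithin] with ε hε hε0
    refine ⟨hε, ?_⟩
    rw [hx, Complex.norm_exp, Real.exp_lt_one_iff, Complex.re_ofReal_mul, Complex.log_re]
    exact mul_neg_of_pos_of_neg hε0 (Real.log_neg (norm_pos_iff.2 hy) hy1)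
  obtain ⟨ε, va, vb, vc, vd, ve⟩ := ((hVε ha₀ h.ha).and ((hVε hb₀ h.hb).and ((hVε hc₀ h.hc).and
    ((hVε hd₀ h.hd).and (hVε he₀ h.he))))).exists
  have hεU : (ε : ℂ) ∈ U := betaDomain_of_lt hρ0 hρp' hρq.le va vb vc vd ve
  have hev : (fun ζ => betaRatio p q (x a ζ) (x b ζ) (x c ζ) (x d ζ) (x e ζ)) =ᶠ[𝓝 (ε : ℂ)]
      fun _ => 1 := by
    filter_upwards [(hVo a).mem_nhds va, (hVo b).mem_nhds vb, (hVo c).mem_nhds vc,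
      (hVo d).mem_nhds vd, (hVo e).mem_nhds ve] with ζ ga gb gc gd ge
    exact betaRatio_eq_one_of_lt hp hq hp₀ hq₀ hρ0 hρp' hρq.le ga gb gc gd ge
  have := (hF.analyticOnNhd hUo).eqOn_of_preconnected_of_eventuallyEq analyticOnNhd_const hUc hεU
    hev h1U
  simpa only [hx1 ha₀, hx1 hb₀, hx1 hc₀, hx1 hd₀, hx1 he₀] using this

/-- The elliptic beta integral. -/
theorem baileyKappa_mul_betaIntegral (hp : ‖p‖ < 1) (hq : ‖q‖ < 1) (hp₀ : p ≠ 0) (hq₀ : q ≠ 0)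
    (h : BetaDomain p q a b c d e) :
    baileyKappa p q * betaIntegral p q a b c d e = betaProduct p q a b c d e := by
  have := betaRatio_eq_one hp hq hp₀ hq₀ h
  rwa [betaRatio, div_eq_one_iff_eq (betaProduct_ne_zero hp hq h)] at this

end

/-! ### The first integral Bailey lemma -/

lemma continuous_comp_circleMap {f : ℂ → ℂ} (hf : ContinuousOn f (Metric.sphere 0 1)) :
    Continuous fun θ => f (circleMap 0 1 θ) :=
  hf.comp_continuous (continuous_circleMap 0 1) fun θ => circleMap_mem_sphere 0 zero_le_one θ

lemma CircleIntegrable.mul_of_continuousOn_sphere {f g : ℂ → ℂ} (hf : CircleIntegrable f 0 1)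
    (hg : ContinuousOn g (Metric.sphere 0 1)) : CircleIntegrable (fun z => g z * f z) 0 1 :=
  IntervalIntegrable.continuousOn_mul (f := fun θ => f (circleMap 0 1 θ)) hf
    (continuous_comp_circleMap hg).continuousOn

lemma continuousOn_inv_sphere : ContinuousOn (fun z : ℂ => z⁻¹) (Metric.sphere 0 1) :=
  continuousOn_inv₀.mono fun z hz => ne_zero_of_mem_unit_sphere ⟨z, hz⟩

/-- Fubini's theorem for a continuous kernel against an integrable function on the circle. -/
lemma circleIntegral_circleIntegral_swap {B : ℂ → ℂ → ℂ} {α : ℂ → ℂ}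
    (hB : ContinuousOn (fun x : ℂ × ℂ => B x.1 x.2) (Metric.sphere 0 1 ×ˢ Metric.sphere 0 1))
    (hα : CircleIntegrable α 0 1) :
    CircleIntegrable (fun x => (∮ z in C(0, 1), B x z * α z / z) / x) 0 1 ∧
      (∮ x in C(0, 1), (∮ z in C(0, 1), B x z * α z / z) / x) =
        ∮ z in C(0, 1), (∮ x in C(0, 1), B x z / x) * α z / z := by
  set μ : MeasureTheory.Measure ℝ := MeasureTheory.volume.restrict (Set.Ioc 0 (2 * Real.pi)) with hμ
  set c : ℝ → ℂ := circleMap 0 1 with hc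
  have hmem : ∀ θ, c θ ∈ Metric.sphere (0 : ℂ) 1 := fun θ => circleMap_mem_sphere 0 zero_le_one θ
  have hcc : Continuous c := continuous_circleMap 0 1
  have ha : MeasureTheory.Integrable (fun θ => α (c θ)) μ :=
    (intervalIntegrable_iff_integrableOn_Ioc_of_le Real.two_pi_pos.le).1 hα
  have hBc : Continuous fun y : ℝ × ℝ => B (c y.1) (c y.2) :=
    hB.comp_continuous (f := fun y : ℝ × ℝ => (c y.1, c y.2)) (by fun_prop)
      fun y => ⟨hmem _, hmem _⟩
  obtain ⟨M, hM⟩ := ((isCompact_sphere (0 : ℂ) 1).prod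
    (isCompact_sphere (0 : ℂ) 1)).exists_bound_of_continuousOn hB
  -- The kernel is bounded and continuous, and α depends on one variable only, so the product is
  -- integrable for the product of the two finite measures.
  have hint : MeasureTheory.Integrable
      (Function.uncurry fun θ φ => B (c θ) (c φ) * α (c φ)) (μ.prod μ) := by
    have h1 : MeasureTheory.Integrable (fun y : ℝ × ℝ => α (c y.2)) (μ.prod μ) := by
      simpa using (MeasureTheory.integrable_const (1 : ℂ)).mul_prod (μ := μ) (ν := μ) ha
    exact h1.bdd_mul (c := M) hBc.aestronglyMeasurable
      (Eventually.of_forall fun y => hM (c y.1, c y.2) ⟨hmem _, hmem _⟩)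
  have e : ∀ f : ℂ → ℂ, (∮ z in C(0, 1), f z / z) = Complex.I * ∫ θ, f (c θ) ∂μ := fun f => by
    rw [circleIntegral_div_self f one_ne_zero, intervalIntegral.integral_of_le Real.two_pi_pos.le]
  refine ⟨?_, ?_⟩
  · have h1 : CircleIntegrable (fun x => ∮ z in C(0, 1), B x z * α z / z) 0 1 := by
      refine (intervalIntegrable_iff_integrableOn_Ioc_of_le Real.two_pi_pos.le).2 ?_
      simp only [fun x => e fun z => B x z * α z]
      exact hint.integral_prod_left.const_mul _
    simpa only [div_eq_inv_mul] using h1.mul_of_continuousOn_sphere continuousOn_inv_sphere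
  · rw [e, e]
    simp only [fun x => e fun z => B x z * α z, fun z => e fun x => B x z]
    rw [MeasureTheory.integral_const_mul, MeasureTheory.integral_integral_swap hint]
    simp only [mul_assoc, MeasureTheory.integral_mul_const, MeasureTheory.integral_const_mul]

section

variable {p q s t u w x z : ℂ}

lemma ellipticGammaPMPM_eq (a w x : ℂ) : ellipticGammaPMPM p q a w x =
    ellipticGammaPM p q (a * w) x * ellipticGammaPM p q (a * w⁻¹) x := by
  rw [ellipticGammaPMPM, ellipticGammaPM, ellipticGammaPM, mul_assoc (_ * _)]

lemma ellipticGammaPMPM_eq' (a w x : ℂ) : ellipticGammaPMPM p q a w x =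
    ellipticGammaPM p q (a * x) w * ellipticGammaPM p q (a * x⁻¹) w := by
  rw [ellipticGammaPMPM, ellipticGammaPM, ellipticGammaPM, mul_right_comm a x, mul_right_comm a x,
    mul_right_comm a x⁻¹, mul_right_comm a x⁻¹]
  ring

/-- The unimodular w and z drop out of all moduli, so the hypotheses of the theorem are exactly
admissibility of these five parameters. -/
lemma betaDomain_bailey (hs : ‖s‖ < 1) (ht : ‖t‖ < 1) (hu : ‖u‖ < 1)
    (hpq : ‖p * q‖ < ‖t ^ 2 * s ^ 2 * u‖) (hw : ‖w‖ = 1) (hz : ‖z‖ = 1) :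
    BetaDomain p q (s * w) (s * w⁻¹) (t * z) (t * z⁻¹) u := by
  refine ⟨by simpa [hw] using hs, by simpa [hw] using hs, by simpa [hz] using ht,
    by simpa [hz] using ht, hu, hpq.trans_eq ?_⟩
  simp only [norm_mul, norm_pow, norm_inv, hw, hz]
  ring

lemma bailey_product_eq (hw : w ≠ 0) (hz : z ≠ 0) :
    s * w * (s * w⁻¹) * (t * z) * (t * z⁻¹) * u = t ^ 2 * s ^ 2 * u := by
  field_simp

lemma firstBaileyIntegrand_kernel (hw : w ≠ 0) (hz : z ≠ 0) :
    ellipticGammaPMPM p q s w x * ellipticGammaPM p q u x /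
        (ellipticGammaPM p q 1 (x ^ 2) * ellipticGammaPM p q (t ^ 2 * s ^ 2 * u) x) *
      ellipticGammaPMPM p q t x z = betaIntegrand p q (s * w) (s * w⁻¹) (t * z) (t * z⁻¹) u x := by
  rw [betaIntegrand, bailey_product_eq hw hz, ellipticGammaPMPM_eq, ellipticGammaPMPM_eq']
  ring

lemma bailey_betaProduct_algebra {S T P L₁ L₂ R₁ R₂ A₁ A₂ A₃ A₄ U₁ U₂ V : ℂ}
    (hS : S ≠ 0) (hT : T ≠ 0) (hP : P ≠ 0) (hL₁ : L₁ ≠ 0) (hL₂ : L₂ ≠ 0) (hR₁ : R₁ ≠ 0) (hR₂ : R₂ ≠ 0) :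
    P * (L₁ * L₂) / (S * T * (R₁ * R₂)) *
      (S * A₁ * A₂ * R₁ * A₃ * A₄ * R₂ * T * U₁ * U₂ * (L₂⁻¹ * L₁⁻¹ * V⁻¹ * P⁻¹)) =
    A₁ * A₂ * A₃ * A₄ * (U₁ * U₂ * V⁻¹) := by
  field_simp

/-- Each factor to be cancelled is Γ of a divisor of t²s²u whose cofactor has modulus below 1. Its
argument therefore lies in the annulus |pq| < |x| < 1, where Γ has neither zeros nor poles. -/
lemma bailey_betaProduct (hp : ‖p‖ < 1) (hq : ‖q‖ < 1) (hs : ‖s‖ < 1) (ht : ‖t‖ < 1)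
    (hu : ‖u‖ < 1) (hpq : ‖p * q‖ < ‖t ^ 2 * s ^ 2 * u‖) (hw : ‖w‖ = 1) (hz : ‖z‖ = 1) :
    ellipticGamma p q (t ^ 2 * s ^ 2) * ellipticGammaPM p q (t ^ 2 * s * u) w /
        (ellipticGamma p q (s ^ 2) * ellipticGamma p q (t ^ 2) * ellipticGammaPM p q (s * u) w) *
      betaProduct p q (s * w) (s * w⁻¹) (t * z) (t * z⁻¹) u =
    ellipticGammaPMPM p q (s * t) w z *
      (ellipticGammaPM p q (t * u) z / ellipticGammaPM p q (t * s ^ 2 * u) z) := by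
  have hw₀ : w ≠ 0 := norm_pos_iff.1 (by rw [hw]; exact one_pos)
  have hz₀ : z ≠ 0 := norm_pos_iff.1 (by rw [hz]; exact one_pos)
  have hwi : ‖w⁻¹‖ = 1 := by rw [norm_inv, hw, inv_one]
  have m := @norm_mul_lt_one
  have key : ∀ x y, ‖x‖ < 1 → ‖y‖ < 1 → x * y = t ^ 2 * s ^ 2 * u → ellipticGamma p q x ≠ 0 :=
    fun x y hx hy hxy => ellipticGamma_ne_zero_of_mul_eq hp hq hpq hx hy.le hxy
  have hs2 : ‖s ^ 2‖ < 1 := by rw [pow_two]; exact m hs hs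
  have ht2 : ‖t ^ 2‖ < 1 := by rw [pow_two]; exact m ht ht
  have mw : ∀ {x y : ℂ}, ‖x‖ < 1 → ‖y‖ = 1 → ‖x * y‖ < 1 := fun hx hy => by
    rwa [norm_mul, hy, mul_one]
  have := bailey_betaProduct_algebra
    (S := ellipticGamma p q (s ^ 2)) (T := ellipticGamma p q (t ^ 2))
    (P := ellipticGamma p q (t ^ 2 * s ^ 2)) (L₁ := ellipticGamma p q (t ^ 2 * s * u * w))
    (L₂ := ellipticGamma p q (t ^ 2 * s * u * w⁻¹)) (R₁ := ellipticGamma p q (s * u * w))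
    (R₂ := ellipticGamma p q (s * u * w⁻¹)) (A₁ := ellipticGamma p q (s * t * w * z))
    (A₂ := ellipticGamma p q (s * t * w * z⁻¹)) (A₃ := ellipticGamma p q (s * t * w⁻¹ * z))
    (A₄ := ellipticGamma p q (s * t * w⁻¹ * z⁻¹)) (U₁ := ellipticGamma p q (t * u * z))
    (U₂ := ellipticGamma p q (t * u * z⁻¹)) (V := ellipticGammaPM p q (t * s ^ 2 * u) z)
    (key _ (t ^ 2 * u) hs2 (m ht2 hu) (by ring)) (key _ (s ^ 2 * u) ht2 (m hs2 hu) (by ring))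
    (key _ u (m ht2 hs2) hu (by ring))
    (key _ (s * w⁻¹) (mw (m (m ht2 hs) hu) hw) (mw hs hwi) (by field_simp))
    (key _ (s * w) (mw (m (m ht2 hs) hu) hwi) (mw hs hw) (by field_simp))
    (key _ (t ^ 2 * s * w⁻¹) (mw (m hs hu) hw) (mw (m ht2 hs) hwi) (by field_simp))
    (key _ (t ^ 2 * s * w) (mw (m hs hu) hwi) (mw (m ht2 hs) hw) (by field_simp))
  rw [ellipticGammaPMPM, div_eq_mul_inv (ellipticGammaPM p q (t * u) z), ellipticGammaPM,
    ellipticGammaPM, ellipticGammaPM, ← this, betaProduct]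
  rw [show s * w * (s * w⁻¹) = s ^ 2 by field_simp, show s * w * (t * z) = s * t * w * z by ring,
    show s * w * (t * z⁻¹) = s * t * w * z⁻¹ by ring, show s * w * u = s * u * w by ring,
    show s * w⁻¹ * (t * z) = s * t * w⁻¹ * z by ring,
    show s * w⁻¹ * (t * z⁻¹) = s * t * w⁻¹ * z⁻¹ by ring,
    show s * w⁻¹ * u = s * u * w⁻¹ by ring, show t * z * (t * z⁻¹) = t ^ 2 by field_simp,
    show t * z * u = t * u * z by ring, show t * z⁻¹ * u = t * u * z⁻¹ by ring,
    show s * t * w⁻¹ * z * (t * z⁻¹) * u = t ^ 2 * s * u * w⁻¹ by field_simp,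
    show s * t * w * z * (t * z⁻¹) * u = t ^ 2 * s * u * w by field_simp,
    show s ^ 2 * (t * z⁻¹) * u = t * s ^ 2 * u * z⁻¹ by ring,
    show s ^ 2 * (t * z) * u = t * s ^ 2 * u * z by ring,
    show s ^ 2 * (t * z) * (t * z⁻¹) = t ^ 2 * s ^ 2 by field_simp]
  simp only [ellipticGammaPM, div_eq_mul_inv, mul_inv]
  ring

end

theorem mainTheorem11 (p q s t u : ℂ)
    (hp₀ : p ≠ 0) (hq₀ : q ≠ 0) (hp : ‖p‖ < 1) (hq : ‖q‖ < 1)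
    (hs : ‖s‖ < 1) (ht : ‖t‖ < 1) (hu : ‖u‖ < 1)
    (hpq : ‖p * q‖ < ‖t ^ 2 * s ^ 2 * u‖)
    (α β : ℂ → ℂ) (hαβ : IsEllipticBaileyPair p q t α β) :
    (∀ w ∈ Metric.sphere (0 : ℂ) 1,
      CircleIntegrable (firstBaileyIntegrand p q s t u β w) 0 1) ∧
    IsEllipticBaileyPair p q (s * t)
      (firstBaileyAlpha p q s t u α) (firstBaileyBeta p q s t u β) := by
  have hA₀ : t ^ 2 * s ^ 2 * u ≠ 0 := norm_pos_iff.1 ((norm_nonneg _).trans_lt hpq)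
  have hs₀ : s ≠ 0 := fun h => hA₀ (by simp [h])
  have ht₀ : t ≠ 0 := fun h => hA₀ (by simp [h])
  have hu₀ : u ≠ 0 := fun h => hA₀ (by simp [h])
  have hst : ‖s * t‖ < 1 := norm_mul_lt_one hs ht
  have hpqt : ‖p * q‖ < ‖t‖ := hpq.trans_le (by
    rw [show t ^ 2 * s ^ 2 * u = t * (t * s ^ 2 * u) by ring]
    refine norm_mul_le_left (norm_mul_lt_one (norm_mul_lt_one ht ?_) hu).le
    rw [pow_two]
    exact norm_mul_lt_one hs hs)
  have hpqV : ‖p * q‖ < ‖t * s ^ 2 * u‖ := hpq.trans_le (by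
    rw [show t ^ 2 * s ^ 2 * u = t * s ^ 2 * u * t by ring]
    exact norm_mul_le_left ht.le)
  have hn : ∀ z ∈ Metric.sphere (0 : ℂ) 1, ‖z‖ = 1 := fun z hz => mem_sphere_zero_iff_norm.1 hz
  have hz₀ : ∀ z ∈ Metric.sphere (0 : ℂ) 1, z ≠ 0 := fun z hz => ne_zero_of_mem_unit_sphere ⟨z, hz⟩
  have hone : (1 : ℂ) ∈ Metric.sphere (0 : ℂ) 1 := by simp
  have hPM : ∀ a : ℂ, a ≠ 0 → ‖a‖ < 1 →
      ContinuousOn (fun z => ellipticGammaPM p q a z) (Metric.sphere 0 1) := fun a ha ha1 z hz =>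
    (continuousAt_ellipticGammaPM_comp hp hq continuousAt_const continuousAt_id ha ha1
      (hn z hz)).continuousWithinAt
  have hPMi : ∀ a : ℂ, ‖p * q‖ < ‖a‖ →
      ContinuousOn (fun z => (ellipticGammaPM p q a z)⁻¹) (Metric.sphere 0 1) := fun a ha z hz =>
    (continuousAt_ellipticGammaPM_inv_comp hp hq continuousAt_const continuousAt_id ha
      (hn z hz)).continuousWithinAt
  -- At w = 1 the kernel is Γ(t z^±)², so multiplying the integrable integrand by z and the
  -- continuous inverse kernel recovers α.
  have hα : CircleIntegrable α 0 1 := by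
    have h1 := (hαβ 1 hone).1.mul_of_continuousOn_sphere
      (continuousOn_id.fun_mul ((hPMi t hpqt).fun_mul (hPMi t hpqt)))
    refine (circleIntegrable_congr fun z hz => ?_).mp h1
    rw [abs_one] at hz
    have hz' := hn z hz
    have hG : ellipticGammaPM p q t z ≠ 0 := mul_ne_zero
      (ellipticGamma_ne_zero hp hq (by simpa [hz'] using hpqt) (by simpa [hz'] using ht))
      (ellipticGamma_ne_zero hp hq (by simpa [hz'] using hpqt) (by simpa [hz'] using ht))
    have hz0 := hz₀ z hz
    simp only [ellipticGammaPMPM_eq, inv_one, mul_one, id]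
    generalize ellipticGammaPM p q t z = G at hG ⊢
    field_simp
  have hBc : ∀ w ∈ Metric.sphere (0 : ℂ) 1, ContinuousOn (fun y : ℂ × ℂ =>
      betaIntegrand p q (s * w) (s * w⁻¹) (t * y.2) (t * y.2⁻¹) u y.1)
      (Metric.sphere 0 1 ×ˢ Metric.sphere 0 1) := by
    rintro w hw ⟨x, z⟩ ⟨hx, hz⟩
    have h := betaDomain_bailey hs ht hu hpq (hn w hw) (hn z hz)
    obtain ⟨h1, h2, h3, h4, h5⟩ := h.ne_zero
    have c1 : ContinuousAt (fun y : ℂ × ℂ => t * y.2) (x, z) := by fun_prop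
    have c2 : ContinuousAt (fun y : ℂ × ℂ => t * y.2⁻¹) (x, z) := by
      fun_prop (disch := exact hz₀ z hz)
    have g : ∀ {f : ℂ × ℂ → ℂ}, ContinuousAt f (x, z) → f (x, z) ≠ 0 → ‖f (x, z)‖ < 1 →
        ContinuousAt (fun y : ℂ × ℂ => ellipticGammaPM p q (f y) y.1) (x, z) := fun hf h₀ h1 =>
      continuousAt_ellipticGammaPM_comp hp hq hf continuousAt_fst h₀ h1 (hn x hx)
    simp only [betaIntegrand, div_eq_mul_inv, mul_inv]
    exact (((((((g continuousAt_const h1 h.ha).mul (g continuousAt_const h2 h.hb)).mul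
      (g c1 h3 h.hc)).mul (g c2 h4 h.hd)).mul (g continuousAt_const hu₀ hu))).mul
      ((continuousAt_ellipticGammaPM_inv_comp hp hq continuousAt_const (continuousAt_fst.pow 2)
        (by simpa using norm_mul_lt_one hp hq) (by simp [hn x hx])).mul
      (continuousAt_ellipticGammaPM_inv_comp hp hq (((continuousAt_const.mul c1).mul c2).mul
        continuousAt_const) continuousAt_fst h.hA (hn x hx)))).continuousWithinAt
  -- The pair relation is used at the point x; the kernel is symmetric in x and z, so the combined
  -- weight is the beta integrand in the variable x.
  have hκβ : ∀ w ∈ Metric.sphere (0 : ℂ) 1, ∀ x ∈ Metric.sphere (0 : ℂ) 1,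
      firstBaileyIntegrand p q s t u β w x = baileyKappa p q *
        ((∮ z in C(0, 1), betaIntegrand p q (s * w) (s * w⁻¹) (t * z) (t * z⁻¹) u x * α z / z) /
          x) := by
    intro w hw x hx
    have e : (∮ z in C(0, 1), betaIntegrand p q (s * w) (s * w⁻¹) (t * z) (t * z⁻¹) u x * α z / z) =
        ellipticGammaPMPM p q s w x * ellipticGammaPM p q u x /
          (ellipticGammaPM p q 1 (x ^ 2) * ellipticGammaPM p q (t ^ 2 * s ^ 2 * u) x) *
        ∮ z in C(0, 1), ellipticGammaPMPM p q t x z * α z / z := by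
      rw [← circleIntegral.integral_const_mul]
      refine circleIntegral.integral_congr zero_le_one fun z hz => ?_
      simp only [← firstBaileyIntegrand_kernel (x := x) (p := p) (q := q) (s := s) (t := t) (u := u)
        (hz₀ w hw) (hz₀ z hz)]
      ring
    rw [firstBaileyIntegrand, (hαβ x hx).2, e]
    ring
  have hswap := fun w hw => circleIntegral_circleIntegral_swap
    (B := fun x z => betaIntegrand p q (s * w) (s * w⁻¹) (t * z) (t * z⁻¹) u x) (hBc w hw) hα
  refine ⟨fun w hw => ?_, fun w hw => ⟨?_, ?_⟩⟩
  · exact (circleIntegrable_congr fun x hx => (hκβ w hw x (by rwa [abs_one] at hx)).symm).mp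
      (hswap w hw).1.const_smul
  · have hw₀ := hz₀ w hw
    have hst₀ : s * t ≠ 0 := mul_ne_zero hs₀ ht₀
    have h1 := hα.mul_of_continuousOn_sphere (((((hPM (s * t * w) (mul_ne_zero hst₀ hw₀)
      (by rwa [norm_mul, hn w hw, mul_one])).fun_mul (hPM (s * t * w⁻¹) (mul_ne_zero hst₀
      (inv_ne_zero hw₀)) (by rwa [norm_mul, norm_inv, hn w hw, inv_one, mul_one]))).fun_mul
      (hPM (t * u) (mul_ne_zero ht₀ hu₀) (norm_mul_lt_one ht hu))).fun_mul
      (hPMi (t * s ^ 2 * u) hpqV)).fun_mul continuousOn_inv_sphere)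
    refine (congrArg (fun f => CircleIntegrable f 0 1) (funext fun z => ?_)).mp h1
    rw [ellipticGammaPMPM_eq, firstBaileyAlpha]
    ring
  -- Two factors κ are present: one normalises the inner beta integral, the other is the factor in
  -- the pair relation for st.
  · rw [firstBaileyBeta, circleIntegral.integral_congr zero_le_one (hκβ w hw),
      circleIntegral.integral_const_mul, (hswap w hw).2,
      mul_assoc, ← circleIntegral.integral_const_mul, ← circleIntegral.integral_const_mul]
    congr 1
    refine circleIntegral.integral_congr zero_le_one fun z hz => ?_
    have h1 := baileyKappa_mul_betaIntegral hp hq hp₀ hq₀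
      (betaDomain_bailey hs ht hu hpq (hn w hw) (hn z hz))
    have h2 := bailey_betaProduct hp hq hs ht hu hpq (hn w hw) (hn z hz)
    rw [betaIntegral] at h1
    rw [← h1] at h2
    simp only [firstBaileyAlpha]
    linear_combination (α z / z) * h2
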